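/- **Problem.** Let $f:\mathbb R^m\times\mathbb R^d\to\mathbb R^m$, $U_{ad}\subset\mathbb R^d$ closed and convex, $y_0\in\mathbb R^m$, and let $C:\mathbb R^m\to\mathbb R$ be a polynomial of degree at most two. Let $u(y,p)$ be a locally unique minimizer over $U_{ad}$ of $v\mapsto p^{\sf T}f(y,v)$ for $(y,p)$ near the solution below, extended by $u(y,rp)=u(y,p)$ for $r>0$ (for AP4o33va: for $r\ne0$). Put $g(y,p)=f(y,u(y,p))$, $\phi(y,p)=-\nabla_yf(y,u(y,p))^{\sf T}p$. Let $0<T\le T^\ast$, and let $y,p\in C^4[0,T^\ast]$ solve $y'=g(y,p)$, $y(0)=y_0$, $p'=\phi(y,p)$, $p(T)=\nabla C(y(T))^{\sf T}$. In an open tubular neighbourhood of $(y,p)$ let $g,\phi$ be differentiable with $\|\nabla_yg\|\le\Lambda_y$, $\|\nabla_pg\|\le\Lambda_p$, $\|\nabla_y\phi\|\le\Lambda_y^\dagger$, $\|\nabla_p\phi\|\le\Lambda_p^\dagger$, and let $\|\nabla_{yy}C\|\le\Gamma$. **Scheme.** A grid has $N\ge1$, steps $h_0,\dots,h_N>0$,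 $t_0=0$, $t_{n+1}=t_n+h_n$, $t_{N+1}=T$, ratios $\sigma_n=h_n/h_{n-1}$. A four-stage Peer triplet has nodes ${\bf c}\in\mathbb R^4$ and $4\times4$ matrices $(A_0,K_0)$, $(A,K)$, $(A_N,K_N)$, $B(\sigma)$; put $A_n=A$, $K_n=K$ for $1\le n<N$, $a=A_0{\bf 1}$, $w=A_N^{\sf T}{\bf 1}$, $y_h(T)=\sum_jw_jY_{Nj}$, $G(Y,P)=(g(Y_i,P_i))_i$, $\Phi(Y,X)=(\phi(Y_i,X_i))_i$. The discrete problem for $Y_n,P_n\in(\mathbb R^m)^4$, $0\le n\le N$, is (matrices act on stages) $$A_0Y_0=a\otimes y_0+h_0K_0G(Y_0,P_0),\qquad A_nY_n=B(\sigma_n)Y_{n-1}+h_nK_nG(Y_n,P_n)\ (1\le n\le N),$$ $$A_n^{\sf T}P_n=B(\sigma_{n+1})^{\sf T}P_{n+1}-h_n\Phi(Y_n,K_n^{\sf T}P_n)\ (0\le n<N),\qquad A_N^{\sf T}P_N=w\otimes\nabla C(y_h(T))^{\sf T}-h_N\Phi(Y_N,K_N^{\sf T}P_N).$$ Let $c^\ast=\max\{1,c_1,\dots,c_4\}$,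 $\pi_n=[t_n,t_n+h_nc^\ast]$ (all assumed to lie in $[0,T^\ast]$), $\|v\|_{[n]}=\max\{\|v(x)\|:x\in\pi_{n-1}\cup\pi_n\cup\pi_{n+1}\}$ with $\pi_{-1}=\pi_{N+1}=\emptyset$, $\|v^{(3:4)}\|_{[n]}=\max\{\|v^{(3)}\|_{[n]},\|v^{(4)}\|_{[n]}\}$, ${\bf y}_n=(y(t_n+h_nc_j))_j$, ${\bf p}_n=(p(t_n+h_nc_j))_j$. With an invertible weight matrix $W$ belonging to the triplet, let $|||Y|||=\max_n\|W^{-1}Y_n\|_\infty$ and $|||P|||=\max_n\|(AW)^{\sf T}P_n\|_1$ (maximum and sum norm over the stages, Euclidean norm in $\mathbb R^m$). **The four triplets.** Let $V=(c_i^{j-1})$, $\hat A=V^{\sf T}AV$, $\hat k_5=\sum_i\kappa_ic_i^4$, $\hat k_6=\sum_i\kappa_ic_i^5$, $K={\rm diag}(\kappa_i)$. Always $A$ is lower triangular, $\sum_i\kappa_ic_i^k=\frac1{k+1}$ $(0\le k\le3)$, $\hat a_{11}=1$, $\hat a_{ij}=\frac{j-1}{i+j-2}$ for the other $i,j\le3$,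 and $B(\sigma)=V^{-\sf T}\hat B(\sigma)V^{-1}$, $$\hat B=\begin{pmatrix}1&1&1&\hat a_{14}\\0&0&0&\sigma^{-1}(\frac14-\hat a_{14}+\hat a_{24})\\0&0&0&\sigma^{-2}(-\frac12+\hat a_{14}-2\hat a_{24}+\hat a_{34}+2\hat k_5)\\\hat a_{41}&\hat a_{41}+\sigma(\hat a_{42}-\frac14)&\hat a_{41}+\sigma(2\hat a_{42}-\frac12)+\sigma^2(\hat a_{43}-2\hat k_5)&\hat b_{44}(\sigma)\end{pmatrix}.$$ With $\rho=3$ for all triplets except AP4o43vs, where $\rho=4$, the boundary methods satisfy $A_0{\bf c}^k=kK_0{\bf c}^{k-1}$ $(1\le k<\rho)$, $({\bf c}^k)^{\sf T}A_0+k({\bf c}^{k-1})^{\sf T}K_0=({\bf c}^k)^{\sf T}A+k({\bf c}^{k-1})^{\sf T}K$ $(k\le2)$, $A_N{\bf c}^k-kK_N{\bf c}^{k-1}=A{\bf c}^k-kK{\bf c}^{k-1}$, $w^{\sf T}{\bf c}^k=1$ $(k<\rho)$, $A_N^{\sf T}{\bf c}^k+kK_N^{\sf T}{\bf c}^{k-1}=w$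 $(k\le2)$, and ${\bf c}^{\sf T}K_n={\bf 1}^{\sf T}K_n{\rm diag}({\bf c})$ $(n=0,N)$. The triplets are the unique solutions of these equations and of the following data. * AP4o33vg: ${\bf c}=(0,\frac13,\frac23,1)$, $\hat a_{14}=1$, $\hat a_{41}=0$, $K_0=K_N=K$, $(A_0)_{i4}=0$ for $i\le3$, $(A_0)_{41}=-\frac{49}{80}$, $A_N=(\Pi A_0\Pi)^{\sf T}$ with the flip $\Pi$, $\hat b_{44}=\frac{13}{1340}+\frac{\sigma^2}{20}$. * AP4o33vs: ${\bf c}=(\frac{144997}{389708},\frac{73}{748},\frac{77297572}{117896267},1)$, $\hat a_{14}=1$, $\hat a_{41}=0.1010743874247749$, $K_0=K_N=K$, $(A_0)_{i4}=0$ for $i\le3$, $(A_0)_{13}=-0.4047906551114346$, $(A_N)_{1j}=0$ for $j\ge2$, ${\bf c}^{\sf T}A_N{\bf c}^3=\frac{13}{16}$, $\hat b_{44}=0.0078782707622298066+0.1683589306029579\sigma-0.1125\sigma^2+0.025\sigma^3$. * AP4o43vs: ${\bf c}=(\frac{7-\sqrt{29}}{20},\frac12,\frac{3+\sqrt{29}}{10},1)$,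 $\hat a_{14}=1$, $\hat a_{41}=-\frac{157}{359}$, $(A_0)_{14}=(K_0)_{13}=(K_0)_{14}=0$, $(K_0)_{11}=\frac12$, $(K_0)_{12}=1$, $(K_0)_{21}=-1.120097818618729$, $(A_N)_{14}=(K_N)_{14}=0$, $(K_N)_{12}=\frac23$, $(K_N)_{13}=\frac14$, $(K_N)_{21}=-0.4081466631436265$, $\hat b_{44}=\hat a_{41}+3(\hat a_{42}-\frac14)\sigma+(\hat a_{44}-3\hat k_6)\sigma^2+3(\hat a_{43}-2\hat k_5)\sigma^3$. * AP4o33va: ${\bf c}=(0,\frac{53}{34},\frac{6242}{30453},\frac{298}{153})$, $\hat a_{14}=\frac{51}{46}$, $\hat a_{41}=\frac{129}{28}$, $(A_0)_{i4}=(K_0)_{i4}=0$ for $i\le3$, $(K_0)_{11}=-\frac3{38}$, $(K_0)_{12}=-\frac{17}{48}$, $(K_0)_{13}=\frac45$, $(K_0)_{23}=\frac32$, $\sum_j(A_0)_{3j}=-\frac{40}{51}$, $(A_N)_{1j}=(K_N)_{1j}=0$ for $j\ge2$, $(A_N)_{23}=-6$, $(K_N)_{23}=\frac23$, $(K_N)_{24}=\frac{10}{11}$,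 ${\bf 1}^{\sf T}A_N{\bf c}^3=\frac35$, $\hat b_{44}=-\frac{2198}{55}+\frac{1607}{22}\sigma-\frac{147}5\sigma^2$. **Claim.** For each triplet there are constants $\zeta_y,\zeta_p,\zeta_y^\dagger,\zeta_p^\dagger$ depending only on the triplet, such that the following holds if $$(\zeta_y\Lambda_y+\zeta_p\Lambda_p)T\le\tfrac12,\qquad(\zeta_y^\dagger\Lambda_y^\dagger+\zeta_p^\dagger\Lambda_p^\dagger)T+2\Gamma\le\tfrac12 .$$ There is $\varepsilon>0$ such that for all grids of the class named below with sufficiently small $\max_nh_n$ the discrete problem has exactly one solution with $\max\{|||Y-{\bf y}|||,|||P-{\bf p}|||\}\le\varepsilon$. a) For AP4o33vg on grids with $\sigma_n\in[0.5,1.8]$, and for AP4o33vs on grids with $\sigma_n\in[0.65,1.80]$ and $|\sigma_n-1|\le\kappa h_n$, it satisfies $$\max\{|||Y-{\bf y}|||,|||P-{\bf p}|||\}\le\mu\Big(\max_nh_n^3\|y^{(3:4)}\|_{[n]}+\max_nh_n^3\|p^{(3:4)}\|_{[n]}\Big),\qquad(*)$$ where $\mu$ depends only on the triplet, $T$, the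 bounds $\Lambda,\Lambda^\dagger,\Gamma$ and, for AP4o33vs, $\kappa$. b) For AP4o43vs with $\sigma_n\in[0.47,1.79]$ and AP4o33va with $\sigma_n\in[0.61,1.52]$, on grids with $|\sigma_n-1|\le\kappa h_n$, where $K_0$ and $K_N$ are full matrices, the estimate holds with $h_0^3\|p^{(2)}\|_{[0]}+h_N^3\|p^{(2)}\|_{[N]}$ added inside the bracket, with $\mu$ depending only on the triplet, $T$, the bounds and $\kappa$. Moreover $(*)$ itself holds, with a constant that may also depend on the problem and on $(y,p)$, unless $y^{(3)}$ and $p^{(3)}$ both vanish identically on $[0,T]$. -/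

import Mathlib

open Set Filter Topology
open scoped BigOperators Matrix RealInnerProductSpace

noncomputable section

/-! ### Peer triplets with four stages -/

/-- The coefficients of a four-stage Peer triplet: node vector `c`, starting step `(A0, K0)`,
standard step `(A, K)`, end step `(AN, KN)`, the free entry `b44` of the transformed matrix
`V^T B(σ) V`, and the weight matrix `W` that defines the norms. -/
structure PeerTriplet where
  c : Fin 4 → ℝ
  A0 : Matrix (Fin 4) (Fin 4) ℝ
  K0 : Matrix (Fin 4) (Fin 4) ℝ
  A : Matrix (Fin 4) (Fin 4) ℝ
  K : Matrix (Fin 4) (Fin 4) ℝ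
  AN : Matrix (Fin 4) (Fin 4) ℝ
  KN : Matrix (Fin 4) (Fin 4) ℝ
  W : Matrix (Fin 4) (Fin 4) ℝ
  b44 : ℝ → ℝ

namespace PeerTriplet

variable (M : PeerTriplet)

/-- The Vandermonde matrix `V = (1, c, c^2, c^3)`. -/
def V : Matrix (Fin 4) (Fin 4) ℝ := Matrix.of fun i j => M.c i ^ (j : ℕ)

/-- `V^T A V` -/
def hatA : Matrix (Fin 4) (Fin 4) ℝ := M.Vᵀ * M.A * M.V

/-- `V^T K V` -/
def hatK : Matrix (Fin 4) (Fin 4) ℝ := M.Vᵀ * M.K * M.V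

/-- `V^T B(σ) V`. Its last entry is free, the others are forced by the order conditions;
`hatK 2 2 = ∑ i, κ_i c_i ^ 4`. -/
def hatB (σ : ℝ) : Matrix (Fin 4) (Fin 4) ℝ :=
  !![1, 1, 1, M.hatA 0 3;
     0, 0, 0, σ⁻¹ * (1 / 4 - M.hatA 0 3 + M.hatA 1 3);
     0, 0, 0, (σ ^ 2)⁻¹ *
        (-1 / 2 + M.hatA 0 3 - 2 * M.hatA 1 3 + M.hatA 2 3 + 2 * M.hatK 2 2);
     M.hatA 3 0,
       M.hatA 3 0 + σ * (M.hatA 3 1 - 1 / 4),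
       M.hatA 3 0 + σ * (2 * M.hatA 3 1 - 1 / 2) + σ ^ 2 * (M.hatA 3 2 - 2 * M.hatK 2 2),
       M.b44 σ]

/-- The coefficient matrix `B(σ)` for the stepsize ratio `σ`. -/
def B (σ : ℝ) : Matrix (Fin 4) (Fin 4) ℝ := (M.V⁻¹)ᵀ * M.hatB σ * M.V⁻¹

/-- The vector `a = A0 1` of the starting step. -/
def a : Fin 4 → ℝ := fun i => ∑ j, M.A0 i j

/-- The vector `w = AN^T 1` of the end step. -/
def w : Fin 4 → ℝ := fun j => ∑ i, M.AN i j

/-- `c* = max {c_1, ..., c_4, 1}` -/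
def cstar : ℝ := max 1 (⨆ i, M.c i)

/-- The matrix `A_n` used in step `n` of a grid with steps `0, ..., N`. -/
def stepA (N n : ℕ) : Matrix (Fin 4) (Fin 4) ℝ :=
  if n = 0 then M.A0 else if n = N then M.AN else M.A

/-- The matrix `K_n` used in step `n` of a grid with steps `0, ..., N`. -/
def stepK (N n : ℕ) : Matrix (Fin 4) (Fin 4) ℝ :=
  if n = 0 then M.K0 else if n = N then M.KN else M.K

end PeerTriplet

/-! ### The four triplets -/

/-- The triplet `AP4o33vg` (general grids). -/
def AP4o33vg : PeerTriplet where
  c := ![0, 1 / 3, 2 / 3, 1]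
  A0 := !![49 / 80, 3 / 4, -3 / 16, 0;
         -87 / 80, 0, 9 / 16, 0;
         87 / 80, -9 / 4, 27 / 16, 0;
         -49 / 80, 3 / 2, -33 / 16, 1]
  K0 := Matrix.diagonal ![1 / 8, 3 / 8, 3 / 8, 1 / 8]
  A := !![1, 0, 0, 0;
         -9 / 4, 9 / 4, 0, 0;
         9 / 4, -9 / 2, 9 / 4, 0;
         -1, 9 / 4, -9 / 4, 1]
  K := Matrix.diagonal ![1 / 8, 3 / 8, 3 / 8, 1 / 8]
  AN := !![1, 0, 0, 0;
         -33 / 16, 27 / 16, 9 / 16, -3 / 16;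
         3 / 2, -9 / 4, 0, 3 / 4;
         -49 / 80, 87 / 80, -87 / 80, 49 / 80]
  KN := Matrix.diagonal ![1 / 8, 3 / 8, 3 / 8, 1 / 8]
  W := !![1, -2, 24 / 5, -9 / 2;
         1, -4 / 3, 0, 3 / 2;
         1, -2 / 3, -8 / 5, 3 / 2;
         1, 0, 0, 0]
  b44 := fun σ => 13 / 1340 + σ ^ 2 / 20

/-- The triplet `AP4o33vs` (smooth grids). The entries are the exact rational numbers of which the
published coefficients are double precision roundings. They satisfy the order conditions exactly;
parameters that these conditions leave free are fixed by the zero entries and by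
`1^T A c^3 = 1`, `(c^3)^T A 1 = 0.1010743874247749`, `A0 0 2 = -0.4047906551114346`,
`c^T AN c^3 = 13 / 16`. -/
def AP4o33vs : PeerTriplet where
  c := ![144997 / 389708, 73 / 748, 77297572 / 117896267, 1]
  A0 := !![8281646356661811825395607847920912558399795526876030730047 / 2986338303021381471359882172842405693495102250000000000000,
            -128819107296324629571447051393667037353278284476116429149 / 22552469649774910592212742189579330843928750000000000000,
            -2023953275557173 / 5000000000000000,
            0;
         -25911518439326433147524329441639332203226530187510701 / 93341751545660035102417428671794465968750000000000000,
            2061982661625870111828469125140462336097386228100202829 / 787408722817893085374680853633387646718750000000000000,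
            716998841799783398810030702640259 / 5009323850951986875000000000000000,
            0;
         -2065242504997648635398435946330249511298616832062617711 / 404806778600781251793237562862987967168750000000000000,
            1315450666508905085745712366377518566575244254237280720639 / 276603117501836260580032635260720536498218750000000000000,
            300686356923095678191623751898924825380656558005024711 / 105988358080979504006143360575043792125000000000000000,
            0;
         16406744423421072375867916159590613336774477175324469842432423381149 / 6295228507965252712554922062349009652009078435619656250000000000000,
            -200079272095801302500859071059037636457296200959245549719719384487 / 120351755801148167227408945147097962153785128279218750000000000000,
            -1364768383391087836051593502102076885525447867422978507 / 529941790404897520030716802875218960625000000000000000,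
            1]
  K0 := Matrix.diagonal ![25982350207311084154 / 124344072815832575433,
           63771896929526 / 259102003261725,
           1638702673237269698866163 / 3847074841169755689753630,
           117896267 / 991079550]
  A := !![6552647818781535735043072853406759 / 8635005056655039960625000000000000, 0, 0, 0;
         351944198939810261712903888209 / 809693760192890625000000000000,
            775953716651608 / 1295510016308625,
            0,
            0;
         -3285588134733243356086467543907560915501143265461 / 997081660312137620072034896443640625000000000000,
            -629412406689715491787 / 1714240522184141673150,
            193196927897594902768534750313521 / 78093109059412177236411124756425,
            0;
         16412015903034210832025849308477575005404557937 / 7808945338179218940715892711953125000000000000,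
            -53641241513290648195619 / 231422470494859125875250,
            -193196927897594902768534750313521 / 78093109059412177236411124756425,
            1]
  K := Matrix.diagonal ![25982350207311084154 / 124344072815832575433,
           63771896929526 / 259102003261725,
           1638702673237269698866163 / 3847074841169755689753630,
           117896267 / 991079550]
  AN := !![6552647818781535735043072853406759 / 8635005056655039960625000000000000, 0, 0, 0;
         283689851011253697894744188091259108070461327423 / 2581554355793591575726175729503359375000000000000,
            94516346265281289516543728 / 132413901566546257473076875,
            3722334793655584556745719401414078664 / 12779292282626490064627774582328959125,
            -267802929636563290376 / 3292188420470883913125;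
         -165351759597685642561683405310951658538428580676326127 / 155270722839682233092557647345939835171875000000000000,
            -886399380022998417783581043014 / 766922478408593012203368382725,
            728133429649357787512682777311028544260021 / 1537252117624316056457343137175483855358050,
            1638702673237269698866163 / 2933521065903520929917550;
         448754568501088249204776138013838149561216543 / 304244623565424114573346469296875000000000000,
            -14463091503698769235537 / 1420092432582090090598125,
            -5758798921642884466307038889555567 / 3012162778005898264833000526319250,
            4579272048587221841 / 5431932410110278750]
  KN := Matrix.diagonal ![25982350207311084154 / 124344072815832575433,
           63771896929526 / 259102003261725,
           1638702673237269698866163 / 3847074841169755689753630,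
           117896267 / 991079550]
  W := !![1, -49 / 3, -4, 27;
         1, -47 / 2, 33, -95 / 3;
         1, -9, -52 / 3, 119 / 5;
         1, 0, 0, 0]
  b44 := fun σ => 0.0078782707622298066 + 0.1683589306029579 * σ - 0.1125 * σ ^ 2 + 0.025 * σ ^ 3

/-- The triplet `AP4o43vs` (smooth grids), with entries in `ℚ(√29)`. The entries are the exact numbers
of which the published coefficients are double precision roundings. They satisfy the order
conditions exactly; parameters that these conditions leave free are fixed by the zero entries, by
`1^T A c^3 = 1`, `(c^3)^T A 1 = -157 / 359`, and by the rational entries of the first rows and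
the entries `(1, 0)` of `K0` and `KN`. -/
def AP4o43vs : PeerTriplet where
  c := ![(7 - √29) / 20, 1 / 2, (3 + √29) / 10, 1]
  A0 := !![(119 - 33 * √29) / 26, (-23 + 6 * √29) / 5, (68 + 9 * √29) / 130, 0;
         (1103 + 774 * √29) / 455,
            (71 - 82 * √29) / 75,
            (-7417 - 1321 * √29) / 3900,
            (17 - 4 * √29) / 210;
         (-119167 - 21321 * √29) / 10920,
            (2497 + 361 * √29) / 600,
            (64543 + 11759 * √29) / 15600,
            (149 + 37 * √29) / 1680;
         (8543 + 3321 * √29) / 2184,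
            (-61 - 85 * √29) / 120,
            (-8607 - 1511 * √29) / 3120,
            (279 - √29) / 336]
  K0 := !![1 / 2, 1, 0, 0;
         -1120097818618729 / 1000000000000000,
            (-138877990810785975 - 32857358897294317 * √29) / 90000000000000000,
            (2857493902632169 + 248555221608707 * √29) / 180000000000000000,
            (5516095070311001 - 3533837427020073 * √29) / 180000000000000000;
         (155286704482913017 + 27683814926130431 * √29) / 156000000000000000,
            (625754671848518509 + 111689751545923097 * √29) / 180000000000000000,
            (223631368156995041 + 1617027049694733 * √29) / 4680000000000000000,
            (6386861989140511 + 1922076691882951 * √29) / 72000000000000000;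
         (-57066162572979927 - 6522054190993309 * √29) / 84000000000000000,
            (-343498690226946559 - 62475033751334463 * √29) / 180000000000000000,
            (1578058313454901 + 360315956745829 * √29) / 72000000000000000,
            (186734499395728101 - 55298960237622263 * √29) / 2520000000000000000]
  A := !![(181302 - 15874 * √29) / 32669, 0, 0, 0;
         (-35434 - 3142 * √29) / 5385, (-4 + 8 * √29) / 15, 0, 0;
         (1019699 + 201437 * √29) / 140010, (-63 - 19 * √29) / 30, (413 + 69 * √29) / 390, 0;
         (-408531 - 24133 * √29) / 65338, (71 + 3 * √29) / 30, (-413 - 69 * √29) / 390, 1]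
  K := Matrix.diagonal ![(-37 + 19 * √29) / 273, (13 - √29) / 15, (89 + 7 * √29) / 780, (13 - √29) / 84]
  AN := !![(10202077 + 124611 * √29) / 5096364, (181 - 47 * √29) / 60, (2693 + 1384 * √29) / 5070, 0;
         (-8074093 - 813049 * √29) / 1960140,
            (116 + 183 * √29) / 150,
            (-14601 - 3113 * √29) / 3900,
            (17 - 4 * √29) / 70;
         (115739614 + 21295257 * √29) / 25481820,
            (-3609 - 767 * √29) / 600,
            (1510637 + 275581 * √29) / 202800,
            (149 + 37 * √29) / 560;
         (-950566 - 174595 * √29) / 392028,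
            (267 + 101 * √29) / 120,
            (-13217 - 2601 * √29) / 3120,
            (55 - √29) / 112]
  KN := !![(-1255 + 369 * √29) / 2184, 2 / 3, 1 / 4, 0;
         -816293326287253 / 2000000000000000,
            (-55634001585368075 - 64660080190244169 * √29) / 180000000000000000,
            (-214911435497554667 - 26406319175608601 * √29) / 360000000000000000,
            (44112237399996357 - 9273520443903061 * √29) / 360000000000000000;
         (205348078076420069 + 5335439725202867 * √29) / 312000000000000000,
            (749790168307328713 + 171627281458538629 * √29) / 360000000000000000,
            (9071061479740958637 + 1533411853224296681 * √29) / 9360000000000000000,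
            (-3985356892678573 + 2080240570732507 * √29) / 144000000000000000;
         (60073520443903061 - 24642159852032313 * √29) / 168000000000000000,
            (-623522165136592563 - 57307121078050291 * √29) / 360000000000000000,
            (-69051756258531343 - 11413039302438047 * √29) / 144000000000000000,
            (106916167643801057 + 12020866239005109 * √29) / 5040000000000000000]
  W := !![1, -11 / 6, 25 / 6, -7 / 6;
         1, -1, -3 / 2, 1;
         1, -1 / 3, -3 / 2, -2 / 5;
         1, 0, 0, 0]
  b44 := fun σ => -157 / 359 + (-23277 + 4351 * √29) / 71800 * σ
      + (-1256323 + 189649 * √29) / 21540000 * σ ^ 2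
      + (-151739 + 30457 * √29) / 718000 * σ ^ 3

/-- The triplet `AP4o33va` (A-stable, smooth grids, some negative quadrature weights). The entries
are the exact rational numbers of which the published coefficients are double precision roundings.
They satisfy the order conditions exactly; parameters that these conditions leave free are fixed by
the zero entries, the short rational entries and by `1^T A c^3 = 51 / 46`,
`(c^3)^T A 1 = 129 / 28`, `1^T AN c^3 = 3 / 5` and the third row sum `-40 / 51` of `A0`. -/
def AP4o33va : PeerTriplet where
  c := ![0, 53 / 34, 6242 / 30453, 298 / 153]
  A0 := !![-3360804935917409784077 / 1181241174239905321440,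
            -34169073721 / 84695608020,
            64611832056489 / 13299873843040,
            0;
         -5194586570290872755837 / 1557818173876027227570,
            23471720221912324 / 207768214685296335,
            9627162976416861 / 2613436662708130,
            0;
         134101699579996321657261 / 48651544779289581135360,
            37131680018829054985297 / 53557817608309089229120,
            -106826774422098998687555079 / 25230784717816251695710720,
            0;
         73554053167633388904514471569 / 28597298632458950756161569280,
            2354547410756262531 / 6151323662496326720,
            -8658652779362018095317 / 2897853758588835576320,
            -16506860481 / 64929970784]
  K0 := !![-3 / 38, -17 / 48, 4 / 5, 0;
         -1532528735629247 / 3009107909538570, -4715146524607 / 79187050251015, 3 / 2, 0;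
         -99922146170409287833 / 357731946906541037760,
            11630104009993291 / 24130723749576960,
            10281739266497 / 1003517599701920,
            0;
         126107325087474779 / 288572983635818560,
            105288618726443 / 407732933431040,
            -57986673 / 54133120,
            -1524191661 / 11292168832]
  A := !![-8837658565 / 1380206072, 0, 0, 0;
         -21960634306 / 3640425257, 3692264 / 8814589, 0, 0;
         16111779184659955389 / 2196599673987532688,
            4377567314883 / 25136170572476,
            95560369541330409 / 47366030705930624,
            0;
         159741380347524585 / 37590914400528272,
            779329966798701 / 4046923462168636,
            -760011359883777747 / 1089418706236404352,
            -16506860481 / 64929970784]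
  K := Matrix.diagonal ![-1601791 / 3720232,
           54298 / 166313,
           994734086776401 / 802814079761536,
           -1524191661 / 11292168832]
  AN := !![-8837658565 / 1380206072, 0, 0, 0;
         -36028157254190928887333211 / 37820660966989231362120152,
            118350610006228722641373 / 63457484843941663359262,
            -6,
            -375343781401772973401733 / 713597376735645874756984;
         48162480358229964065984608729 / 7086964107138107936004222976,
            41136287517715072963 / 136069933794031200512,
            449581018624894909847992037487 / 173501455547043205137877368832,
            -1349754683742117508277467611 / 8283151834831604474701611008;
         9590701255199888878459214281233 / 18233320416319750192660006031360,
            -2617339091896348130989205223471 / 3435151641955275335626532957440,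
            3189623002633976511735373046229 / 867507277735216025689386844160,
            7361408060899381734099292674027 / 149176080793995483358213566300160]
  KN := !![-1601791 / 3720232, 0, 0, 0;
         -907614840765569118477499 / 1196626857057185651917512,
            -27966824299438984513537 / 56982231288437411996072,
            2 / 3,
            10 / 11;
         -488856487023922780697818371755 / 1138069270134920810511266838528,
            4180534712906586370117877 / 45581114632125953641111296,
            342256056102937133710019 / 192305326809587038550016,
            -6039845 / 29773216;
         598790459472661981970467177 / 918050645761510743439648768,
            245913806641563904124581 / 770176716242878140469504,
            -1401781 / 2706656,
            -10195781120373211758479325 / 17321710297386995159238656]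
  W := !![1, -2, 6, 2.509523385281405;
         1, 1.117647058823529, 12.32698961937716, 7.052310433008046;
         1, -1.590056808852987, 1.836922096090924, 0.5167228373603610;
         1, 1.895424836601307, 27.53940792003076, 16.07292401233786]
  b44 := fun σ => -2198 / 55 + 1607 / 22 * σ - 147 / 5 * σ ^ 2

/-! ### The optimal control problem and its reduced boundary value problem -/

/-- `ℝ^m` with the Euclidean norm. -/
abbrev Vec (m : ℕ) : Type := EuclideanSpace ℝ (Fin m)

/-- The data of the problem: minimize `C (y T)` subject to `y' = f (y, u)`, `y 0 = y0` and
`u t ∈ Uad`. -/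
structure ControlProblem (m d : ℕ) where
  f : Vec m → Vec d → Vec m
  C : Vec m → ℝ
  Uad : Set (Vec d)
  y0 : Vec m

variable {m d : ℕ}

/-- `g(y, p) = f(y, u(y, p))` -/
def ControlProblem.g (Q : ControlProblem m d) (u : Vec m → Vec m → Vec d) (y p : Vec m) : Vec m :=
  Q.f y (u y p)

/-- `φ(y, p) = -(∇_y f(y, u(y, p)))^T p` -/
def ControlProblem.phi (Q : ControlProblem m d) (u : Vec m → Vec m → Vec d) (y p : Vec m) :
    Vec m :=
  -(ContinuousLinearMap.adjoint (fderiv ℝ (fun x => Q.f x (u y p)) y) p)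

/-- `C` is a real polynomial function of degree at most two. -/
def IsQuadratic (C : Vec m → ℝ) : Prop :=
  ∃ (c₀ : ℝ) (b : Vec m) (S : Vec m →L[ℝ] Vec m), IsSelfAdjoint S ∧
    ∀ y, C y = c₀ + ⟪b, y⟫ + (1 / 2) * ⟪S y, y⟫

/-- The open tubular neighbourhood of radius `ρ` of the curve `(y, p)` over `[0, Tstar]`. -/
def tube (Tstar : ℝ) (y p : ℝ → Vec m) (ρ : ℝ) : Set (Vec m × Vec m) :=
  {z | ∃ t ∈ Icc 0 Tstar, ‖z.1 - y t‖ < ρ ∧ ‖z.2 - p t‖ < ρ}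

/-- Control uniqueness on the set `D` of pairs `(y, p)`: `u y p` is a locally unique minimizer over
`Uad` of the Hamiltonian `v ↦ p^T f(y, v)`. As the Hamiltonian is linear in `p`, scaling `p` does not
change `u`; the set `Λ` holds the scaling factors for which this is used. -/
structure IsControlLaw (Q : ControlProblem m d) (u : Vec m → Vec m → Vec d) (Λ : Set ℝ)
    (D : Set (Vec m × Vec m)) : Prop where
  mem : ∀ z ∈ D, u z.1 z.2 ∈ Q.Uad
  minimizer : ∀ z ∈ D, ∃ δ > 0, ∀ v ∈ Q.Uad, v ≠ u z.1 z.2 → ‖v - u z.1 z.2‖ < δ →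
    ⟪z.2, Q.f z.1 (u z.1 z.2)⟫ < ⟪z.2, Q.f z.1 v⟫
  scaling : ∀ z ∈ D, ∀ r ∈ Λ, u z.1 (r • z.2) = u z.1 z.2

/-- Bounds for the partial derivatives of `g` and `φ` and for the Hessian of the objective
function. -/
structure Bounds where
  dyG : ℝ
  dpG : ℝ
  dyPhi : ℝ
  dpPhi : ℝ
  hessC : ℝ

/-- On the set `D`, the functions `g` and `φ` are differentiable with partial derivatives bounded
as prescribed. -/
structure HasDerivBounds (Q : ControlProblem m d) (u : Vec m → Vec m → Vec d) (L : Bounds)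
    (D : Set (Vec m × Vec m)) : Prop where
  diff_f : ∀ z ∈ D, DifferentiableAt ℝ (fun x => Q.f x (u z.1 z.2)) z.1
  diff_g : ∀ z ∈ D, DifferentiableAt ℝ (fun x : Vec m × Vec m => Q.g u x.1 x.2) z
  diff_phi : ∀ z ∈ D, DifferentiableAt ℝ (fun x : Vec m × Vec m => Q.phi u x.1 x.2) z
  dyG_le : ∀ z ∈ D, ‖fderiv ℝ (fun x => Q.g u x z.2) z.1‖ ≤ L.dyG
  dpG_le : ∀ z ∈ D, ‖fderiv ℝ (fun x => Q.g u z.1 x) z.2‖ ≤ L.dpG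
  dyPhi_le : ∀ z ∈ D, ‖fderiv ℝ (fun x => Q.phi u x z.2) z.1‖ ≤ L.dyPhi
  dpPhi_le : ∀ z ∈ D, ‖fderiv ℝ (fun x => Q.phi u z.1 x) z.2‖ ≤ L.dpPhi

/-- The standing assumptions: `(y, p)` is a solution of class `C^4` on `[0, Tstar]` of the reduced
boundary value problem `y' = g(y, p)`, `y 0 = y0`, `p' = φ(y, p)`, `p T = ∇C(y T)` of an optimal
control problem with closed convex set of controls and an objective function that is polynomial of
degree at most two; control uniqueness and the derivative bounds hold in a tubular neighbourhood. -/
structure IsRegularSolution (Q : ControlProblem m d) (u : Vec m → Vec m → Vec d) (Λ : Set ℝ)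
    (L : Bounds) (T Tstar : ℝ) (y p : ℝ → Vec m) : Prop where
  T_pos : 0 < T
  T_le : T ≤ Tstar
  closed_Uad : IsClosed Q.Uad
  convex_Uad : Convex ℝ Q.Uad
  quadratic : IsQuadratic Q.C
  hessC_le : ∀ x, ‖fderiv ℝ (gradient Q.C) x‖ ≤ L.hessC
  smooth_y : ContDiffOn ℝ 4 y (Icc 0 Tstar)
  smooth_p : ContDiffOn ℝ 4 p (Icc 0 Tstar)
  deriv_y : ∀ t ∈ Icc 0 Tstar, HasDerivWithinAt y (Q.g u (y t) (p t)) (Icc 0 Tstar) t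
  deriv_p : ∀ t ∈ Icc 0 Tstar, HasDerivWithinAt p (Q.phi u (y t) (p t)) (Icc 0 Tstar) t
  init_y : y 0 = Q.y0
  final_p : p T = gradient Q.C (y T)
  tubular : ∃ ρ > 0, IsControlLaw Q u Λ (tube Tstar y p ρ) ∧
    HasDerivBounds Q u L (tube Tstar y p ρ)

/-- The constants `ζ_y, ζ_p, ζ_y^†, ζ_p^†`. -/
structure Zeta where
  y : ℝ
  p : ℝ
  y' : ℝ
  p' : ℝ

/-- The smallness conditions of the fixed point argument (number of stages `s = 4`). -/
def Contractive (ζ : Zeta) (L : Bounds) (T : ℝ) : Prop :=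
  (ζ.y * L.dyG + ζ.p * L.dpG) * T ≤ 1 / 2 ∧
  (ζ.y' * L.dyPhi + ζ.p' * L.dpPhi) * T + (4 : ℝ) / 2 * L.hessC ≤ 1 / 2

/-! ### Grids -/

/-- `t_n = h_0 + ... + h_{n-1}` -/
def gridPoint (h : ℕ → ℝ) (n : ℕ) : ℝ := ∑ k ∈ Finset.range n, h k

/-- The stepsize ratio `σ_n = h_n / h_{n-1}`, `n ≥ 1`. -/
def ratio (h : ℕ → ℝ) (n : ℕ) : ℝ := h n / h (n - 1)

/-- `π_n = [t_n, t_n + h_n c*]` -/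
def cell (M : PeerTriplet) (h : ℕ → ℝ) (n : ℕ) : Set ℝ :=
  Icc (gridPoint h n) (gridPoint h n + h n * M.cstar)

/-- A grid `0 = t_0 < t_1 < ... < t_{N+1} = T` with steps `h_0, ..., h_N` and ratios in
`[lo, hi]`; all intervals `π_n` lie in `[0, Tstar]`. -/
structure IsGrid (M : PeerTriplet) (lo hi T Tstar : ℝ) (N : ℕ) (h : ℕ → ℝ) : Prop where
  one_le : 1 ≤ N
  pos : ∀ n ≤ N, 0 < h n
  sum_eq : gridPoint h (N + 1) = T
  ratio_mem : ∀ n, 1 ≤ n → n ≤ N → ratio h n ∈ Icc lo hi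
  cell_subset : ∀ n ≤ N, cell M h n ⊆ Icc 0 Tstar

/-- Smooth grids: `σ_n = 1 + O(h_n)` with the constant `κ`. -/
def IsSmoothGrid (κ : ℝ) (N : ℕ) (h : ℕ → ℝ) : Prop :=
  ∀ n, 1 ≤ n → n ≤ N → |ratio h n - 1| ≤ κ * h n

/-! ### The discrete boundary value problem -/

/-- The action of `X ⊗ I_m` on a vector of stages. -/
def stageMul (X : Matrix (Fin 4) (Fin 4) ℝ) (Y : Fin 4 → Vec m) : Fin 4 → Vec m :=
  fun i => ∑ j, X i j • Y j

/-- The approximation `y_h(T) = (w^T ⊗ I_m) Y_N` at the end point. -/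
def endValue (M : PeerTriplet) (Y : Fin 4 → Vec m) : Vec m := ∑ j, M.w j • Y j

/-- `(Y, P) = (Y_n, P_n)`, `0 ≤ n ≤ N`, solves the discrete boundary value problem: the forward
starting step, the forward steps, the adjoint steps and the adjoint end step. -/
structure IsDiscreteSolution (M : PeerTriplet) (Q : ControlProblem m d)
    (u : Vec m → Vec m → Vec d) (N : ℕ) (h : ℕ → ℝ) (Y P : ℕ → Fin 4 → Vec m) : Prop where
  start : ∀ i, stageMul M.A0 (Y 0) i =
    M.a i • Q.y0 + h 0 • stageMul M.K0 (fun j => Q.g u (Y 0 j) (P 0 j)) i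
  forward : ∀ n, 1 ≤ n → n ≤ N → ∀ i, stageMul (M.stepA N n) (Y n) i =
    stageMul (M.B (ratio h n)) (Y (n - 1)) i +
      h n • stageMul (M.stepK N n) (fun j => Q.g u (Y n j) (P n j)) i
  adjoint : ∀ n < N, ∀ i, stageMul (M.stepA N n)ᵀ (P n) i =
    stageMul (M.B (ratio h (n + 1)))ᵀ (P (n + 1)) i -
      h n • Q.phi u (Y n i) (stageMul (M.stepK N n)ᵀ (P n) i)
  final : ∀ i, stageMul M.ANᵀ (P N) i =
    M.w i • gradient Q.C (endValue M (Y N)) -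
      h N • Q.phi u (Y N i) (stageMul M.KNᵀ (P N) i)

/-! ### Norms, error bounds and convergence -/

/-- The vector `(v(t_n + h_n c_j))_j` of exact values in step `n`. -/
def exactStages (M : PeerTriplet) (h : ℕ → ℝ) (v : ℝ → Vec m) (n : ℕ) : Fin 4 → Vec m :=
  fun j => v (gridPoint h n + h n * M.c j)

/-- `|||Y - y||| = max_n ‖W⁻¹ (Y_n - y_n)‖_∞` -/
def stateError (M : PeerTriplet) (y : ℝ → Vec m) (N : ℕ) (h : ℕ → ℝ)
    (Y : ℕ → Fin 4 → Vec m) : ℝ :=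
  ⨆ n : Fin (N + 1), ⨆ i : Fin 4,
    ‖stageMul M.W⁻¹ (fun j => Y n j - exactStages M h y n j) i‖

/-- `|||P - p||| = max_n ‖(W^†)⁻¹ (P_n - p_n)‖_1`, where `(W^†)⁻¹ = (A W)^T`. -/
def adjointError (M : PeerTriplet) (p : ℝ → Vec m) (N : ℕ) (h : ℕ → ℝ)
    (P : ℕ → Fin 4 → Vec m) : ℝ :=
  ⨆ n : Fin (N + 1), ∑ i : Fin 4,
    ‖stageMul (M.A * M.W)ᵀ (fun j => P n j - exactStages M h p n j) i‖

/-- `max {|||Y - y|||, |||P - p|||}` -/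
def globalError (M : PeerTriplet) (y p : ℝ → Vec m) (N : ℕ) (h : ℕ → ℝ)
    (Y P : ℕ → Fin 4 → Vec m) : ℝ :=
  max (stateError M y N h Y) (adjointError M p N h P)

/-- `‖v^(k)‖_[n]`, the maximum of `‖v^(k)‖` over `π_{n-1} ∪ π_n ∪ π_{n+1}`, where only indices
in `{0, ..., N}` count. -/
def localNorm (M : PeerTriplet) (Tstar : ℝ) (N : ℕ) (h : ℕ → ℝ) (v : ℝ → Vec m) (k n : ℕ) : ℝ :=
  sSup ((fun x => ‖iteratedDerivWithin k v (Icc 0 Tstar) x‖) ''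
    ⋃ l ∈ {l : ℕ | l ≤ N ∧ l ≤ n + 1 ∧ n ≤ l + 1}, cell M h l)

/-- `max_n h_n^3 ‖v^(3:4)‖_[n]`, where `‖v^(3:4)‖_[n] = max {‖v^(3)‖_[n], ‖v^(4)‖_[n]}`. -/
def gridSeminorm (M : PeerTriplet) (Tstar : ℝ) (N : ℕ) (h : ℕ → ℝ) (v : ℝ → Vec m) : ℝ :=
  ⨆ n : Fin (N + 1),
    h n ^ 3 * max (localNorm M Tstar N h v 3 n) (localNorm M Tstar N h v 4 n)

/-- The right-hand side of the order three estimate, without the constant. -/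
def errorBound (M : PeerTriplet) (Tstar : ℝ) (y p : ℝ → Vec m) (N : ℕ) (h : ℕ → ℝ) : ℝ :=
  gridSeminorm M Tstar N h y + gridSeminorm M Tstar N h p

/-- The contribution of non-diagonal matrices `K_0`, `K_N` in the two boundary steps:
`h_0^3 ‖p^(2)‖_[0] + h_N^3 ‖p^(2)‖_[N]`. -/
def boundaryBound (M : PeerTriplet) (Tstar : ℝ) (p : ℝ → Vec m) (N : ℕ) (h : ℕ → ℝ) : ℝ :=
  h 0 ^ 3 * localNorm M Tstar N h p 2 0 + h N ^ 3 * localNorm M Tstar N h p 2 N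

/-- On all sufficiently fine grids of the class `Grid` the discrete boundary value problem has a
solution near the exact one, it is unique there, and its error is at most `bound`. -/
def ConvergesOn (M : PeerTriplet) (Q : ControlProblem m d) (u : Vec m → Vec m → Vec d)
    (y p : ℝ → Vec m) (Grid : ℕ → (ℕ → ℝ) → Prop) (bound : ℕ → (ℕ → ℝ) → ℝ) : Prop :=
  ∃ ε > 0, ∃ H > 0, ∀ (N : ℕ) (h : ℕ → ℝ), Grid N h → (∀ n ≤ N, h n ≤ H) →
    (∃ Y P, IsDiscreteSolution M Q u N h Y P ∧ globalError M y p N h Y P ≤ ε) ∧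
    (∀ Y P Y' P', IsDiscreteSolution M Q u N h Y P → globalError M y p N h Y P ≤ ε →
      IsDiscreteSolution M Q u N h Y' P' → globalError M y p N h Y' P' ≤ ε →
      ∀ n ≤ N, Y n = Y' n ∧ P n = P' n) ∧
    (∀ Y P, IsDiscreteSolution M Q u N h Y P → globalError M y p N h Y P ≤ ε →
      globalError M y p N h Y P ≤ bound N h)

end

/-!
The discrete boundary value problem is solved by the fixed point iteration that inserts the last
iterate into `g`, `φ` and then solves the two linear recursions, the forward one for `Y` and, with
the new `Y_N` in its end condition, the backward one for `P`. Three facts about a triplet give the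
claim.

*Stability.* `1` is an eigenvector of `A⁻¹ B(σ)` for the eigenvalue one, with the left eigenvector
`1^T A`, for all `σ`. If the complementary part `A⁻¹ B(σ) - 1 1^T A` is a contraction in a norm that
does not depend on `σ` (`PeerTriplet.IsDamped`), then both recursions are bounded by the maximum of
their inhomogeneities `r_n` plus the sum of the mean values `1^T r_n`, see
`OrderConditions.forward_stability` and `OrderConditions.adjoint_stability`. Applied to differences
of right-hand sides, which carry a factor `h_n`, this shows that the iteration contracts with factor
`1/2` under the smallness conditions, see `OrderConditions.iterate_sub_le`. Since `φ` is positively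
homogeneous in `p` where the control law is invariant under scaling, the arguments `K_n^T P_n` may be
divided by the column sums of `K_n`, and only the tube around `(y, p)` matters.

*Consistency.* By Taylor expansion the conditions of order two make the residuals of the exact
solution `O(h_n^3)`. Their means `1^T r_n` vanish even for cubic polynomials, up to terms with
`(1^T A c^3 - 1) (σ^3 - 1)` and `(c^3)^T A 1 (1 - σ^3)`, which are zero for `AP4o33vg` and gain a
factor `h_n` on smooth grids. The sum over all steps of the remaining `O(h_n^4)` terms is again of
order three. In the boundary steps, `K_n^T p_n` differs from `p_n` scaled by column sums by a term
`h_n^2 p''` if `K_n` is not diagonal. This is `OrderConditions.exact_defect_le`.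

*Damping.* In the coordinates `V^T X V` the matrix `B(σ) - A 1 1^T A` is zero outside its
last row and column. For `AP4o33vg` a diagonally weighted maximum norm shows damping
for all `σ` in `[0.5, 1.8]`. On smooth grids with small steps all ratios are close to one, so for the
other triplets strict damping at `σ = 1` is sufficient by continuity, see
`OrderConditions.exists_isDamped`.

Banach's theorem then gives existence, uniqueness and the error bound, see
`OrderConditions.convergesOn`. For the last part, the steps of a smooth grid are comparable, so
`h_0^3` and `h_N^3` are bounded by a multiple of `h_n^3` for a step `n` that contains a point with
nonvanishing third derivative (`exists_boundaryBound_le`).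
-/

noncomputable section

variable {m d : ℕ}
/-! ### Stage vectors -/

/-- The sum of the absolute values of the entries, an upper bound for the norm of `X ⊗ I_m` on stage
vectors with the maximum norm. -/
def entrySum (X : Matrix (Fin 4) (Fin 4) ℝ) : ℝ := ∑ i, ∑ j, |X i j|

lemma entrySum_nonneg (X : Matrix (Fin 4) (Fin 4) ℝ) : 0 ≤ entrySum X :=
  Finset.sum_nonneg fun _ _ => Finset.sum_nonneg fun _ _ => abs_nonneg _

lemma abs_le_entrySum (X : Matrix (Fin 4) (Fin 4) ℝ) (i j : Fin 4) : |X i j| ≤ entrySum X :=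
  (Finset.single_le_sum (f := fun j => |X i j|) (fun _ _ => abs_nonneg _)
    (Finset.mem_univ j)).trans
    (Finset.single_le_sum (f := fun i => ∑ j, |X i j|)
      (fun _ _ => Finset.sum_nonneg fun _ _ => abs_nonneg _) (Finset.mem_univ i))

lemma entrySum_transpose (X : Matrix (Fin 4) (Fin 4) ℝ) : entrySum Xᵀ = entrySum X := by
  simp only [entrySum, Matrix.transpose_apply]
  exact Finset.sum_comm

lemma stageMul_mul (X X' : Matrix (Fin 4) (Fin 4) ℝ) (Y : Fin 4 → Vec m) :
    stageMul (X * X') Y = stageMul X (stageMul X' Y) := by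
  funext i
  simp only [stageMul, Matrix.mul_apply, Finset.sum_smul, Finset.smul_sum, smul_smul]
  exact Finset.sum_comm

lemma stageMul_one (Y : Fin 4 → Vec m) : stageMul 1 Y = Y := by
  funext i
  simp [stageMul, Matrix.one_apply]

lemma stageMul_add (X : Matrix (Fin 4) (Fin 4) ℝ) (Y Y' : Fin 4 → Vec m) :
    stageMul X (Y + Y') = stageMul X Y + stageMul X Y' := by
  funext i
  simp [stageMul, Finset.sum_add_distrib]

lemma stageMul_sub (X : Matrix (Fin 4) (Fin 4) ℝ) (Y Y' : Fin 4 → Vec m) :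
    stageMul X (Y - Y') = stageMul X Y - stageMul X Y' := by
  funext i
  simp [stageMul, smul_sub]

lemma sub_stageMul (X X' : Matrix (Fin 4) (Fin 4) ℝ) (Y : Fin 4 → Vec m) :
    stageMul (X - X') Y = stageMul X Y - stageMul X' Y := by
  funext i
  simp [stageMul, sub_smul]

lemma stageMul_inv_mul {X : Matrix (Fin 4) (Fin 4) ℝ} (hX : X.det ≠ 0) (Y : Fin 4 → Vec m) :
    stageMul X⁻¹ (stageMul X Y) = Y := by
  rw [← stageMul_mul, Matrix.nonsing_inv_mul _ (isUnit_iff_ne_zero.2 hX), stageMul_one]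

lemma stageMul_mul_inv {X : Matrix (Fin 4) (Fin 4) ℝ} (hX : X.det ≠ 0) (Y : Fin 4 → Vec m) :
    stageMul X (stageMul X⁻¹ Y) = Y := by
  rw [← stageMul_mul, Matrix.mul_nonsing_inv _ (isUnit_iff_ne_zero.2 hX), stageMul_one]

lemma norm_sum_smul_le (c : Fin 4 → ℝ) (Y : Fin 4 → Vec m) :
    ‖∑ j, c j • Y j‖ ≤ (∑ j, |c j|) * ‖Y‖ := by
  refine (norm_sum_le _ _).trans ?_
  rw [Finset.sum_mul]
  refine Finset.sum_le_sum fun j _ => ?_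
  rw [norm_smul, Real.norm_eq_abs]
  exact mul_le_mul_of_nonneg_left (norm_le_pi_norm Y j) (abs_nonneg _)

/-- The operator norm of `X ⊗ I_m` for the maximum norm is a row sum norm. -/
lemma norm_stageMul_le_of_rows {X : Matrix (Fin 4) (Fin 4) ℝ} {γ : ℝ}
    (hX : ∀ i, ∑ j, |X i j| ≤ γ) (Y : Fin 4 → Vec m) : ‖stageMul X Y‖ ≤ γ * ‖Y‖ := by
  have hγ : 0 ≤ γ := (Finset.sum_nonneg fun _ _ => abs_nonneg _).trans (hX 0)
  refine (pi_norm_le_iff_of_nonneg (by positivity)).2 fun i => ?_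
  exact (norm_sum_smul_le _ _).trans (mul_le_mul_of_nonneg_right (hX i) (norm_nonneg _))

lemma norm_stageMul_le (X : Matrix (Fin 4) (Fin 4) ℝ) (Y : Fin 4 → Vec m) :
    ‖stageMul X Y‖ ≤ entrySum X * ‖Y‖ :=
  norm_stageMul_le_of_rows (fun i => Finset.single_le_sum (f := fun i => ∑ j, |X i j|)
    (fun _ _ => Finset.sum_nonneg fun _ _ => abs_nonneg _) (Finset.mem_univ i)) Y

/-- The operator norm of `Xᵀ ⊗ I_m` for the sum norm is the row sum norm of `X`. -/
lemma sum_norm_stageMul_transpose_le {X : Matrix (Fin 4) (Fin 4) ℝ} {γ : ℝ}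
    (hX : ∀ i, ∑ j, |X i j| ≤ γ) (Y : Fin 4 → Vec m) :
    ∑ i, ‖stageMul Xᵀ Y i‖ ≤ γ * ∑ i, ‖Y i‖ := by
  calc ∑ i, ‖stageMul Xᵀ Y i‖ ≤ ∑ i, ∑ j, |X j i| * ‖Y j‖ := by
        refine Finset.sum_le_sum fun i _ => (norm_sum_le _ _).trans (le_of_eq ?_)
        simp [norm_smul]
    _ = ∑ j, (∑ i, |X j i|) * ‖Y j‖ := by
        rw [Finset.sum_comm]
        simp [Finset.sum_mul]
    _ ≤ _ := by
        rw [Finset.mul_sum]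
        exact Finset.sum_le_sum fun j _ => mul_le_mul_of_nonneg_right (hX j) (norm_nonneg _)

lemma norm_le_sum_norm (Y : Fin 4 → Vec m) : ‖Y‖ ≤ ∑ i, ‖Y i‖ :=
  (pi_norm_le_iff_of_nonneg (Finset.sum_nonneg fun _ _ => norm_nonneg _)).2 fun i =>
    Finset.single_le_sum (f := fun i => ‖Y i‖) (fun _ _ => norm_nonneg _) (Finset.mem_univ i)

lemma sum_norm_le (Y : Fin 4 → Vec m) : ∑ i, ‖Y i‖ ≤ 4 * ‖Y‖ := by
  calc ∑ i, ‖Y i‖ ≤ ∑ _i : Fin 4, ‖Y‖ := Finset.sum_le_sum fun i _ => norm_le_pi_norm Y i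
    _ = 4 * ‖Y‖ := by simp

lemma norm_sum_stages_le (Y : Fin 4 → Vec m) : ‖∑ i, Y i‖ ≤ 4 * ‖Y‖ :=
  (norm_sum_le _ _).trans (sum_norm_le Y)

lemma sum_stageMul (X : Matrix (Fin 4) (Fin 4) ℝ) (Y : Fin 4 → Vec m) :
    ∑ i, stageMul X Y i = ∑ j, (∑ i, X i j) • Y j := by
  simp only [stageMul, Finset.sum_smul]
  exact Finset.sum_comm

/-! ### Stability of two-term recursions -/

/-- The vector `1^T X` of the column sums. -/
def colSum (X : Matrix (Fin 4) (Fin 4) ℝ) (j : Fin 4) : ℝ := ∑ i, X i j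

/-- The matrix `1 (1^T X)`. If `1^T X 1 = 1` it is the projection onto constant stage vectors along
the kernel of the functional `1^T X`. -/
def meanProj (X : Matrix (Fin 4) (Fin 4) ℝ) : Matrix (Fin 4) (Fin 4) ℝ :=
  Matrix.of fun _ j => colSum X j

lemma stageMul_meanProj (X : Matrix (Fin 4) (Fin 4) ℝ) (Y : Fin 4 → Vec m) (i : Fin 4) :
    stageMul (meanProj X) Y i = ∑ j, stageMul X Y j := by
  rw [sum_stageMul]; rfl

lemma meanProj_mul (X X' : Matrix (Fin 4) (Fin 4) ℝ) (i j : Fin 4) :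
    (meanProj X * X') i j = ∑ k, colSum X k * X' k j := by
  simp [meanProj, Matrix.mul_apply]

/-- The propagation constant of `norm_le_of_recursion`. -/
def recursionConst (X : Matrix (Fin 4) (Fin 4) ℝ) (γ C : ℝ) : ℝ :=
  C * C * entrySum (1 - meanProj X) + C * C * entrySum ((1 - meanProj X) * X⁻¹) / (1 - γ) +
    entrySum X + 1

lemma recursionConst_pos (X : Matrix (Fin 4) (Fin 4) ℝ) {γ C : ℝ} (hγ : γ < 1) :
    0 < recursionConst X γ C := by
  have h1 := entrySum_nonneg (1 - meanProj X)
  have h2 := entrySum_nonneg ((1 - meanProj X) * X⁻¹)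
  have h3 := entrySum_nonneg X
  have h4 : 0 < 1 - γ := by linarith
  have h5 := mul_self_nonneg C
  unfold recursionConst
  positivity

/-- The recursion `X Z_n = B_n Z_{n-1} + r_n` reproduces constant stage vectors and conserves
`1^T X Z_n`. If its action on the complement is a contraction in some norm `ν`, then perturbations
`r_n` enter through the maximum of their norms; only their stage sums `1^T r_n` accumulate. -/
lemma norm_le_of_recursion {X : Matrix (Fin 4) (Fin 4) ℝ} (hX : X.det ≠ 0)
    (hX1 : ∑ i, ∑ j, X i j = 1) {ν : (Fin 4 → Vec m) → ℝ} {γ C : ℝ} (hγ0 : 0 ≤ γ) (hγ : γ < 1)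
    (hC : 0 ≤ C) (hadd : ∀ x y, ν (x + y) ≤ ν x + ν y) (hub : ∀ x, ν x ≤ C * ‖x‖)
    (hlb : ∀ x, ‖x‖ ≤ C * ν x) {B : ℕ → Matrix (Fin 4) (Fin 4) ℝ} {K : ℕ}
    (hB1 : ∀ n, 1 ≤ n → n ≤ K → ∀ i, ∑ j, B n i j = ∑ j, X i j)
    (hB2 : ∀ n, 1 ≤ n → n ≤ K → ∀ j, ∑ i, B n i j = ∑ i, X i j)
    (hD : ∀ n, 1 ≤ n → n ≤ K → ∀ x, ν (stageMul (X⁻¹ * B n - meanProj X) x) ≤ γ * ν x)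
    {Z r : ℕ → Fin 4 → Vec m}
    (hZ : ∀ n, 1 ≤ n → n ≤ K → stageMul X (Z n) = stageMul (B n) (Z (n - 1)) + r n)
    {R Q : ℝ} (hR0 : 0 ≤ R) (hR : ∀ n, 1 ≤ n → n ≤ K → ‖r n‖ ≤ R)
    (hQ : ∑ n ∈ Finset.Icc 1 K, ‖∑ i, r n i‖ ≤ Q) :
    ∀ n ≤ K, ‖Z n‖ ≤ recursionConst X γ C * (‖Z 0‖ + R + Q) := by
  set J := meanProj X with hJ
  have hXX : X⁻¹ * X = 1 := Matrix.nonsing_inv_mul _ (isUnit_iff_ne_zero.2 hX)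
  have hXX' : X * X⁻¹ = 1 := Matrix.mul_nonsing_inv _ (isUnit_iff_ne_zero.2 hX)
  -- `1^T X X⁻¹ = 1^T`
  have hcol : ∀ Y : Matrix (Fin 4) (Fin 4) ℝ, ∀ i j,
      (J * (X⁻¹ * Y)) i j = ∑ k, Y k j := by
    intro Y i j
    have h1 : ∀ W : Matrix (Fin 4) (Fin 4) ℝ, (J * W) i j = ∑ k, (X * W) k j := by
      intro W
      rw [hJ, meanProj_mul]
      simp only [Matrix.mul_apply, colSum, Finset.sum_mul]
      exact Finset.sum_comm
    rw [h1, ← mul_assoc, hXX', one_mul]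
  have hone : ∀ Y : Matrix (Fin 4) (Fin 4) ℝ, (∀ i, ∑ j, Y i j = ∑ j, X i j) →
      ∀ i, ∑ j, (X⁻¹ * Y) i j = 1 := by
    intro Y hY i
    have h1 : ∀ W : Matrix (Fin 4) (Fin 4) ℝ, ∑ j, (X⁻¹ * W) i j =
        ∑ k, X⁻¹ i k * ∑ j, W k j := by
      intro W
      simp only [Matrix.mul_apply, Finset.mul_sum]
      exact Finset.sum_comm
    rw [h1, Finset.sum_congr rfl fun k _ => by rw [hY k], ← h1, hXX]
    simp [Matrix.one_apply]
  have hJJ : J * J = J := by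
    ext i j
    rw [hJ, meanProj_mul]
    simp only [meanProj, Matrix.of_apply, ← Finset.sum_mul]
    simp only [colSum]
    rw [Finset.sum_comm, hX1, one_mul]
  have hcomm1 : ∀ n, 1 ≤ n → n ≤ K → (1 - J) * (X⁻¹ * B n) = X⁻¹ * B n - J := by
    intro n h1 h2
    rw [sub_mul, one_mul]
    congr 1
    ext i j
    rw [hcol, hB2 n h1 h2]; rfl
  have hcomm2 : ∀ n, 1 ≤ n → n ≤ K → (X⁻¹ * B n - J) * (1 - J) = X⁻¹ * B n - J := by
    intro n h1 h2
    have h3 : X⁻¹ * B n * J = J := by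
      ext i j
      rw [Matrix.mul_apply]
      simp only [hJ, meanProj, Matrix.of_apply, ← Finset.sum_mul]
      rw [hone _ (hB1 n h1 h2), one_mul]
    rw [mul_sub, mul_one, sub_mul, h3, hJJ, sub_self, sub_zero]
  set x : ℕ → Fin 4 → Vec m := fun n => stageMul (1 - J) (Z n) with hx
  set z : ℕ → Vec m := fun n => ∑ i, stageMul X (Z n) i with hz
  set q := entrySum ((1 - J) * X⁻¹) with hq
  have hq0 : 0 ≤ q := entrySum_nonneg _
  have hγ' : 0 < 1 - γ := by linarith
  have hstep : ∀ n, 1 ≤ n → n ≤ K → ν (x n) ≤ γ * ν (x (n - 1)) + C * (q * R) := by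
    intro n h1 h2
    have h3 : Z n = stageMul X⁻¹ (stageMul (B n) (Z (n - 1)) + r n) := by
      rw [← hZ n h1 h2, stageMul_inv_mul hX]
    have h4 : x n = stageMul (X⁻¹ * B n - J) (x (n - 1)) + stageMul ((1 - J) * X⁻¹) (r n) := by
      simp only [hx]
      rw [← stageMul_mul, hcomm2 n h1 h2, ← hcomm1 n h1 h2, h3, stageMul_add, stageMul_add]
      simp only [stageMul_mul]
    rw [h4]
    refine (hadd _ _).trans (add_le_add (hD n h1 h2 _) ((hub _).trans ?_))
    refine mul_le_mul_of_nonneg_left ((norm_stageMul_le _ _).trans ?_) hC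
    exact mul_le_mul_of_nonneg_left (hR n h1 h2) hq0
  have hν0 : 0 ≤ C * ν (x 0) := (norm_nonneg _).trans (hlb _)
  have hsum : ∀ n ≤ K, C * ν (x n) ≤ C * ν (x 0) + C * C * (q * R) / (1 - γ) := by
    intro n
    induction n with
    | zero =>
      intro _
      have : 0 ≤ C * C * (q * R) / (1 - γ) := by positivity
      linarith
    | succ n ih =>
      intro hn
      have h1 := mul_le_mul_of_nonneg_left (hstep (n + 1) (by omega) hn) hC
      have h2 := mul_le_mul_of_nonneg_left (ih (by omega)) hγ0
      have h3 : C * C * (q * R) = (1 - γ) * (C * C * (q * R) / (1 - γ)) := by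
        field_simp
      simp only [Nat.add_sub_cancel] at h1
      nlinarith
  have hzstep : ∀ n, 1 ≤ n → n ≤ K → z n = z (n - 1) + ∑ i, r n i := by
    intro n h1 h2
    simp only [hz, hZ n h1 h2, Pi.add_apply, Finset.sum_add_distrib]
    congr 1
    rw [sum_stageMul, sum_stageMul]
    exact Finset.sum_congr rfl fun j _ => by rw [hB2 n h1 h2]
  have hzsum : ∀ n ≤ K, ‖z n‖ ≤ ‖z 0‖ + ∑ k ∈ Finset.Icc 1 n, ‖∑ i, r k i‖ := by
    intro n
    induction n with
    | zero => simp
    | succ n ih =>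
      intro hn
      have h1 := hzstep (n + 1) (by omega) hn
      simp only [Nat.add_sub_cancel] at h1
      rw [Finset.sum_Icc_succ_top (by omega), h1]
      exact (norm_add_le _ _).trans (by linarith [ih (by omega)])
  have hz0 : ‖z 0‖ ≤ entrySum X * ‖Z 0‖ := by
    simp only [hz]
    rw [sum_stageMul]
    refine (norm_sum_smul_le _ _).trans (mul_le_mul_of_nonneg_right ?_ (norm_nonneg _))
    rw [← entrySum_transpose]
    exact Finset.sum_le_sum fun j _ => Finset.abs_sum_le_sum_abs _ _
  intro n hn
  have hdec : Z n = x n + fun _ => z n := by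
    funext i
    have h1 := stageMul_meanProj X (Z n) i
    simp only [hx, hz, Pi.add_apply, sub_stageMul, stageMul_one, Pi.sub_apply, ← h1, ← hJ]
    abel
  have h1 : ‖Z n‖ ≤ ‖x n‖ + ‖z n‖ := by
    conv_lhs => rw [hdec]
    exact (norm_add_le _ _).trans (by gcongr; exact pi_norm_const_le _)
  have h2 : ν (x 0) ≤ C * (entrySum (1 - J) * ‖Z 0‖) :=
    (hub _).trans (mul_le_mul_of_nonneg_left (norm_stageMul_le _ _) hC)
  have h3 : ∑ k ∈ Finset.Icc 1 n, ‖∑ i, r k i‖ ≤ Q := by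
    refine le_trans ?_ hQ
    exact Finset.sum_le_sum_of_subset_of_nonneg (Finset.Icc_subset_Icc_right hn)
      fun _ _ _ => norm_nonneg _
  have hQ0 : 0 ≤ Q := (Finset.sum_nonneg fun _ _ => norm_nonneg _).trans h3
  have h4 := hzsum n hn
  have h5 := hsum n hn
  have h6 := hlb (x n)
  have h7 := mul_le_mul_of_nonneg_left h2 hC
  have e0 := entrySum_nonneg (1 - J)
  have e1 := entrySum_nonneg X
  have hCC : 0 ≤ C * C := mul_self_nonneg C
  have h8 : ‖Z n‖ ≤ C * C * entrySum (1 - J) * ‖Z 0‖ + C * C * q / (1 - γ) * R +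
      entrySum X * ‖Z 0‖ + 1 * Q := by
    have : C * C * (q * R) / (1 - γ) = C * C * q / (1 - γ) * R := by ring
    nlinarith
  refine h8.trans ?_
  have e3 : 0 ≤ C * C * q / (1 - γ) := by positivity
  have e2 : 0 ≤ C * C * entrySum (1 - J) := by positivity
  have hn0 := norm_nonneg (Z 0)
  unfold recursionConst
  rw [← hJ, ← hq]
  nlinarith [mul_nonneg e2 hR0, mul_nonneg e2 hQ0, mul_nonneg e3 hn0, mul_nonneg e3 hQ0,
    mul_nonneg e1 hR0, mul_nonneg e1 hQ0]
/-! ### Properties of the triplets that imply convergence -/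

namespace PeerTriplet

/-- The algebraic properties of a triplet that enter the local errors: the order conditions of the
standard step in the coordinates `V^T X V`, and the order conditions of the boundary steps for
polynomials of degree at most two. The column sums of `K_n` are the factors by which the stage
values `K_n^T P_n` differ from `P_n` to leading order; they have to be admissible scaling factors of
the control law. -/
structure OrderConditions (M : PeerTriplet) (Λ : Set ℝ) : Prop where
  c_nonneg : ∀ i, 0 ≤ M.c i
  det_V : M.V.det ≠ 0
  det_A : M.A.det ≠ 0
  det_A0 : M.A0.det ≠ 0
  det_AN : M.AN.det ≠ 0
  det_W : M.W.det ≠ 0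
  hatA_eq : ∃ a b c d e f g : ℝ, M.hatA =
    !![1, 1, 1, a; 0, 1 / 2, 2 / 3, b; 0, 1 / 3, 1 / 2, c; d, e, f, g]
  diag_K : ∃ k : Fin 4 → ℝ, M.K = Matrix.diagonal k
  quad : ∀ k : ℕ, k ≤ 3 → ∑ i, M.K i i * M.c i ^ k = 1 / (k + 1)
  start_one : ∀ i, ∑ j, M.A0 i j * M.c j = ∑ j, M.K0 i j
  start_two : ∀ i, ∑ j, M.A0 i j * M.c j ^ 2 = 2 * ∑ j, M.K0 i j * M.c j
  start_adj_zero : ∀ j, ∑ i, M.A0 i j = ∑ i, M.A i j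
  start_adj_one : ∀ j, ∑ i, M.A0 i j * M.c i + ∑ i, M.K0 i j =
    ∑ i, M.A i j * M.c i + ∑ i, M.K i j
  start_adj_two : ∀ j, ∑ i, M.A0 i j * M.c i ^ 2 + 2 * ∑ i, M.K0 i j * M.c i =
    ∑ i, M.A i j * M.c i ^ 2 + 2 * ∑ i, M.K i j * M.c i
  end_zero : ∀ i, ∑ j, M.AN i j = ∑ j, M.A i j
  end_one : ∀ i, ∑ j, M.AN i j * M.c j - ∑ j, M.KN i j =
    ∑ j, M.A i j * M.c j - ∑ j, M.K i j
  end_two : ∀ i, ∑ j, M.AN i j * M.c j ^ 2 - 2 * ∑ j, M.KN i j * M.c j =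
    ∑ j, M.A i j * M.c j ^ 2 - 2 * ∑ j, M.K i j * M.c j
  w_pow : ∀ k : ℕ, k ≤ 2 → ∑ j, M.w j * M.c j ^ k = 1
  end_adj_one : ∀ j, ∑ i, M.AN i j * M.c i + ∑ i, M.KN i j = M.w j
  end_adj_two : ∀ j, ∑ i, M.AN i j * M.c i ^ 2 + 2 * ∑ i, M.KN i j * M.c i = M.w j
  colSum_mem : ∀ i, colSum M.K i ∈ Λ ∧ colSum M.K0 i ∈ Λ ∧ colSum M.KN i ∈ Λ
  colSum_ne : ∀ i, colSum M.K i ≠ 0 ∧ colSum M.K0 i ≠ 0 ∧ colSum M.KN i ≠ 0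
  start_mean : ∀ j, ∑ i, M.K0 i j * M.c i = colSum M.K0 j * M.c j
  end_mean : ∀ j, ∑ i, M.KN i j * M.c i = colSum M.KN j * M.c j

/-- Uniform stability for stepsize ratios in `S`: the coefficients `B(σ)` are bounded, and in some
coordinates `G` the part of `A⁻¹ B(σ)` complementary to the eigenvector `1` is a contraction in the
maximum norm with a common factor. -/
structure IsDamped (M : PeerTriplet) (S : Set ℝ) : Prop where
  bounded : ∃ b, ∀ σ ∈ S, entrySum (M.B σ) ≤ b
  contraction : ∃ (G : Matrix (Fin 4) (Fin 4) ℝ) (γ : ℝ), G.det ≠ 0 ∧ 0 ≤ γ ∧ γ < 1 ∧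
    ∀ σ ∈ S, ∃ R : Matrix (Fin 4) (Fin 4) ℝ,
      G * (M.A⁻¹ * M.B σ - meanProj M.A) = R * G ∧ ∀ i, ∑ j, |R i j| ≤ γ

variable {M : PeerTriplet} {Λ : Set ℝ}

lemma stepA_zero (N : ℕ) : M.stepA N 0 = M.A0 := by simp [stepA]

lemma stepA_last {N : ℕ} (hN : 1 ≤ N) : M.stepA N N = M.AN := by
  simp [stepA, show N ≠ 0 by omega]

lemma stepA_mid {N n : ℕ} (h0 : 1 ≤ n) (hN : n < N) : M.stepA N n = M.A := by
  simp [stepA, show n ≠ 0 by omega, show n ≠ N by omega]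

lemma stepK_zero (N : ℕ) : M.stepK N 0 = M.K0 := by simp [stepK]

lemma stepK_last {N : ℕ} (hN : 1 ≤ N) : M.stepK N N = M.KN := by
  simp [stepK, show N ≠ 0 by omega]

lemma stepK_mid {N n : ℕ} (h0 : 1 ≤ n) (hN : n < N) : M.stepK N n = M.K := by
  simp [stepK, show n ≠ 0 by omega, show n ≠ N by omega]

namespace OrderConditions

variable (hM : M.OrderConditions Λ)
include hM

lemma V_mul_inv : M.V * M.V⁻¹ = 1 := Matrix.mul_nonsing_inv _ (isUnit_iff_ne_zero.2 hM.det_V)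

lemma V_inv_mul : M.V⁻¹ * M.V = 1 := Matrix.nonsing_inv_mul _ (isUnit_iff_ne_zero.2 hM.det_V)

/-- The factorization `V^T B(σ) V = hatB σ`. -/
lemma V_B_V (σ : ℝ) : M.Vᵀ * M.B σ * M.V = M.hatB σ := by
  have h1 : M.Vᵀ * (M.V⁻¹)ᵀ = 1 := by rw [← Matrix.transpose_mul, hM.V_inv_mul]; simp
  rw [B, show M.Vᵀ * ((M.V⁻¹)ᵀ * M.hatB σ * M.V⁻¹) * M.V =
    (M.Vᵀ * (M.V⁻¹)ᵀ) * M.hatB σ * (M.V⁻¹ * M.V) by simp only [Matrix.mul_assoc], h1,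
    hM.V_inv_mul, one_mul, mul_one]

/-- Identities between vectors can be tested after multiplication by `V^T`. -/
lemma eq_of_V_transpose {x y : Fin 4 → ℝ} (h : M.Vᵀ *ᵥ x = M.Vᵀ *ᵥ y) : x = y := by
  have h1 : M.V⁻¹ᵀ *ᵥ (M.Vᵀ *ᵥ x) = M.V⁻¹ᵀ *ᵥ (M.Vᵀ *ᵥ y) := by rw [h]
  have h2 : M.V⁻¹ᵀ * M.Vᵀ = 1 := by rw [← Matrix.transpose_mul, hM.V_mul_inv]; simp
  simpa [Matrix.mulVec_mulVec, h2] using h1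

/-- The transformed matrix `V^T K V` is a Hankel matrix with the moments of the quadrature rule. -/
lemma hatK_eq : ∃ k5 k6 k7 : ℝ, M.hatK =
    !![1, 1 / 2, 1 / 3, 1 / 4; 1 / 2, 1 / 3, 1 / 4, k5; 1 / 3, 1 / 4, k5, k6;
      1 / 4, k5, k6, k7] := by
  obtain ⟨k, hk⟩ := hM.diag_K
  refine ⟨∑ i, k i * M.c i ^ 4, ∑ i, k i * M.c i ^ 5, ∑ i, k i * M.c i ^ 6, ?_⟩
  have h : ∀ i j, M.hatK i j = ∑ l, k l * M.c l ^ ((i : ℕ) + (j : ℕ)) := by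
    intro i j
    rw [hatK, hk, Matrix.mul_apply]
    simp only [Matrix.mul_diagonal, Matrix.transpose_apply, V, Matrix.of_apply]
    exact Finset.sum_congr rfl fun l _ => by ring
  have hq := hM.quad
  simp only [hk, Matrix.diagonal_apply_eq] at hq
  have h0 := hq 0 (by norm_num)
  have h1 := hq 1 (by norm_num)
  have h2 := hq 2 (by norm_num)
  have h3 := hq 3 (by norm_num)
  norm_num at h0 h1 h2 h3
  ext i j
  rw [h]
  fin_cases i <;> fin_cases j <;> simp [h0, h1, h2, h3]

lemma forward_of_hat {σ : ℝ} {x y z : Fin 4 → ℝ}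
    (h : M.hatA *ᵥ x = M.hatB σ *ᵥ y + M.hatK *ᵥ z) :
    M.A *ᵥ (M.V *ᵥ x) = M.B σ *ᵥ (M.V *ᵥ y) + M.K *ᵥ (M.V *ᵥ z) := by
  apply hM.eq_of_V_transpose
  rw [Matrix.mulVec_add]
  simpa only [Matrix.mulVec_mulVec, ← Matrix.mul_assoc, ← hM.V_B_V σ, hatA, hatK] using h

lemma adjoint_of_hat {σ : ℝ} {x y z : Fin 4 → ℝ}
    (h : M.hatAᵀ *ᵥ x + M.hatKᵀ *ᵥ z = (M.hatB σ)ᵀ *ᵥ y) :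
    M.Aᵀ *ᵥ (M.V *ᵥ x) + M.Kᵀ *ᵥ (M.V *ᵥ z) = (M.B σ)ᵀ *ᵥ (M.V *ᵥ y) := by
  apply hM.eq_of_V_transpose
  rw [Matrix.mulVec_add]
  simpa only [Matrix.mulVec_mulVec, ← Matrix.mul_assoc, ← hM.V_B_V σ, hatA, hatK,
    Matrix.transpose_mul, Matrix.transpose_transpose] using h

lemma sum_B (σ : ℝ) (i : Fin 4) : ∑ j, M.B σ i j = ∑ j, M.A i j := by
  obtain ⟨a, b, c, d, e, f, g, hA⟩ := hM.hatA_eq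
  have h := hM.forward_of_hat (σ := σ) (x := ![1, 0, 0, 0]) (y := ![1, 0, 0, 0]) (z := 0) (by
    simp only [hatB, hA]
    ext l
    fin_cases l <;> simp [Matrix.mulVec, dotProduct, Fin.sum_univ_four])
  have h1 := congrFun h i
  simp only [Matrix.mulVec, dotProduct, Fin.sum_univ_four, Pi.add_apply] at h1
  simp [V] at h1
  simp only [Fin.sum_univ_four]
  linarith

lemma colSum_B (σ : ℝ) (j : Fin 4) : ∑ i, M.B σ i j = ∑ i, M.A i j := by
  obtain ⟨a, b, c, d, e, f, g, hA⟩ := hM.hatA_eq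
  have h := hM.adjoint_of_hat (σ := σ) (x := ![1, 0, 0, 0]) (y := ![1, 0, 0, 0]) (z := 0) (by
    simp only [hatB, hA]
    ext l
    fin_cases l <;> simp [Matrix.mulVec, dotProduct, Fin.sum_univ_four])
  have h1 := congrFun h j
  simp only [Matrix.mulVec, dotProduct, Fin.sum_univ_four, Pi.add_apply] at h1
  simp [V] at h1
  simp only [Fin.sum_univ_four]
  linarith

lemma sum_A : ∑ i, ∑ j, M.A i j = 1 := by
  obtain ⟨a, b, c, d, e, f, g, hA⟩ := hM.hatA_eq
  have h := congrFun (congrFun hA 0) 0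
  simp [hatA, Matrix.mul_apply, V, Fin.sum_univ_four] at h
  simp only [Fin.sum_univ_four]
  linarith

/-- The standard step with stepsizes `1` and `σ` is exact for linear functions. -/
lemma forward_one (σ : ℝ) (hσ : σ ≠ 0) (i : Fin 4) : ∑ j, M.A i j * (1 + σ * M.c j) =
    ∑ j, M.B σ i j * M.c j + σ * ∑ j, M.K i j := by
  obtain ⟨a, b, c, d, e, f, g, hA⟩ := hM.hatA_eq
  obtain ⟨k5, k6, k7, hK⟩ := hM.hatK_eq
  have h := hM.forward_of_hat (σ := σ) (x := ![1, σ, 0, 0]) (y := ![0, 1, 0, 0])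
    (z := ![σ, 0, 0, 0]) (by
    simp only [hatB, hA, hK]
    ext l
    fin_cases l <;> simp [Matrix.mulVec, dotProduct, Fin.sum_univ_four] <;> field_simp <;> ring)
  have h1 := congrFun h i
  simp only [Matrix.mulVec, dotProduct, Fin.sum_univ_four, Pi.add_apply] at h1
  simp [V] at h1
  simp only [Fin.sum_univ_four]
  linarith

lemma forward_two (σ : ℝ) (hσ : σ ≠ 0) (i : Fin 4) : ∑ j, M.A i j * (1 + σ * M.c j) ^ 2 =
    ∑ j, M.B σ i j * M.c j ^ 2 + 2 * (σ * ∑ j, M.K i j * (1 + σ * M.c j)) := by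
  obtain ⟨a, b, c, d, e, f, g, hA⟩ := hM.hatA_eq
  obtain ⟨k5, k6, k7, hK⟩ := hM.hatK_eq
  have h := hM.forward_of_hat (σ := σ) (x := ![1, 2 * σ, σ ^ 2, 0]) (y := ![0, 0, 1, 0])
    (z := ![2 * σ, 2 * σ ^ 2, 0, 0]) (by
    simp only [hatB, hA, hK]
    ext l
    fin_cases l <;> simp [Matrix.mulVec, dotProduct, Fin.sum_univ_four] <;> field_simp <;> ring)
  have h1 := congrFun h i
  simp only [Matrix.mulVec, dotProduct, Fin.sum_univ_four, Pi.add_apply] at h1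
  simp [V] at h1
  simp only [Fin.sum_univ_four]
  linarith

lemma adjoint_one (σ : ℝ) (hσ : σ ≠ 0) (j : Fin 4) : ∑ i, M.A i j * M.c i + ∑ i, M.K i j =
    ∑ i, M.B σ i j * (1 + σ * M.c i) := by
  obtain ⟨a, b, c, d, e, f, g, hA⟩ := hM.hatA_eq
  obtain ⟨k5, k6, k7, hK⟩ := hM.hatK_eq
  have h := hM.adjoint_of_hat (σ := σ) (x := ![0, 1, 0, 0]) (y := ![1, σ, 0, 0])
    (z := ![1, 0, 0, 0]) (by
    simp only [hatB, hA, hK]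
    ext l
    fin_cases l <;> simp [Matrix.mulVec, dotProduct, Fin.sum_univ_four] <;> field_simp <;> ring)
  have h1 := congrFun h j
  simp only [Matrix.mulVec, dotProduct, Fin.sum_univ_four, Pi.add_apply] at h1
  simp [V] at h1
  simp only [Fin.sum_univ_four]
  linarith

lemma adjoint_two (σ : ℝ) (hσ : σ ≠ 0) (j : Fin 4) :
    ∑ i, M.A i j * M.c i ^ 2 + 2 * ∑ i, M.K i j * M.c i =
      ∑ i, M.B σ i j * (1 + σ * M.c i) ^ 2 := by
  obtain ⟨a, b, c, d, e, f, g, hA⟩ := hM.hatA_eq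
  obtain ⟨k5, k6, k7, hK⟩ := hM.hatK_eq
  have h := hM.adjoint_of_hat (σ := σ) (x := ![0, 0, 1, 0]) (y := ![1, 2 * σ, σ ^ 2, 0])
    (z := ![0, 2, 0, 0]) (by
    simp only [hatB, hA, hK]
    ext l
    fin_cases l <;> simp [Matrix.mulVec, dotProduct, Fin.sum_univ_four] <;> field_simp <;> ring)
  have h1 := congrFun h j
  simp only [Matrix.mulVec, dotProduct, Fin.sum_univ_four, Pi.add_apply] at h1
  simp [V] at h1
  simp only [Fin.sum_univ_four]
  linarith

/-- The cubic term of the stage sum of the local error. It vanishes on uniform grids, and on all grids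
if `1^T A c^3 = 1`. -/
lemma forward_three (σ : ℝ) : ∑ i, (∑ j, M.A i j * (1 + σ * M.c j) ^ 3 -
    ∑ j, M.B σ i j * M.c j ^ 3 - 3 * (σ * ∑ j, M.K i j * (1 + σ * M.c j) ^ 2)) =
      (M.hatA 0 3 - 1) * (σ ^ 3 - 1) := by
  obtain ⟨a, b, c, d, e, f, g, hA⟩ := hM.hatA_eq
  obtain ⟨k5, k6, k7, hK⟩ := hM.hatK_eq
  have hB := hM.V_B_V σ
  have e1 : (M.hatA *ᵥ ![1, 3 * σ, 3 * σ ^ 2, σ ^ 3] - M.hatB σ *ᵥ ![0, 0, 0, 1] -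
      M.hatK *ᵥ ![3 * σ, 6 * σ ^ 2, 3 * σ ^ 3, 0]) 0 = (M.hatA 0 3 - 1) * (σ ^ 3 - 1) := by
    simp only [hatB, hA, hK]
    simp
    ring
  rw [← e1, ← hB, hatA, hatK]
  simp only [Pi.sub_apply, ← Matrix.mulVec_mulVec]
  simp [Matrix.mulVec, dotProduct, V, Fin.sum_univ_four]
  ring

lemma adjoint_three (σ : ℝ) : ∑ j, (∑ i, M.A i j * M.c i ^ 3 +
    3 * ∑ i, M.K i j * M.c i ^ 2 - ∑ i, M.B σ i j * (1 + σ * M.c i) ^ 3) =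
      M.hatA 3 0 * (1 - σ ^ 3) := by
  obtain ⟨a, b, c, d, e, f, g, hA⟩ := hM.hatA_eq
  obtain ⟨k5, k6, k7, hK⟩ := hM.hatK_eq
  have hB := hM.V_B_V σ
  have e1 : (M.hatAᵀ *ᵥ ![0, 0, 0, 1] + M.hatKᵀ *ᵥ ![0, 0, 3, 0] -
      (M.hatB σ)ᵀ *ᵥ ![1, 3 * σ, 3 * σ ^ 2, σ ^ 3]) 0 = M.hatA 3 0 * (1 - σ ^ 3) := by
    simp only [hatB, hA, hK]
    simp [Matrix.mulVec, dotProduct, Fin.sum_univ_four]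
    ring
  rw [← e1, ← hB, hatA, hatK]
  simp only [Pi.sub_apply, Pi.add_apply, Matrix.transpose_mul, Matrix.transpose_transpose,
    ← Matrix.mulVec_mulVec]
  simp [Matrix.mulVec, dotProduct, V, Fin.sum_univ_four]
  ring

end OrderConditions

/-- Perturbations of the forward recursion. The constant does not depend on the grid. -/
theorem OrderConditions.forward_stability (hM : M.OrderConditions Λ) {S : Set ℝ}
    (hS : M.IsDamped S) : ∃ C > 0, ∀ {m N : ℕ} {σ : ℕ → ℝ} {Z r : ℕ → Fin 4 → Vec m} {R Q : ℝ},
      1 ≤ N → (∀ n, 1 ≤ n → n ≤ N → σ n ∈ S) → stageMul M.A0 (Z 0) = r 0 →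
      (∀ n, 1 ≤ n → n ≤ N →
        stageMul (M.stepA N n) (Z n) = stageMul (M.B (σ n)) (Z (n - 1)) + r n) →
      (∀ n ≤ N, ‖r n‖ ≤ R) → ∑ n ∈ Finset.Icc 1 (N - 1), ‖∑ i, r n i‖ ≤ Q →
      ∀ n ≤ N, ‖Z n‖ ≤ C * (R + Q) := by
  obtain ⟨⟨b, hb⟩, G, γ, hG, hγ0, hγ, hR⟩ := hS
  set C1 := entrySum G + entrySum G⁻¹ with hC1
  have hC10 : 0 ≤ C1 := add_nonneg (entrySum_nonneg _) (entrySum_nonneg _)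
  set c := recursionConst M.A γ C1 with hc
  have hc0 : 0 < c := recursionConst_pos _ hγ
  set a0 := entrySum M.A0⁻¹ with ha0
  set aN := entrySum M.AN⁻¹ with haN
  have ha0' : 0 ≤ a0 := entrySum_nonneg _
  have haN' : 0 ≤ aN := entrySum_nonneg _
  refine ⟨c * (a0 + 1) + aN * (|b| * (c * (a0 + 1)) + 1), by positivity, ?_⟩
  intro m N σ Z r R Q hN hσ h0 hZ hrR hQ
  have hR0 : 0 ≤ R := (norm_nonneg _).trans (hrR 0 (by omega))
  have hQ0 : 0 ≤ Q := (Finset.sum_nonneg fun _ _ => norm_nonneg _).trans hQ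
  have hZ0 : ‖Z 0‖ ≤ a0 * R := by
    rw [← stageMul_inv_mul hM.det_A0 (Z 0), h0]
    exact (norm_stageMul_le _ _).trans (mul_le_mul_of_nonneg_left (hrR 0 (by omega)) ha0')
  have hmid := norm_le_of_recursion hM.det_A hM.sum_A (ν := fun x => ‖stageMul G x‖)
    (B := fun n => M.B (σ n)) (K := N - 1) (Z := Z) (r := r) hγ0 hγ hC10
    (fun x y => by rw [stageMul_add]; exact norm_add_le _ _)
    (fun x => (norm_stageMul_le _ _).trans (mul_le_mul_of_nonneg_right
      (by rw [hC1]; linarith [entrySum_nonneg G⁻¹]) (norm_nonneg _)))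
    (fun x => by
      conv_lhs => rw [← stageMul_inv_mul hG x]
      exact (norm_stageMul_le _ _).trans (mul_le_mul_of_nonneg_right
        (by rw [hC1]; linarith [entrySum_nonneg G]) (norm_nonneg _)))
    (fun n _ _ => hM.sum_B _) (fun n _ _ => hM.colSum_B _)
    (fun n h1 h2 x => by
      obtain ⟨X, hX1, hX2⟩ := hR (σ n) (hσ n h1 (by omega))
      rw [← stageMul_mul, hX1, stageMul_mul]
      exact norm_stageMul_le_of_rows hX2 _)
    (fun n h1 h2 => by rw [← hZ n h1 (by omega), stepA_mid h1 (by omega)])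
    hR0 (fun n _ h2 => hrR n (by omega)) hQ
  have hmid' : ∀ n ≤ N - 1, ‖Z n‖ ≤ c * (a0 + 1) * (R + Q) := fun n hn => by
    refine (hmid n hn).trans ?_
    rw [mul_assoc c]
    refine mul_le_mul_of_nonneg_left ?_ hc0.le
    nlinarith [mul_nonneg ha0' hQ0]
  have hRQ : 0 ≤ R + Q := add_nonneg hR0 hQ0
  intro n hn
  rcases Nat.lt_or_ge n N with h | h
  · refine (hmid' n (by omega)).trans (mul_le_mul_of_nonneg_right ?_ hRQ)
    have : 0 ≤ aN * (|b| * (c * (a0 + 1)) + 1) := by positivity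
    linarith
  · obtain rfl : n = N := le_antisymm hn h
    have h1 := hZ n hN le_rfl
    rw [stepA_last hN] at h1
    have h2 : ‖stageMul (M.B (σ n)) (Z (n - 1)) + r n‖ ≤
        (|b| * (c * (a0 + 1)) + 1) * (R + Q) := by
      have h3 : ‖stageMul (M.B (σ n)) (Z (n - 1))‖ ≤ |b| * (c * (a0 + 1) * (R + Q)) :=
        (norm_stageMul_le _ _).trans (mul_le_mul ((hb _ (hσ n hN le_rfl)).trans (le_abs_self b))
          (hmid' _ le_rfl) (norm_nonneg _) (abs_nonneg _))
      refine (norm_add_le _ _).trans ?_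
      linarith [hrR n le_rfl]
    rw [← stageMul_inv_mul hM.det_AN (Z n), h1]
    refine ((norm_stageMul_le _ _).trans (mul_le_mul_of_nonneg_left h2 haN')).trans ?_
    rw [← mul_assoc]
    refine mul_le_mul_of_nonneg_right ?_ hRQ
    have : 0 ≤ c * (a0 + 1) := by positivity
    linarith

/-- Perturbations of the adjoint recursion, which runs backwards. Its propagation matrix
`A^{-T} B(σ)^T` is similar to the transpose of the matrix of the forward recursion, so the same
coordinates give a contraction, now in the sum norm. -/
theorem OrderConditions.adjoint_stability (hM : M.OrderConditions Λ) {S : Set ℝ}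
    (hS : M.IsDamped S) : ∃ C > 0, ∀ {m N : ℕ} {σ : ℕ → ℝ} {Z r : ℕ → Fin 4 → Vec m} {R Q : ℝ},
      1 ≤ N → (∀ n, 1 ≤ n → n ≤ N → σ n ∈ S) → stageMul M.ANᵀ (Z N) = r N →
      (∀ n < N, stageMul (M.stepA N n)ᵀ (Z n) =
        stageMul (M.B (σ (n + 1)))ᵀ (Z (n + 1)) + r n) →
      (∀ n ≤ N, ‖r n‖ ≤ R) → ∑ n ∈ Finset.Icc 1 (N - 1), ‖∑ i, r n i‖ ≤ Q →
      ∀ n ≤ N, ‖Z n‖ ≤ C * (R + Q) := by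
  obtain ⟨⟨b, hb⟩, G, γ, hG, hγ0, hγ, hR⟩ := hS
  have hA := hM.det_A
  have hAT : M.Aᵀ.det ≠ 0 := by rwa [Matrix.det_transpose]
  have hA0T : M.A0ᵀ.det ≠ 0 := by rw [Matrix.det_transpose]; exact hM.det_A0
  have hANT : M.ANᵀ.det ≠ 0 := by rw [Matrix.det_transpose]; exact hM.det_AN
  set U := (G⁻¹)ᵀ * M.Aᵀ with hU
  have hUdet : U.det ≠ 0 := by
    rw [hU, Matrix.det_mul, Matrix.det_transpose, Matrix.det_nonsing_inv, Ring.inverse_eq_inv']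
    exact mul_ne_zero (inv_ne_zero hG) hAT
  set C1 := 4 * entrySum U + entrySum U⁻¹ with hC1
  have hC10 : 0 ≤ C1 := by have := entrySum_nonneg U; have := entrySum_nonneg U⁻¹; positivity
  set c := recursionConst M.Aᵀ γ C1 with hc
  have hc0 : 0 < c := recursionConst_pos _ hγ
  set a0 := entrySum (M.ANᵀ)⁻¹ with ha0
  set aN := entrySum (M.A0ᵀ)⁻¹ with haN
  have ha0' : 0 ≤ a0 := entrySum_nonneg _
  have haN' : 0 ≤ aN := entrySum_nonneg _
  refine ⟨c * (a0 + 1) + aN * (|b| * (c * (a0 + 1)) + 1), by positivity, ?_⟩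
  intro m N σ Z r R Q hN hσ h0 hZ hrR hQ
  have hR0 : 0 ≤ R := (norm_nonneg _).trans (hrR 0 (by omega))
  have hQ0 : 0 ≤ Q := (Finset.sum_nonneg fun _ _ => norm_nonneg _).trans hQ
  have hZ0 : ‖Z N‖ ≤ a0 * R := by
    rw [← stageMul_inv_mul hANT (Z N), h0]
    exact (norm_stageMul_le _ _).trans (mul_le_mul_of_nonneg_left (hrR N le_rfl) ha0')
  have hAinv : M.A * M.A⁻¹ = 1 := Matrix.mul_nonsing_inv _ (isUnit_iff_ne_zero.2 hA)
  have hAinv' : M.A⁻¹ * M.A = 1 := Matrix.nonsing_inv_mul _ (isUnit_iff_ne_zero.2 hA)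
  have hGinv : G⁻¹ * G = 1 := Matrix.nonsing_inv_mul _ (isUnit_iff_ne_zero.2 hG)
  have hGinv' : G * G⁻¹ = 1 := Matrix.mul_nonsing_inv _ (isUnit_iff_ne_zero.2 hG)
  -- the similarity between the two propagation matrices
  have hsim : ∀ X R : Matrix (Fin 4) (Fin 4) ℝ, G * (M.A⁻¹ * X - meanProj M.A) = R * G →
      U * ((M.Aᵀ)⁻¹ * Xᵀ - meanProj M.Aᵀ) = Rᵀ * U := by
    intro X R hX
    have h1 : (X - M.A * meanProj M.A) * G⁻¹ = M.A * G⁻¹ * R := by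
      calc (X - M.A * meanProj M.A) * G⁻¹
          = M.A * (M.A⁻¹ * X - meanProj M.A) * G⁻¹ := by
            rw [mul_sub, ← mul_assoc, hAinv, one_mul]
        _ = M.A * (G⁻¹ * G) * (M.A⁻¹ * X - meanProj M.A) * G⁻¹ := by rw [hGinv, mul_one]
        _ = M.A * G⁻¹ * (G * (M.A⁻¹ * X - meanProj M.A)) * G⁻¹ := by simp only [mul_assoc]
        _ = M.A * G⁻¹ * R := by rw [hX]; simp only [mul_assoc, hGinv', mul_one]
    have h2 : M.Aᵀ * meanProj M.Aᵀ = (M.A * meanProj M.A)ᵀ := by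
      ext i j
      simp only [Matrix.mul_apply, Matrix.transpose_apply, meanProj, Matrix.of_apply, colSum,
        ← Finset.sum_mul]
      ring
    have h3 : M.Aᵀ * ((M.Aᵀ)⁻¹ * Xᵀ - meanProj M.Aᵀ) = (X - M.A * meanProj M.A)ᵀ := by
      rw [mul_sub, h2, ← mul_assoc, Matrix.mul_nonsing_inv _ (isUnit_iff_ne_zero.2 hAT), one_mul,
        Matrix.transpose_sub]
    rw [hU, mul_assoc, h3, ← Matrix.transpose_mul, h1]
    simp only [Matrix.transpose_mul]
  have hsum1 : ∑ i, ∑ j, M.Aᵀ i j = 1 := by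
    rw [← hM.sum_A]; exact Finset.sum_comm
  have hmid := norm_le_of_recursion hAT hsum1 (ν := fun x => ∑ i, ‖stageMul U x i‖)
    (B := fun n => (M.B (σ (N - n + 1)))ᵀ) (K := N - 1) (Z := fun n => Z (N - n))
    (r := fun n => r (N - n)) hγ0 hγ hC10
    (fun x y => by
      rw [stageMul_add, ← Finset.sum_add_distrib]
      exact Finset.sum_le_sum fun i _ => norm_add_le _ _)
    (fun x => by
      refine (sum_norm_le _).trans ?_
      have := norm_stageMul_le U x
      have h2 := mul_nonneg (entrySum_nonneg U⁻¹) (norm_nonneg x)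
      rw [hC1, add_mul]
      linarith)
    (fun x => by
      conv_lhs => rw [← stageMul_inv_mul hUdet x]
      refine (norm_stageMul_le _ _).trans ?_
      have h1 := mul_le_mul_of_nonneg_left (norm_le_sum_norm (stageMul U x))
        (entrySum_nonneg U⁻¹)
      have h2 : 0 ≤ 4 * entrySum U * ∑ i, ‖stageMul U x i‖ := by
        have := entrySum_nonneg U
        positivity
      rw [hC1, add_mul]
      linarith)
    (fun n _ _ i => hM.colSum_B _ i) (fun n _ _ j => hM.sum_B _ j)
    (fun n h1 h2 x => by
      obtain ⟨X, hX1, hX2⟩ := hR (σ (N - n + 1)) (hσ _ (by omega) (by omega))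
      rw [← stageMul_mul, hsim _ _ hX1, stageMul_mul]
      exact sum_norm_stageMul_transpose_le hX2 _)
    (fun n h1 h2 => by
      have h3 := hZ (N - n) (by omega)
      rw [stepA_mid (by omega) (by omega)] at h3
      rw [h3, show N - (n - 1) = N - n + 1 by omega])
    hR0 (fun n _ h2 => hrR _ (by omega))
    (Q := Q) (by
      refine le_trans (le_of_eq ?_) hQ
      refine Finset.sum_nbij' (fun n => N - n) (fun n => N - n) ?_ ?_ ?_ ?_ ?_
      · intro n hn; simp only [Finset.mem_Icc] at hn ⊢; omega
      · intro n hn; simp only [Finset.mem_Icc] at hn ⊢; omega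
      · intro n hn; simp only [Finset.mem_Icc] at hn ⊢; omega
      · intro n hn; simp only [Finset.mem_Icc] at hn ⊢; omega
      · intro n _; rfl)
  have hRQ : 0 ≤ R + Q := add_nonneg hR0 hQ0
  have hmid' : ∀ n, 1 ≤ n → n ≤ N → ‖Z n‖ ≤ c * (a0 + 1) * (R + Q) := fun n h1 hn => by
    have h2 := hmid (N - n) (by omega)
    simp only [show N - (N - n) = n by omega, Nat.sub_zero] at h2
    refine h2.trans ?_
    rw [mul_assoc c]
    refine mul_le_mul_of_nonneg_left ?_ hc0.le
    nlinarith [mul_nonneg ha0' hQ0]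
  intro n hn
  rcases Nat.eq_zero_or_pos n with rfl | h
  · have h1 := hZ 0 (by omega)
    rw [stepA_zero] at h1
    have h2 : ‖stageMul (M.B (σ (0 + 1)))ᵀ (Z (0 + 1)) + r 0‖ ≤
        (|b| * (c * (a0 + 1)) + 1) * (R + Q) := by
      have h3 : ‖stageMul (M.B (σ (0 + 1)))ᵀ (Z (0 + 1))‖ ≤ |b| * (c * (a0 + 1) * (R + Q)) := by
        refine (norm_stageMul_le _ _).trans (mul_le_mul ?_
          (hmid' _ le_rfl (by omega)) (norm_nonneg _) (abs_nonneg _))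
        rw [entrySum_transpose]
        exact (hb _ (hσ _ le_rfl (by omega))).trans (le_abs_self b)
      refine (norm_add_le _ _).trans ?_
      linarith [hrR 0 (by omega)]
    rw [← stageMul_inv_mul hA0T (Z 0), h1]
    refine ((norm_stageMul_le _ _).trans (mul_le_mul_of_nonneg_left h2 haN')).trans ?_
    rw [← mul_assoc]
    refine mul_le_mul_of_nonneg_right ?_ hRQ
    have : 0 ≤ c * (a0 + 1) := by positivity
    linarith
  · refine (hmid' n h hn).trans (mul_le_mul_of_nonneg_right ?_ hRQ)
    have : 0 ≤ aN * (|b| * (c * (a0 + 1)) + 1) := by positivity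
    linarith

end PeerTriplet
/-! ### Taylor expansion of linear functionals -/

/-- Taylor's formula with base point at the left end of the interval, for a function `D 0` with
successive derivatives `D 1, D 2, ...` -/
lemma norm_sub_taylor_le {D : ℕ → ℝ → Vec m} {a b M : ℝ} {K : ℕ}
    (hD : ∀ k < K, ∀ x ∈ Icc a b, HasDerivWithinAt (D k) (D (k + 1) x) (Icc a b) x)
    (hM : ∀ x ∈ Icc a b, ‖D K x‖ ≤ M) :
    ∀ x ∈ Icc a b, ‖D 0 x - ∑ j ∈ Finset.range K, ((x - a) ^ j / j.factorial) • D j a‖ ≤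
      M * (x - a) ^ K := by
  induction K generalizing D with
  | zero => intro x hx; simpa using hM x hx
  | succ K ih =>
    intro x hx
    have hM0 : 0 ≤ M := (norm_nonneg _).trans (hM x hx)
    have ih' := ih (D := fun k => D (k + 1)) (fun k hk => hD (k + 1) (by omega)) hM
    set F : ℝ → Vec m := fun t =>
      D 0 t - ∑ j ∈ Finset.range (K + 1), ((t - a) ^ j / j.factorial) • D j a with hF
    have hder : ∀ t ∈ Icc a x, HasDerivWithinAt F
        (D 1 t - ∑ j ∈ Finset.range K, ((t - a) ^ j / j.factorial) • D (j + 1) a) (Icc a x) t := by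
      intro t ht
      have h0 : HasDerivWithinAt (D 0) (D 1 t) (Icc a x) t :=
        (hD 0 (by omega) t ⟨ht.1, ht.2.trans hx.2⟩).mono (Icc_subset_Icc_right hx.2)
      have h1 : HasDerivWithinAt
          (fun t => ∑ j ∈ Finset.range (K + 1), ((t - a) ^ j / j.factorial) • D j a)
          (∑ j ∈ Finset.range K, ((t - a) ^ j / j.factorial) • D (j + 1) a) (Icc a x) t := by
        simp only [Finset.sum_range_succ']
        have h2 : ∀ j ∈ Finset.range K, HasDerivWithinAt
            (fun t => ((t - a) ^ (j + 1) / (j + 1).factorial) • D (j + 1) a)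
            (((t - a) ^ j / j.factorial) • D (j + 1) a) (Icc a x) t := by
          intro j _
          have h3 : HasDerivAt (fun t : ℝ => (t - a) ^ (j + 1) / (j + 1).factorial)
              ((t - a) ^ j / j.factorial) t := by
            have h4 := (((hasDerivAt_id t).sub_const a).pow (j + 1)).div_const
              ((j + 1).factorial : ℝ)
            refine h4.congr_deriv ?_
            rw [Nat.factorial_succ]
            push_cast
            simp
            field_simp
          exact (h3.smul_const (D (j + 1) a)).hasDerivWithinAt
        have h5 := (HasDerivWithinAt.fun_sum h2).add_const
          (((t - a) ^ 0 / (Nat.factorial 0 : ℝ)) • D 0 a)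
        simpa using h5
      exact h0.sub h1
    have hbd : ∀ t ∈ Ico a x,
        ‖D 1 t - ∑ j ∈ Finset.range K, ((t - a) ^ j / j.factorial) • D (j + 1) a‖ ≤
          M * (x - a) ^ K := by
      intro t ht
      refine (ih' t ⟨ht.1, ht.2.le.trans hx.2⟩).trans (mul_le_mul_of_nonneg_left ?_ hM0)
      exact pow_le_pow_left₀ (by linarith [ht.1]) (by linarith [ht.2]) _
    have h := norm_image_sub_le_of_norm_deriv_le_segment' hder hbd x ⟨hx.1, le_rfl⟩
    have hFa : F a = 0 := by
      simp [hF, Finset.sum_range_succ']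
    rw [hFa, sub_zero] at h
    calc _ = ‖F x‖ := rfl
      _ ≤ _ := h
      _ = _ := by ring

/-- A functional that combines values and derivatives of a function at nodes `a + h x` differs from
its Taylor polynomial in `h` by `O(h^K)`. -/
lemma functional_sub_taylor_le {D : ℕ → ℝ → Vec m} {a b M h X q : ℝ} {K : ℕ} (hK : 1 ≤ K)
    (hD : ∀ k < K, ∀ x ∈ Icc a b, HasDerivWithinAt (D k) (D (k + 1) x) (Icc a b) x)
    (hM : ∀ x ∈ Icc a b, ‖D K x‖ ≤ M) (hh : 0 ≤ h) (hX : 1 ≤ X)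
    {α β κ x y z : Fin 4 → ℝ}
    (hα : ∀ j, |α j| ≤ q) (hβ : ∀ j, |β j| ≤ q) (hκ : ∀ j, |κ j| ≤ q)
    (hx0 : ∀ j, 0 ≤ x j) (hy0 : ∀ j, 0 ≤ y j) (hz0 : ∀ j, 0 ≤ z j)
    (hxX : ∀ j, x j ≤ X) (hyX : ∀ j, y j ≤ X) (hzX : ∀ j, z j ≤ X)
    (hxb : ∀ j, a + h * x j ≤ b) (hyb : ∀ j, a + h * y j ≤ b) (hzb : ∀ j, a + h * z j ≤ b) :
    ‖∑ j, α j • D 0 (a + h * x j) - ∑ j, β j • D 0 (a + h * y j) -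
        h • ∑ j, κ j • D 1 (a + h * z j) -
      ∑ k ∈ Finset.range K, (h ^ k / k.factorial * (∑ j, α j * x j ^ k - ∑ j, β j * y j ^ k -
        k * ∑ j, κ j * z j ^ (k - 1))) • D k a‖ ≤ 12 * q * X ^ K * M * h ^ K := by
  obtain ⟨K, rfl⟩ : ∃ K', K = K' + 1 := ⟨K - 1, by omega⟩
  have hab : a ≤ b := le_trans (le_add_of_nonneg_right (mul_nonneg hh (hx0 0))) (hxb 0)
  have hM0 : 0 ≤ M := (norm_nonneg _).trans (hM a ⟨le_rfl, hab⟩)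
  have hq : 0 ≤ q := (abs_nonneg _).trans (hα 0)
  have hX0 : 0 ≤ X := by linarith
  have h0 := norm_sub_taylor_le hD hM
  have h1 := norm_sub_taylor_le (D := fun k => D (k + 1)) (K := K)
    (fun k hk => hD (k + 1) (by omega)) hM
  set B := M * (h * X) ^ (K + 1) with hB
  have hB0 : 0 ≤ B := by positivity
  set ρ : ℝ → Vec m := fun s => D 0 (a + h * s) -
    ∑ j ∈ Finset.range (K + 1), ((h * s) ^ j / j.factorial) • D j a with hρ
  set ρ' : ℝ → Vec m := fun s => D 1 (a + h * s) -
    ∑ j ∈ Finset.range K, ((h * s) ^ j / j.factorial) • D (j + 1) a with hρ'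
  have hρle : ∀ s, 0 ≤ s → s ≤ X → a + h * s ≤ b → ‖ρ s‖ ≤ B := by
    intro s hs hsX hsb
    have h2 := h0 (a + h * s) ⟨le_add_of_nonneg_right (mul_nonneg hh hs), hsb⟩
    rw [add_sub_cancel_left] at h2
    refine h2.trans (mul_le_mul_of_nonneg_left ?_ hM0)
    exact pow_le_pow_left₀ (mul_nonneg hh hs) (mul_le_mul_of_nonneg_left hsX hh) _
  have hρ'le : ∀ s, 0 ≤ s → s ≤ X → a + h * s ≤ b → h * ‖ρ' s‖ ≤ B := by
    intro s hs hsX hsb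
    have h2 := h1 (a + h * s) ⟨le_add_of_nonneg_right (mul_nonneg hh hs), hsb⟩
    rw [add_sub_cancel_left] at h2
    have h3 : M * (h * s) ^ K ≤ M * (h * X) ^ K := mul_le_mul_of_nonneg_left
      (pow_le_pow_left₀ (mul_nonneg hh hs) (mul_le_mul_of_nonneg_left hsX hh) _) hM0
    calc h * ‖ρ' s‖ ≤ h * (M * (h * X) ^ K) := mul_le_mul_of_nonneg_left (h2.trans h3) hh
      _ ≤ (h * X) * (M * (h * X) ^ K) := by
        refine mul_le_mul_of_nonneg_right ?_ (by positivity)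
        nlinarith
      _ = B := by rw [hB]; ring
  -- the Taylor polynomials collect to the moments of the functional
  have hpoly : ∀ (γ u : Fin 4 → ℝ), ∑ j, γ j • D 0 (a + h * u j) = ∑ j, γ j • ρ (u j) +
      ∑ k ∈ Finset.range (K + 1), (h ^ k / k.factorial * ∑ j, γ j * u j ^ k) • D k a := by
    intro γ u
    have : ∀ j, γ j • D 0 (a + h * u j) = γ j • ρ (u j) +
        ∑ k ∈ Finset.range (K + 1), (h ^ k / k.factorial * (γ j * u j ^ k)) • D k a := by
      intro j
      rw [hρ]
      simp only [smul_sub, Finset.smul_sum, smul_smul]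
      rw [sub_add, ← Finset.sum_sub_distrib, Finset.sum_eq_zero, sub_zero]
      intro k _
      rw [← sub_smul, mul_pow]
      convert! zero_smul ℝ _ using 2
      ring
    rw [Finset.sum_congr rfl fun j _ => this j, Finset.sum_add_distrib, Finset.sum_comm]
    simp only [Finset.mul_sum, Finset.sum_smul]
  have hpoly' : ∀ (γ u : Fin 4 → ℝ), h • ∑ j, γ j • D 1 (a + h * u j) =
      h • ∑ j, γ j • ρ' (u j) + ∑ k ∈ Finset.range (K + 1),
        (h ^ k / k.factorial * (k * ∑ j, γ j * u j ^ (k - 1))) • D k a := by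
    intro γ u
    have : ∀ j, h • γ j • D 1 (a + h * u j) = h • γ j • ρ' (u j) +
        ∑ k ∈ Finset.range (K + 1),
          (h ^ k / k.factorial * (k * (γ j * u j ^ (k - 1)))) • D k a := by
      intro j
      rw [hρ', Finset.sum_range_succ']
      simp only [smul_sub, Finset.smul_sum, smul_smul]
      simp only [Nat.cast_zero, zero_mul, mul_zero, zero_smul, add_zero]
      rw [sub_add, ← Finset.sum_sub_distrib, Finset.sum_eq_zero, sub_zero]
      intro k _
      rw [← sub_smul, mul_pow]
      convert! zero_smul ℝ _ using 2
      rw [Nat.factorial_succ]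
      push_cast
      field_simp
      ring
    rw [Finset.smul_sum, Finset.sum_congr rfl fun j _ => this j, Finset.sum_add_distrib,
      Finset.sum_comm, Finset.smul_sum]
    simp only [Finset.mul_sum, Finset.sum_smul]
  have key : ∑ j, α j • D 0 (a + h * x j) - ∑ j, β j • D 0 (a + h * y j) -
        h • ∑ j, κ j • D 1 (a + h * z j) -
      ∑ k ∈ Finset.range (K + 1), (h ^ k / k.factorial * (∑ j, α j * x j ^ k -
        ∑ j, β j * y j ^ k - k * ∑ j, κ j * z j ^ (k - 1))) • D k a =
      ∑ j, α j • ρ (x j) - ∑ j, β j • ρ (y j) - h • ∑ j, κ j • ρ' (z j) := by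
    rw [hpoly, hpoly, hpoly']
    simp only [mul_sub, sub_smul, Finset.sum_sub_distrib]
    abel
  rw [key]
  have hs : ∀ (γ u : Fin 4 → ℝ), (∀ j, |γ j| ≤ q) → (∀ j, ‖ρ (u j)‖ ≤ B) →
      ‖∑ j, γ j • ρ (u j)‖ ≤ 4 * (q * B) := by
    intro γ u h2 h3
    refine (norm_sum_le _ _).trans ((Finset.sum_le_sum (g := fun _ => q * B) fun j _ => ?_).trans
      (by simp))
    rw [norm_smul]
    exact mul_le_mul (h2 j) (h3 j) (norm_nonneg _) hq
  have hs' : ‖h • ∑ j, κ j • ρ' (z j)‖ ≤ 4 * (q * B) := by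
    rw [Finset.smul_sum]
    refine (norm_sum_le _ _).trans ((Finset.sum_le_sum (g := fun _ => q * B) fun j _ => ?_).trans
      (by simp))
    rw [norm_smul, norm_smul, Real.norm_eq_abs, abs_of_nonneg hh, Real.norm_eq_abs,
      mul_left_comm]
    exact mul_le_mul (hκ j) (hρ'le _ (hz0 j) (hzX j) (hzb j)) (by positivity) hq
  have e1 := hs α x hα fun j => hρle _ (hx0 j) (hxX j) (hxb j)
  have e2 := hs β y hβ fun j => hρle _ (hy0 j) (hyX j) (hyb j)
  calc _ ≤ 4 * (q * B) + 4 * (q * B) + 4 * (q * B) :=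
        (norm_sub_le _ _).trans (add_le_add ((norm_sub_le _ _).trans (add_le_add e1 e2)) hs')
    _ = _ := by rw [hB]; ring

/-- The defect of a functional that is exact for polynomials of degree at most two. -/
lemma norm_functional_le_of_order_three {D : ℕ → ℝ → Vec m} {a b M h X q : ℝ}
    (hD : ∀ k < 3, ∀ x ∈ Icc a b, HasDerivWithinAt (D k) (D (k + 1) x) (Icc a b) x)
    (hM : ∀ x ∈ Icc a b, ‖D 3 x‖ ≤ M) (hh : 0 ≤ h) (hX : 1 ≤ X)
    {α β κ x y z : Fin 4 → ℝ}
    (hα : ∀ j, |α j| ≤ q) (hβ : ∀ j, |β j| ≤ q) (hκ : ∀ j, |κ j| ≤ q)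
    (hx0 : ∀ j, 0 ≤ x j) (hy0 : ∀ j, 0 ≤ y j) (hz0 : ∀ j, 0 ≤ z j)
    (hxX : ∀ j, x j ≤ X) (hyX : ∀ j, y j ≤ X) (hzX : ∀ j, z j ≤ X)
    (hxb : ∀ j, a + h * x j ≤ b) (hyb : ∀ j, a + h * y j ≤ b) (hzb : ∀ j, a + h * z j ≤ b)
    (m0 : ∑ j, α j = ∑ j, β j) (m1 : ∑ j, α j * x j = ∑ j, β j * y j + ∑ j, κ j)
    (m2 : ∑ j, α j * x j ^ 2 = ∑ j, β j * y j ^ 2 + 2 * ∑ j, κ j * z j) :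
    ‖∑ j, α j • D 0 (a + h * x j) - ∑ j, β j • D 0 (a + h * y j) -
        h • ∑ j, κ j • D 1 (a + h * z j)‖ ≤ 12 * q * X ^ 3 * M * h ^ 3 := by
  have h := functional_sub_taylor_le (K := 3) (by norm_num) hD hM hh hX hα hβ hκ hx0 hy0 hz0
    hxX hyX hzX hxb hyb hzb
  rw [Finset.sum_eq_zero (s := Finset.range 3), sub_zero] at h
  · exact h
  · intro k hk
    have : k = 0 ∨ k = 1 ∨ k = 2 := by simp only [Finset.mem_range] at hk; omega
    rcases this with rfl | rfl | rfl
    · simp [m0]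
    · simp [m1]
    · simp [m2]

/-- The defect of a functional that is exact for polynomials of degree at most two and almost exact
for cubic ones. -/
lemma norm_functional_le_of_order_four {D : ℕ → ℝ → Vec m} {a b M3 M4 h X q δ : ℝ}
    (hD : ∀ k < 4, ∀ x ∈ Icc a b, HasDerivWithinAt (D k) (D (k + 1) x) (Icc a b) x)
    (hM3 : ‖D 3 a‖ ≤ M3) (hM : ∀ x ∈ Icc a b, ‖D 4 x‖ ≤ M4) (hh : 0 ≤ h) (hX : 1 ≤ X)
    {α β κ x y z : Fin 4 → ℝ}
    (hα : ∀ j, |α j| ≤ q) (hβ : ∀ j, |β j| ≤ q) (hκ : ∀ j, |κ j| ≤ q)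
    (hx0 : ∀ j, 0 ≤ x j) (hy0 : ∀ j, 0 ≤ y j) (hz0 : ∀ j, 0 ≤ z j)
    (hxX : ∀ j, x j ≤ X) (hyX : ∀ j, y j ≤ X) (hzX : ∀ j, z j ≤ X)
    (hxb : ∀ j, a + h * x j ≤ b) (hyb : ∀ j, a + h * y j ≤ b) (hzb : ∀ j, a + h * z j ≤ b)
    (m0 : ∑ j, α j = ∑ j, β j) (m1 : ∑ j, α j * x j = ∑ j, β j * y j + ∑ j, κ j)
    (m2 : ∑ j, α j * x j ^ 2 = ∑ j, β j * y j ^ 2 + 2 * ∑ j, κ j * z j)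
    (m3 : |∑ j, α j * x j ^ 3 - ∑ j, β j * y j ^ 3 - 3 * ∑ j, κ j * z j ^ 2| ≤ δ) :
    ‖∑ j, α j • D 0 (a + h * x j) - ∑ j, β j • D 0 (a + h * y j) -
        h • ∑ j, κ j • D 1 (a + h * z j)‖ ≤ 12 * q * X ^ 4 * M4 * h ^ 4 + δ * M3 * h ^ 3 := by
  have hδ : 0 ≤ δ := (abs_nonneg _).trans m3
  have h1 := functional_sub_taylor_le (K := 4) (by norm_num) hD hM hh hX hα hβ hκ hx0 hy0 hz0
    hxX hyX hzX hxb hyb hzb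
  rw [Finset.sum_range_succ, Finset.sum_eq_zero (s := Finset.range 3), zero_add] at h1
  · have h2 := norm_sub_norm_le (∑ j, α j • D 0 (a + h * x j) - ∑ j, β j • D 0 (a + h * y j) -
      h • ∑ j, κ j • D 1 (a + h * z j)) ((h ^ 3 / (Nat.factorial 3 : ℝ) * (∑ j, α j * x j ^ 3 -
        ∑ j, β j * y j ^ 3 - (3 : ℕ) * ∑ j, κ j * z j ^ (3 - 1))) • D 3 a)
    have h3 : ‖((h ^ 3 / (Nat.factorial 3 : ℝ) * (∑ j, α j * x j ^ 3 -
        ∑ j, β j * y j ^ 3 - (3 : ℕ) * ∑ j, κ j * z j ^ (3 - 1))) • D 3 a)‖ ≤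
          δ * M3 * h ^ 3 := by
      rw [norm_smul, norm_mul, Real.norm_eq_abs, Real.norm_eq_abs, abs_of_nonneg (by positivity)]
      have e1 : h ^ 3 / (Nat.factorial 3 : ℝ) ≤ h ^ 3 :=
        div_le_self (by positivity) (by norm_num [Nat.factorial])
      calc _ ≤ (h ^ 3 * δ) * M3 := by
            refine mul_le_mul (mul_le_mul e1 ?_ (abs_nonneg _) (by positivity)) hM3
              (norm_nonneg _) (by positivity)
            simpa using m3
        _ = _ := by ring
    linarith
  · intro k hk
    have : k = 0 ∨ k = 1 ∨ k = 2 := by simp only [Finset.mem_range] at hk; omega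
    rcases this with rfl | rfl | rfl
    · simp [m0]
    · simp [m1]
    · simp [m2]

/-! ### Grids and local norms -/

section Grid

variable {M : PeerTriplet} {lo hi T Tstar : ℝ} {N : ℕ} {h : ℕ → ℝ}

lemma gridPoint_succ (h : ℕ → ℝ) (n : ℕ) : gridPoint h (n + 1) = gridPoint h n + h n := by
  simp [gridPoint, Finset.sum_range_succ]

lemma PeerTriplet.one_le_cstar (M : PeerTriplet) : 1 ≤ M.cstar := le_max_left _ _

lemma PeerTriplet.c_le_cstar (M : PeerTriplet) (i : Fin 4) : M.c i ≤ M.cstar :=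
  (le_ciSup (Finite.bddAbove_range M.c) i).trans (le_max_right _ _)

lemma hasDerivWithinAt_iteratedDerivWithin {v : ℝ → Vec m} (hT : 0 < Tstar)
    (hv : ContDiffOn ℝ 4 v (Icc 0 Tstar)) {k : ℕ} (hk : k < 4) {x : ℝ} (hx : x ∈ Icc 0 Tstar) :
    HasDerivWithinAt (iteratedDerivWithin k v (Icc 0 Tstar))
      (iteratedDerivWithin (k + 1) v (Icc 0 Tstar) x) (Icc 0 Tstar) x := by
  rw [iteratedDerivWithin_succ]
  exact ((hv.differentiableOn_iteratedDerivWithin (by exact_mod_cast hk)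
    (uniqueDiffOn_Icc hT)) x hx).hasDerivWithinAt

lemma continuousOn_iteratedDerivWithin {v : ℝ → Vec m} (hT : 0 < Tstar)
    (hv : ContDiffOn ℝ 4 v (Icc 0 Tstar)) {k : ℕ} (hk : k ≤ 4) :
    ContinuousOn (iteratedDerivWithin k v (Icc 0 Tstar)) (Icc 0 Tstar) :=
  hv.continuousOn_iteratedDerivWithin (by exact_mod_cast hk) (uniqueDiffOn_Icc hT)

lemma localNorm_nonneg (v : ℝ → Vec m) (k n : ℕ) : 0 ≤ localNorm M Tstar N h v k n := by
  refine Real.sSup_nonneg ?_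
  rintro _ ⟨x, _, rfl⟩
  exact norm_nonneg _

lemma le_gridSeminorm {n : ℕ} (hn : n ≤ N) (v : ℝ → Vec m) :
    h n ^ 3 * max (localNorm M Tstar N h v 3 n) (localNorm M Tstar N h v 4 n) ≤
      gridSeminorm M Tstar N h v :=
  le_ciSup (f := fun n : Fin (N + 1) => h n ^ 3 *
      max (localNorm M Tstar N h v 3 n) (localNorm M Tstar N h v 4 n))
    (Finite.bddAbove_range _) ⟨n, by omega⟩

namespace IsGrid

variable (hg : IsGrid M lo hi T Tstar N h)
include hg

lemma node_mem_cell (hc : ∀ i, 0 ≤ M.c i) {n : ℕ} (hn : n ≤ N) (i : Fin 4) :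
    gridPoint h n + h n * M.c i ∈ cell M h n :=
  ⟨le_add_of_nonneg_right (mul_nonneg (hg.pos n hn).le (hc i)),
    by gcongr; exacts [(hg.pos n hn).le, M.c_le_cstar i]⟩

lemma node_mem (hc : ∀ i, 0 ≤ M.c i) {n : ℕ} (hn : n ≤ N) (i : Fin 4) :
    gridPoint h n + h n * M.c i ∈ Icc 0 Tstar :=
  hg.cell_subset n hn (hg.node_mem_cell hc hn i)

lemma step_le {n : ℕ} (hn : n ≤ N) : h n ≤ T := by
  rw [← hg.sum_eq]
  exact Finset.single_le_sum (fun k hk => (hg.pos k (by rw [Finset.mem_range] at hk; omega)).le)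
    (Finset.mem_range.2 (by omega))

lemma sum_step_le {s : Finset ℕ} (hs : ∀ n ∈ s, n ≤ N) : ∑ n ∈ s, h n ≤ T := by
  rw [← hg.sum_eq]
  exact Finset.sum_le_sum_of_subset_of_nonneg
    (fun n hn => Finset.mem_range.2 (by have := hs n hn; omega))
    fun k hk _ => (hg.pos k (by rw [Finset.mem_range] at hk; omega)).le

lemma norm_le_localNorm (hT : 0 < Tstar) {v : ℝ → Vec m} (hv : ContDiffOn ℝ 4 v (Icc 0 Tstar))
    {k l n : ℕ} (hk : k ≤ 4) (hl : l ≤ N) (h1 : l ≤ n + 1) (h2 : n ≤ l + 1) {x : ℝ}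
    (hx : x ∈ cell M h l) :
    ‖iteratedDerivWithin k v (Icc 0 Tstar) x‖ ≤ localNorm M Tstar N h v k n := by
  have hc := (continuousOn_iteratedDerivWithin hT hv hk).norm
  have hb : BddAbove ((fun x => ‖iteratedDerivWithin k v (Icc 0 Tstar) x‖) '' Icc 0 Tstar) :=
    (isCompact_Icc.image_of_continuousOn hc).bddAbove
  refine le_csSup (hb.mono (image_mono ?_)) ⟨x, ?_, rfl⟩
  · refine iUnion₂_subset fun l hl => hg.cell_subset l hl.1
  · exact mem_iUnion₂.2 ⟨l, ⟨hl, h1, h2⟩, hx⟩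

lemma localNorm_le {v : ℝ → Vec m} {k n : ℕ} {C : ℝ} (hC : 0 ≤ C)
    (hv : ∀ x ∈ Icc 0 Tstar, ‖iteratedDerivWithin k v (Icc 0 Tstar) x‖ ≤ C) :
    localNorm M Tstar N h v k n ≤ C := by
  refine Real.sSup_le ?_ hC
  rintro _ ⟨x, hx, rfl⟩
  obtain ⟨l, hl, hx⟩ := mem_iUnion₂.1 hx
  exact hv x (hg.cell_subset l hl.1 hx)

/-- Two consecutive cells together form an interval. -/
lemma mem_cell_or {n : ℕ} (hn : n + 1 ≤ N) {x : ℝ} (hx : x ∈ Icc (gridPoint h n)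
    (max (gridPoint h n + h n * M.cstar) (gridPoint h (n + 1) + h (n + 1) * M.cstar))) :
    x ∈ cell M h n ∨ x ∈ cell M h (n + 1) := by
  by_cases h1 : x ≤ gridPoint h n + h n * M.cstar
  · exact Or.inl ⟨hx.1, h1⟩
  · right
    push Not at h1
    refine ⟨?_, (le_max_iff.1 hx.2).resolve_left (by linarith)⟩
    rw [gridPoint_succ]
    have := mul_le_mul_of_nonneg_left M.one_le_cstar (hg.pos n (by omega)).le
    linarith

lemma Icc_max_subset {n : ℕ} (hn : n + 1 ≤ N) : Icc (gridPoint h n)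
    (max (gridPoint h n + h n * M.cstar) (gridPoint h (n + 1) + h (n + 1) * M.cstar)) ⊆
      Icc 0 Tstar := by
  intro x hx
  rcases hg.mem_cell_or hn hx with h | h
  · exact hg.cell_subset _ (by omega) h
  · exact hg.cell_subset _ hn h

lemma seminorm_nonneg (v : ℝ → Vec m) : 0 ≤ gridSeminorm M Tstar N h v :=
  Real.iSup_nonneg fun n => mul_nonneg (pow_nonneg (hg.pos n (by omega)).le _)
    (le_max_of_le_left (localNorm_nonneg _ _ _))

end IsGrid

end Grid
/-! ### Local errors -/

/-- The defect of the values of `v` in the forward step `n`, where `v' = derivWithin v` takes the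
place of the right-hand side. -/
def forwardDefect (M : PeerTriplet) (Tstar : ℝ) (N : ℕ) (h : ℕ → ℝ) (v : ℝ → Vec m) (n : ℕ) :
    Fin 4 → Vec m :=
  stageMul (M.stepA N n) (exactStages M h v n) -
    (if n = 0 then fun i => M.a i • v 0
      else stageMul (M.B (ratio h n)) (exactStages M h v (n - 1))) -
    h n • stageMul (M.stepK N n) (exactStages M h (iteratedDerivWithin 1 v (Icc 0 Tstar)) n)

/-- The defect of the values of `v` in the adjoint step `n`, where `K_n^T v'` takes the place of the
right-hand side. -/
def adjointDefect (M : PeerTriplet) (Tstar : ℝ) (N : ℕ) (h : ℕ → ℝ) (v : ℝ → Vec m) (n : ℕ) :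
    Fin 4 → Vec m :=
  stageMul (M.stepA N n)ᵀ (exactStages M h v n) -
    (if n = N then fun i => M.w i • v (gridPoint h (N + 1))
      else stageMul (M.B (ratio h (n + 1)))ᵀ (exactStages M h v (n + 1))) +
    h n • stageMul (M.stepK N n)ᵀ (exactStages M h (iteratedDerivWithin 1 v (Icc 0 Tstar)) n)

namespace PeerTriplet

/-- A common bound for the entries of all coefficient matrices. -/
def coeffBound (M : PeerTriplet) : ℝ :=
  entrySum M.A + entrySum M.A0 + entrySum M.AN + (entrySum M.K + entrySum M.K0 + entrySum M.KN)

lemma coeffBound_nonneg (M : PeerTriplet) : 0 ≤ M.coeffBound := by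
  have := entrySum_nonneg M.A
  have := entrySum_nonneg M.A0
  have := entrySum_nonneg M.AN
  have := entrySum_nonneg M.K
  have := entrySum_nonneg M.K0
  have := entrySum_nonneg M.KN
  unfold coeffBound
  positivity

/-- Each of the coefficient matrices satisfies the common bound. -/
lemma entrySum_le_coeffBound (M : PeerTriplet) :
    (entrySum M.A ≤ M.coeffBound ∧ entrySum M.A0 ≤ M.coeffBound ∧
      entrySum M.AN ≤ M.coeffBound) ∧ entrySum M.K ≤ M.coeffBound ∧
      entrySum M.K0 ≤ M.coeffBound ∧ entrySum M.KN ≤ M.coeffBound := by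
  have := entrySum_nonneg M.A
  have := entrySum_nonneg M.A0
  have := entrySum_nonneg M.AN
  have := entrySum_nonneg M.K
  have := entrySum_nonneg M.K0
  have := entrySum_nonneg M.KN
  unfold coeffBound
  refine ⟨⟨?_, ?_, ?_⟩, ?_, ?_, ?_⟩ <;> linarith

lemma entrySum_stepA_le (M : PeerTriplet) (N n : ℕ) : entrySum (M.stepA N n) ≤ M.coeffBound := by
  obtain ⟨⟨h1, h2, h3⟩, -⟩ := M.entrySum_le_coeffBound
  unfold stepA
  split_ifs
  exacts [h2, h3, h1]

lemma entrySum_stepK_le (M : PeerTriplet) (N n : ℕ) : entrySum (M.stepK N n) ≤ M.coeffBound := by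
  obtain ⟨-, h1, h2, h3⟩ := M.entrySum_le_coeffBound
  unfold stepK
  split_ifs
  exacts [h2, h3, h1]

end PeerTriplet

lemma abs_colSum_le (X : Matrix (Fin 4) (Fin 4) ℝ) (j : Fin 4) : |colSum X j| ≤ entrySum X := by
  rw [← entrySum_transpose]
  exact (Finset.abs_sum_le_sum_abs _ _).trans
    (Finset.single_le_sum (f := fun j => ∑ i, |X i j|)
      (fun _ _ => Finset.sum_nonneg fun _ _ => abs_nonneg _) (Finset.mem_univ j))

lemma abs_single_le {q r : ℝ} (hr : |r| ≤ q) (j : Fin 4) : |(![r, 0, 0, 0] : Fin 4 → ℝ) j| ≤ q := by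
  have : 0 ≤ q := (abs_nonneg _).trans hr
  fin_cases j <;> simp [hr, this]

namespace IsGrid

variable {M : PeerTriplet} {Λ : Set ℝ} {lo hi T Tstar b : ℝ} {N : ℕ} {h : ℕ → ℝ}

lemma mul_ratio (hg : IsGrid M lo hi T Tstar N h) {n : ℕ} (hn : n + 1 ≤ N) :
    h n * ratio h (n + 1) = h (n + 1) := by
  have := hg.pos n (by omega)
  simp only [ratio, Nat.add_sub_cancel]
  field_simp

lemma node_eq (hg : IsGrid M lo hi T Tstar N h) {n : ℕ} (hn : n + 1 ≤ N) (x : ℝ) :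
    gridPoint h n + h n * (1 + ratio h (n + 1) * x) = gridPoint h (n + 1) + h (n + 1) * x := by
  rw [gridPoint_succ, ← hg.mul_ratio hn]
  ring

/-- The size of the nodes of two consecutive steps, relative to the first stepsize. -/
lemma node_le (hg : IsGrid M lo hi T Tstar N h) (hc : ∀ i, 0 ≤ M.c i) (hlo : 0 < lo) {n : ℕ}
    (hn : n + 1 ≤ N) (j : Fin 4) :
    0 ≤ 1 + ratio h (n + 1) * M.c j ∧ 1 + ratio h (n + 1) * M.c j ≤ 1 + (1 + |hi|) * M.cstar := by
  have h1 := hg.ratio_mem (n + 1) (by omega) hn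
  have h2 : 0 < ratio h (n + 1) := hlo.trans_le h1.1
  have h3 : ratio h (n + 1) ≤ |hi| := h1.2.trans (le_abs_self _)
  have h4 := mul_nonneg h2.le (hc j)
  have h5 := mul_le_mul h3 (M.c_le_cstar j) (hc j) (abs_nonneg _)
  constructor
  · linarith
  · linarith [M.one_le_cstar]

lemma c_le (hi : ℝ) (j : Fin 4) : M.c j ≤ 1 + (1 + |hi|) * M.cstar := by
  have h1 := mul_nonneg (abs_nonneg hi) (by linarith [M.one_le_cstar] : 0 ≤ M.cstar)
  linarith [M.c_le_cstar j]

lemma one_le_nodeBound (M : PeerTriplet) (hi : ℝ) : 1 ≤ 1 + (1 + |hi|) * M.cstar := by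
  have h1 := mul_nonneg (abs_nonneg hi) (by linarith [M.one_le_cstar] : 0 ≤ M.cstar)
  linarith [M.one_le_cstar]

lemma ratio_pos (hg : IsGrid M lo hi T Tstar N h) (hlo : 0 < lo) {n : ℕ} (h1 : 1 ≤ n)
    (hn : n ≤ N) : 0 < ratio h n := hlo.trans_le (hg.ratio_mem n h1 hn).1

/-- The stepsizes of neighbouring steps are comparable. -/
lemma step_le_div (hg : IsGrid M lo hi T Tstar N h) (hlo : 0 < lo) {n : ℕ} (hn : n + 1 ≤ N) :
    h n ≤ h (n + 1) / lo := by
  rw [le_div_iff₀ hlo, ← hg.mul_ratio hn]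
  exact mul_le_mul_of_nonneg_left (hg.ratio_mem (n + 1) (by omega) hn).1 (hg.pos n (by omega)).le

lemma hasDeriv_Icc (hg : IsGrid M lo hi T Tstar N h) (hT : 0 < Tstar) {v : ℝ → Vec m}
    (hv : ContDiffOn ℝ 4 v (Icc 0 Tstar)) {n : ℕ} (hn : n + 1 ≤ N) {k : ℕ} (hk : k < 4) :
    ∀ x ∈ Icc (gridPoint h n) (max (gridPoint h n + h n * M.cstar)
      (gridPoint h (n + 1) + h (n + 1) * M.cstar)), HasDerivWithinAt
        (iteratedDerivWithin k v (Icc 0 Tstar)) (iteratedDerivWithin (k + 1) v (Icc 0 Tstar) x)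
        (Icc (gridPoint h n) (max (gridPoint h n + h n * M.cstar)
          (gridPoint h (n + 1) + h (n + 1) * M.cstar))) x :=
  fun _ hx => (hasDerivWithinAt_iteratedDerivWithin hT hv hk (hg.Icc_max_subset hn hx)).mono
    (hg.Icc_max_subset hn)

lemma hasDeriv_cell (hg : IsGrid M lo hi T Tstar N h) (hT : 0 < Tstar) {v : ℝ → Vec m}
    (hv : ContDiffOn ℝ 4 v (Icc 0 Tstar)) {n : ℕ} (hn : n ≤ N) {k : ℕ} (hk : k < 4) :
    ∀ x ∈ cell M h n, HasDerivWithinAt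
        (iteratedDerivWithin k v (Icc 0 Tstar)) (iteratedDerivWithin (k + 1) v (Icc 0 Tstar) x)
        (cell M h n) x :=
  fun _ hx => (hasDerivWithinAt_iteratedDerivWithin hT hv hk (hg.cell_subset n hn hx)).mono
    (hg.cell_subset n hn)

end IsGrid

namespace PeerTriplet.OrderConditions

variable {M : PeerTriplet} {Λ : Set ℝ}

lemma forward_step_zero (hM : M.OrderConditions Λ) {N n : ℕ} (h1 : 1 ≤ n) (σ : ℝ) (i : Fin 4) :
    ∑ j, M.stepA N n i j = ∑ j, M.B σ i j := by
  rw [hM.sum_B]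
  unfold stepA
  split_ifs with h2
  · omega
  · exact hM.end_zero i
  · rfl

lemma forward_step_one (hM : M.OrderConditions Λ) {N n : ℕ} (h1 : 1 ≤ n) {σ : ℝ} (hσ : σ ≠ 0)
    (i : Fin 4) : ∑ j, M.stepA N n i j * (1 + σ * M.c j) =
      ∑ j, M.B σ i j * M.c j + ∑ j, σ * M.stepK N n i j := by
  have h := hM.forward_one σ hσ i
  unfold stepA stepK
  split_ifs with h2 h3
  · omega
  · have e0 := hM.end_zero i
    have e1 := hM.end_one i
    simp only [Fin.sum_univ_four] at *
    linear_combination h + e0 + σ * e1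
  · simp only [Fin.sum_univ_four] at *
    linear_combination h

lemma forward_step_two (hM : M.OrderConditions Λ) {N n : ℕ} (h1 : 1 ≤ n) {σ : ℝ} (hσ : σ ≠ 0)
    (i : Fin 4) : ∑ j, M.stepA N n i j * (1 + σ * M.c j) ^ 2 =
      ∑ j, M.B σ i j * M.c j ^ 2 + 2 * ∑ j, σ * M.stepK N n i j * (1 + σ * M.c j) := by
  have h := hM.forward_two σ hσ i
  unfold stepA stepK
  split_ifs with h2 h3
  · omega
  · have e0 := hM.end_zero i
    have e1 := hM.end_one i
    have e2 := hM.end_two i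
    simp only [Fin.sum_univ_four] at *
    linear_combination h + e0 + 2 * σ * e1 + σ ^ 2 * e2
  · simp only [Fin.sum_univ_four] at *
    linear_combination h

lemma adjoint_step_zero (hM : M.OrderConditions Λ) {N n : ℕ} (h1 : n < N) (σ : ℝ) (j : Fin 4) :
    ∑ i, M.stepA N n i j = ∑ i, M.B σ i j := by
  rw [hM.colSum_B]
  unfold stepA
  split_ifs with h2
  · exact hM.start_adj_zero j
  · omega
  · rfl

lemma adjoint_step_one (hM : M.OrderConditions Λ) {N n : ℕ} (h1 : n < N) {σ : ℝ} (hσ : σ ≠ 0)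
    (j : Fin 4) : ∑ i, M.stepA N n i j * M.c i =
      ∑ i, M.B σ i j * (1 + σ * M.c i) + ∑ i, -M.stepK N n i j := by
  have h := hM.adjoint_one σ hσ j
  unfold stepA stepK
  split_ifs with h2 h3
  · have e1 := hM.start_adj_one j
    simp only [Fin.sum_univ_four] at *
    linear_combination h + e1
  · omega
  · simp only [Fin.sum_univ_four] at *
    linear_combination h

lemma adjoint_step_two (hM : M.OrderConditions Λ) {N n : ℕ} (h1 : n < N) {σ : ℝ} (hσ : σ ≠ 0)
    (j : Fin 4) : ∑ i, M.stepA N n i j * M.c i ^ 2 =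
      ∑ i, M.B σ i j * (1 + σ * M.c i) ^ 2 + 2 * ∑ i, -M.stepK N n i j * M.c i := by
  have h := hM.adjoint_two σ hσ j
  unfold stepA stepK
  split_ifs with h2 h3
  · have e1 := hM.start_adj_two j
    simp only [Fin.sum_univ_four] at *
    linear_combination h + e1
  · omega
  · simp only [Fin.sum_univ_four] at *
    linear_combination h

/-- The local error of the forward steps has order three. -/
theorem forwardDefect_le (hM : M.OrderConditions Λ) {lo hi : ℝ} (hlo : 0 < lo) (b : ℝ) :
    ∃ C > 0, ∀ {m N : ℕ} {T Tstar : ℝ} {h : ℕ → ℝ} {v : ℝ → Vec m}, 0 < Tstar →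
      IsGrid M lo hi T Tstar N h → (∀ n, 1 ≤ n → n ≤ N → entrySum (M.B (ratio h n)) ≤ b) →
      ContDiffOn ℝ 4 v (Icc 0 Tstar) → ∀ n ≤ N,
        ‖forwardDefect M Tstar N h v n‖ ≤ C * (h n ^ 3 * localNorm M Tstar N h v 3 n) := by
  set X := 1 + (1 + |hi|) * M.cstar with hX
  have hX1 : 1 ≤ X := IsGrid.one_le_nodeBound M hi
  have hcX : ∀ j, M.c j ≤ X := IsGrid.c_le hi
  set q := (1 + |hi|) * M.coeffBound + |b| with hq
  have hcb := M.coeffBound_nonneg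
  have hq0 : M.coeffBound ≤ q := by
    have := mul_nonneg (abs_nonneg hi) hcb
    linarith [abs_nonneg b]
  refine ⟨12 * q * X ^ 3 * (1 + (1 / lo) ^ 3) + 1, by positivity, ?_⟩
  intro m N T Tstar h v hT hg hb hv n hn
  have hL := localNorm_nonneg (M := M) (Tstar := Tstar) (N := N) (h := h) v 3 n
  have hhn := hg.pos n hn
  have hA : ∀ n i j, |M.stepA N n i j| ≤ q := fun n i j =>
    ((abs_le_entrySum _ i j).trans (M.entrySum_stepA_le N n)).trans hq0
  have hfin : ∀ c, 0 ≤ c → c ≤ 1 + (1 / lo) ^ 3 →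
      12 * q * X ^ 3 * localNorm M Tstar N h v 3 n * (c * h n ^ 3) ≤
      (12 * q * X ^ 3 * (1 + (1 / lo) ^ 3) + 1) * (h n ^ 3 * localNorm M Tstar N h v 3 n) := by
    intro c hc hc1
    have h0 : 0 ≤ h n ^ 3 * localNorm M Tstar N h v 3 n := by positivity
    have h1 : 0 ≤ 12 * q * X ^ 3 := by positivity
    calc _ = (12 * q * X ^ 3 * c) * (h n ^ 3 * localNorm M Tstar N h v 3 n) := by ring
      _ ≤ _ := by
        refine mul_le_mul_of_nonneg_right ?_ h0
        linarith [mul_le_mul_of_nonneg_left hc1 h1]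
  refine (pi_norm_le_iff_of_nonneg (by positivity)).2 fun i => ?_
  rcases n with _ | n
  · have h1 := norm_functional_le_of_order_three (D := fun k => iteratedDerivWithin k v (Icc 0 Tstar))
      (a := gridPoint h 0) (b := gridPoint h 0 + h 0 * M.cstar) (h := h 0) (X := X) (q := q)
      (M := localNorm M Tstar N h v 3 0)
      (α := fun j => M.A0 i j) (β := fun j => M.A0 i j) (κ := fun j => M.K0 i j)
      (x := M.c) (y := fun _ => 0) (z := M.c)
      (fun k hk => hg.hasDeriv_cell hT hv hn (by omega))
      (fun x hx => hg.norm_le_localNorm hT hv (by omega) hn (by omega) (by omega) hx)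
      hhn.le hX1 (fun j => by simpa [stepA_zero] using hA 0 i j)
      (fun j => by simpa [stepA_zero] using hA 0 i j)
      (fun j => by
        have := ((abs_le_entrySum _ i j).trans (M.entrySum_stepK_le N 0)).trans hq0
        rwa [stepK_zero] at this)
      hM.c_nonneg (fun _ => le_rfl) hM.c_nonneg hcX (fun _ => by linarith) hcX
      (fun j => (hg.node_mem_cell hM.c_nonneg hn j).2)
      (fun j => by
        rw [mul_zero, add_zero]
        exact le_add_of_nonneg_right (mul_nonneg hhn.le (by linarith [M.one_le_cstar])))
      (fun j => (hg.node_mem_cell hM.c_nonneg hn j).2) rfl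
      (by simpa using hM.start_one i) (by simpa using hM.start_two i)
    refine le_trans (le_of_eq ?_) (h1.trans ?_)
    · simp only [forwardDefect, stepA_zero, stepK_zero, if_pos, Pi.sub_apply, Pi.smul_apply,
        stageMul, exactStages, iteratedDerivWithin_zero, mul_zero, add_zero, ← Finset.sum_smul]
      simp [gridPoint, PeerTriplet.a]
    · simpa using hfin 1 zero_le_one (by have : 0 < (1 / lo) ^ 3 := by positivity
                                         linarith)
  · have hσ := hg.ratio_pos hlo (by omega) hn
    have hn' := hg.pos n (by omega)
    have h1 := norm_functional_le_of_order_three (D := fun k => iteratedDerivWithin k v (Icc 0 Tstar))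
      (a := gridPoint h n) (b := max (gridPoint h n + h n * M.cstar)
        (gridPoint h (n + 1) + h (n + 1) * M.cstar)) (h := h n) (X := X) (q := q)
      (M := localNorm M Tstar N h v 3 (n + 1))
      (α := fun j => M.stepA N (n + 1) i j) (β := fun j => M.B (ratio h (n + 1)) i j)
      (κ := fun j => ratio h (n + 1) * M.stepK N (n + 1) i j)
      (x := fun j => 1 + ratio h (n + 1) * M.c j) (y := M.c)
      (z := fun j => 1 + ratio h (n + 1) * M.c j)
      (fun k hk => hg.hasDeriv_Icc hT hv hn (by omega))
      (fun x hx => by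
        rcases hg.mem_cell_or hn hx with hx | hx
        · exact hg.norm_le_localNorm hT hv (by omega) (by omega) (by omega) (by omega) hx
        · exact hg.norm_le_localNorm hT hv (by omega) hn (by omega) (by omega) hx)
      hn'.le hX1 (fun j => hA _ i j)
      (fun j => by
        have e1 := (abs_le_entrySum _ i j).trans (hb (n + 1) (by omega) hn)
        have e2 : 0 ≤ (1 + |hi|) * M.coeffBound := by positivity
        linarith [le_abs_self b])
      (fun j => by
        have e1 := (abs_le_entrySum _ i j).trans (M.entrySum_stepK_le N (n + 1))
        have e2 := (hg.ratio_mem (n + 1) (by omega) hn).2.trans (le_abs_self hi)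
        rw [abs_mul, abs_of_pos hσ]
        have e3 := mul_le_mul e2 e1 (abs_nonneg _) (abs_nonneg _)
        linarith [abs_nonneg b])
      (fun j => (hg.node_le hM.c_nonneg hlo hn j).1) hM.c_nonneg
      (fun j => (hg.node_le hM.c_nonneg hlo hn j).1)
      (fun j => (hg.node_le hM.c_nonneg hlo hn j).2) hcX
      (fun j => (hg.node_le hM.c_nonneg hlo hn j).2)
      (fun j => by
        rw [hg.node_eq hn]
        exact le_max_of_le_right (hg.node_mem_cell hM.c_nonneg hn j).2)
      (fun j => le_max_of_le_left (hg.node_mem_cell hM.c_nonneg (by omega) j).2)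
      (fun j => by
        rw [hg.node_eq hn]
        exact le_max_of_le_right (hg.node_mem_cell hM.c_nonneg hn j).2)
      (hM.forward_step_zero (by omega) _ i) (hM.forward_step_one (by omega) hσ.ne' i)
      (hM.forward_step_two (by omega) hσ.ne' i)
    refine le_trans (le_of_eq ?_) (h1.trans ?_)
    · simp only [forwardDefect, if_neg (Nat.succ_ne_zero n), Pi.sub_apply, Pi.smul_apply,
        stageMul, exactStages, iteratedDerivWithin_zero, hg.node_eq hn, Nat.add_sub_cancel,
        mul_smul, ← Finset.smul_sum, ← hg.mul_ratio hn]
    · refine le_trans ?_ (hfin ((1 / lo) ^ 3) (by positivity) (by linarith))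
      have e1 : h n ^ 3 ≤ (1 / lo) ^ 3 * h (n + 1) ^ 3 := by
        rw [← mul_pow]
        refine pow_le_pow_left₀ hn'.le ?_ 3
        rw [one_div_mul_eq_div]
        exact hg.step_le_div hlo hn
      exact mul_le_mul_of_nonneg_left e1 (by positivity)

end PeerTriplet.OrderConditions
namespace PeerTriplet.OrderConditions

variable {M : PeerTriplet} {Λ : Set ℝ}

/-- The stage sum of the local error, which is the part that accumulates, has order four. -/
theorem sum_forwardDefect_le (hM : M.OrderConditions Λ) {lo hi : ℝ} (hlo : 0 < lo) (b : ℝ) :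
    ∃ C > 0, ∀ {m N : ℕ} {T Tstar κ : ℝ} {h : ℕ → ℝ} {v : ℝ → Vec m}, 0 < Tstar →
      IsGrid M lo hi T Tstar N h → (∀ n, 1 ≤ n → n ≤ N → entrySum (M.B (ratio h n)) ≤ b) →
      0 ≤ κ →
      (∀ n, 1 ≤ n → n ≤ N → |(M.hatA 0 3 - 1) * (ratio h n ^ 3 - 1)| ≤ κ * h n) →
      ContDiffOn ℝ 4 v (Icc 0 Tstar) → ∀ n, 1 ≤ n → n < N →
        ‖∑ i, forwardDefect M Tstar N h v n i‖ ≤ C * (1 + κ) * (h n * (h n ^ 3 *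
          max (localNorm M Tstar N h v 3 n) (localNorm M Tstar N h v 4 n))) := by
  set X := 1 + (1 + |hi|) * M.cstar with hX
  have hX1 : 1 ≤ X := IsGrid.one_le_nodeBound M hi
  have hcX : ∀ j, M.c j ≤ X := IsGrid.c_le hi
  set q := (1 + |hi|) * M.coeffBound + |b| with hq
  have hcb := M.coeffBound_nonneg
  have hq0 : M.coeffBound ≤ q := by
    have := mul_nonneg (abs_nonneg hi) hcb
    linarith [abs_nonneg b]
  have hq1 : 0 ≤ q := hcb.trans hq0
  refine ⟨12 * q * X ^ 4 * (1 / lo) ^ 4 + (1 / lo) ^ 3 + 1, by positivity, ?_⟩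
  intro m N T Tstar κ h v hT hg hb hκ hsm hv n h1n hnN
  obtain ⟨n, rfl⟩ : ∃ n', n = n' + 1 := ⟨n - 1, by omega⟩
  have hn : n + 1 ≤ N := hnN.le
  have hσ := hg.ratio_pos hlo (by omega) hn
  have hn' := hg.pos n (by omega)
  have hn1 := hg.pos (n + 1) hn
  set L := max (localNorm M Tstar N h v 3 (n + 1)) (localNorm M Tstar N h v 4 (n + 1)) with hL
  have hL0 : 0 ≤ L := le_max_of_le_left (localNorm_nonneg _ _ _)
  have hx : ∀ k ≤ 4, ∀ x ∈ Icc (gridPoint h n) (max (gridPoint h n + h n * M.cstar)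
        (gridPoint h (n + 1) + h (n + 1) * M.cstar)),
      ‖iteratedDerivWithin k v (Icc 0 Tstar) x‖ ≤ localNorm M Tstar N h v k (n + 1) := by
    intro k hk x hx
    rcases hg.mem_cell_or hn hx with hx | hx
    · exact hg.norm_le_localNorm hT hv hk (by omega) (by omega) (by omega) hx
    · exact hg.norm_le_localNorm hT hv hk hn (by omega) (by omega) hx
  have hend : ∀ j, gridPoint h n + h n * (1 + ratio h (n + 1) * M.c j) ≤
      max (gridPoint h n + h n * M.cstar) (gridPoint h (n + 1) + h (n + 1) * M.cstar) := by
    intro j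
    rw [hg.node_eq hn]
    exact le_max_of_le_right (hg.node_mem_cell hM.c_nonneg hn j).2
  have h1 := norm_functional_le_of_order_four (D := fun k => iteratedDerivWithin k v (Icc 0 Tstar))
    (a := gridPoint h n) (b := max (gridPoint h n + h n * M.cstar)
      (gridPoint h (n + 1) + h (n + 1) * M.cstar)) (h := h n) (X := X) (q := q)
    (M3 := L) (M4 := L) (δ := κ * h (n + 1))
    (α := fun j => colSum M.A j) (β := fun j => colSum (M.B (ratio h (n + 1))) j)
    (κ := fun j => ratio h (n + 1) * colSum M.K j)
    (x := fun j => 1 + ratio h (n + 1) * M.c j) (y := M.c)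
    (z := fun j => 1 + ratio h (n + 1) * M.c j)
    (fun k hk => hg.hasDeriv_Icc hT hv hn hk)
    ((hx 3 (by norm_num) _ ⟨le_rfl, le_max_of_le_left (le_add_of_nonneg_right
      (mul_nonneg hn'.le (by linarith [M.one_le_cstar])))⟩).trans (le_max_left _ _))
    (fun x h => (hx 4 le_rfl x h).trans (le_max_right _ _))
    hn'.le hX1
    (fun j => by
      have e1 := (abs_colSum_le M.A j).trans M.entrySum_le_coeffBound.1.1
      exact e1.trans hq0)
    (fun j => by
      have e1 := (abs_colSum_le _ j).trans (hb (n + 1) (by omega) hn)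
      have e2 : 0 ≤ (1 + |hi|) * M.coeffBound := by positivity
      linarith [le_abs_self b])
    (fun j => by
      have e1 := (abs_colSum_le M.K j).trans M.entrySum_le_coeffBound.2.1
      have e2 := (hg.ratio_mem (n + 1) (by omega) hn).2.trans (le_abs_self hi)
      rw [abs_mul, abs_of_pos hσ]
      have e3 := mul_le_mul e2 e1 (abs_nonneg _) (abs_nonneg _)
      linarith [abs_nonneg b])
    (fun j => (hg.node_le hM.c_nonneg hlo hn j).1) hM.c_nonneg
    (fun j => (hg.node_le hM.c_nonneg hlo hn j).1)
    (fun j => (hg.node_le hM.c_nonneg hlo hn j).2) hcX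
    (fun j => (hg.node_le hM.c_nonneg hlo hn j).2)
    hend
    (fun j => le_max_of_le_left (hg.node_mem_cell hM.c_nonneg (by omega) j).2)
    hend
    (Finset.sum_congr rfl fun j _ => (hM.colSum_B _ j).symm)
    (by
      have e := Finset.sum_congr (rfl : (Finset.univ : Finset (Fin 4)) = _)
        fun i _ => hM.forward_one (ratio h (n + 1)) hσ.ne' i
      simp only [Fin.sum_univ_four, colSum] at e ⊢
      linear_combination e)
    (by
      have e := Finset.sum_congr (rfl : (Finset.univ : Finset (Fin 4)) = _)
        fun i _ => hM.forward_two (ratio h (n + 1)) hσ.ne' i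
      simp only [Fin.sum_univ_four, colSum] at e ⊢
      linear_combination e)
    (by
      refine le_trans (le_of_eq ?_) (hsm (n + 1) (by omega) hn)
      congr 1
      rw [← hM.forward_three (ratio h (n + 1))]
      simp only [Fin.sum_univ_four, colSum]
      ring)
  refine le_trans (le_of_eq ?_) (h1.trans ?_)
  · congr 1
    simp only [forwardDefect, if_neg (Nat.succ_ne_zero n), Pi.sub_apply, Pi.smul_apply,
      Finset.sum_sub_distrib, ← Finset.smul_sum, sum_stageMul, stepA_mid h1n hnN,
      stepK_mid h1n hnN]
    simp only [colSum, exactStages, iteratedDerivWithin_zero, hg.node_eq hn, Nat.add_sub_cancel,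
      mul_smul, ← Finset.smul_sum, ← hg.mul_ratio hn]
  · have e1 : h n ≤ 1 / lo * h (n + 1) := by
      rw [one_div_mul_eq_div]
      exact hg.step_le_div hlo hn
    have e3 : h n ^ 3 ≤ (1 / lo) ^ 3 * h (n + 1) ^ 3 := by
      rw [← mul_pow]; exact pow_le_pow_left₀ hn'.le e1 3
    have e4 : h n ^ 4 ≤ (1 / lo) ^ 4 * h (n + 1) ^ 4 := by
      rw [← mul_pow]; exact pow_le_pow_left₀ hn'.le e1 4
    have f1 := mul_le_mul_of_nonneg_left e4 (by positivity : 0 ≤ 12 * q * X ^ 4 * L)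
    have f2 := mul_le_mul_of_nonneg_left e3 (by positivity : 0 ≤ κ * h (n + 1) * L)
    have f3 : 0 ≤ 12 * q * X ^ 4 * (1 / lo) ^ 4 * κ * (h (n + 1) ^ 4 * L) := by positivity
    have f4 : 0 ≤ (1 / lo) ^ 3 * (h (n + 1) ^ 4 * L) := by positivity
    have f5 : 0 ≤ (1 + κ) * (h (n + 1) ^ 4 * L) := by positivity
    nlinarith

/-- The local error of the adjoint steps has order three. -/
theorem adjointDefect_le (hM : M.OrderConditions Λ) {lo hi : ℝ} (hlo : 0 < lo) (b : ℝ) :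
    ∃ C > 0, ∀ {m N : ℕ} {T Tstar : ℝ} {h : ℕ → ℝ} {v : ℝ → Vec m}, 0 < Tstar →
      IsGrid M lo hi T Tstar N h → (∀ n, 1 ≤ n → n ≤ N → entrySum (M.B (ratio h n)) ≤ b) →
      ContDiffOn ℝ 4 v (Icc 0 Tstar) → ∀ n ≤ N,
        ‖adjointDefect M Tstar N h v n‖ ≤ C * (h n ^ 3 * localNorm M Tstar N h v 3 n) := by
  set X := 1 + (1 + |hi|) * M.cstar with hX
  have hX1 : 1 ≤ X := IsGrid.one_le_nodeBound M hi
  have hcX : ∀ j, M.c j ≤ X := IsGrid.c_le hi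
  set q := M.coeffBound + |b| with hq
  have hcb := M.coeffBound_nonneg
  have hq0 : M.coeffBound ≤ q := by linarith [abs_nonneg b]
  refine ⟨12 * q * X ^ 3 + 1, by positivity, ?_⟩
  intro m N T Tstar h v hT hg hb hv n hn
  have hL := localNorm_nonneg (M := M) (Tstar := Tstar) (N := N) (h := h) v 3 n
  have hhn := hg.pos n hn
  have hA : ∀ n i j, |M.stepA N n i j| ≤ q := fun n i j =>
    ((abs_le_entrySum _ i j).trans (M.entrySum_stepA_le N n)).trans hq0
  have hK : ∀ n i j, |(-M.stepK N n i j)| ≤ q := fun n i j => by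
    rw [abs_neg]
    exact ((abs_le_entrySum _ i j).trans (M.entrySum_stepK_le N n)).trans hq0
  have hfin : 12 * q * X ^ 3 * localNorm M Tstar N h v 3 n * h n ^ 3 ≤
      (12 * q * X ^ 3 + 1) * (h n ^ 3 * localNorm M Tstar N h v 3 n) := by
    have h0 : 0 ≤ h n ^ 3 * localNorm M Tstar N h v 3 n := by positivity
    linarith
  refine (pi_norm_le_iff_of_nonneg (by positivity)).2 fun i => ?_
  have hsplit : h n • ∑ j, M.stepK N n j i • exactStages M h
        (iteratedDerivWithin 1 v (Icc 0 Tstar)) n j =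
      -(h n • ∑ j, (-M.stepK N n j i) • iteratedDerivWithin 1 v (Icc 0 Tstar)
        (gridPoint h n + h n * M.c j)) := by
    simp only [neg_smul, Finset.sum_neg_distrib, smul_neg, neg_neg, exactStages]
  rcases Nat.lt_or_ge n N with hnN | hnN
  · have hσ := hg.ratio_pos hlo (Nat.succ_pos n) hnN
    have h1 := norm_functional_le_of_order_three (D := fun k => iteratedDerivWithin k v (Icc 0 Tstar))
      (a := gridPoint h n) (b := max (gridPoint h n + h n * M.cstar)
        (gridPoint h (n + 1) + h (n + 1) * M.cstar)) (h := h n) (X := X) (q := q)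
      (M := localNorm M Tstar N h v 3 n)
      (α := fun j => M.stepA N n j i) (β := fun j => M.B (ratio h (n + 1)) j i)
      (κ := fun j => -M.stepK N n j i)
      (x := M.c) (y := fun j => 1 + ratio h (n + 1) * M.c j) (z := M.c)
      (fun k hk => hg.hasDeriv_Icc hT hv hnN (by omega))
      (fun x hx => by
        rcases hg.mem_cell_or hnN hx with hx | hx
        · exact hg.norm_le_localNorm hT hv (by omega) hn (by omega) (by omega) hx
        · exact hg.norm_le_localNorm hT hv (by omega) hnN (by omega) (by omega) hx)
      hhn.le hX1 (fun j => hA _ j i)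
      (fun j => by
        have e1 := (abs_le_entrySum _ j i).trans (hb (n + 1) (by omega) hnN)
        linarith [le_abs_self b])
      (fun j => hK _ j i)
      hM.c_nonneg (fun j => (hg.node_le hM.c_nonneg hlo hnN j).1) hM.c_nonneg
      hcX (fun j => (hg.node_le hM.c_nonneg hlo hnN j).2) hcX
      (fun j => le_max_of_le_left (hg.node_mem_cell hM.c_nonneg hn j).2)
      (fun j => by
        rw [hg.node_eq hnN]
        exact le_max_of_le_right (hg.node_mem_cell hM.c_nonneg hnN j).2)
      (fun j => le_max_of_le_left (hg.node_mem_cell hM.c_nonneg hn j).2)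
      (hM.adjoint_step_zero hnN _ i) (hM.adjoint_step_one hnN hσ.ne' i)
      (hM.adjoint_step_two hnN hσ.ne' i)
    refine le_trans (le_of_eq ?_) (h1.trans hfin)
    simp only [adjointDefect, if_neg hnN.ne, Pi.sub_apply, Pi.add_apply, Pi.smul_apply,
      stageMul, Matrix.transpose_apply, hsplit]
    simp only [exactStages, iteratedDerivWithin_zero, hg.node_eq hnN, ← sub_eq_add_neg]
  · obtain rfl : n = N := le_antisymm hn hnN
    have hw : |M.w i| ≤ q := (abs_colSum_le M.AN i).trans
      (M.entrySum_le_coeffBound.1.2.2.trans hq0)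
    have hA' := hA n
    have hK' := hK n
    simp only [stepA_last hg.one_le, stepK_last hg.one_le] at hA' hK'
    have h1 := norm_functional_le_of_order_three (D := fun k => iteratedDerivWithin k v (Icc 0 Tstar))
      (a := gridPoint h n) (b := gridPoint h n + h n * M.cstar) (h := h n) (X := X) (q := q)
      (M := localNorm M Tstar n h v 3 n)
      (α := fun j => M.AN j i) (β := ![M.w i, 0, 0, 0]) (κ := fun j => -M.KN j i)
      (x := M.c) (y := fun _ => 1) (z := M.c)
      (fun k hk => hg.hasDeriv_cell hT hv hn (by omega))
      (fun x hx => hg.norm_le_localNorm hT hv (by omega) hn (by omega) (by omega) hx)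
      hhn.le hX1 (fun j => hA' j i) (abs_single_le hw) (fun j => hK' j i)
      hM.c_nonneg (fun _ => zero_le_one) hM.c_nonneg hcX (fun _ => hX1) hcX
      (fun j => (hg.node_mem_cell hM.c_nonneg hn j).2)
      (fun j => by gcongr; exact M.one_le_cstar)
      (fun j => (hg.node_mem_cell hM.c_nonneg hn j).2)
      (by simp [Fin.sum_univ_four, w])
      (by
        have e := hM.end_adj_one i
        simp [Fin.sum_univ_four] at e ⊢
        linear_combination e)
      (by
        have e := hM.end_adj_two i
        simp [Fin.sum_univ_four] at e ⊢
        linear_combination e)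
    refine le_trans (le_of_eq ?_) (h1.trans hfin)
    simp only [adjointDefect, if_pos, Pi.sub_apply, Pi.add_apply, Pi.smul_apply,
      stageMul, Matrix.transpose_apply, hsplit]
    simp only [exactStages, iteratedDerivWithin_zero, gridPoint_succ, ← sub_eq_add_neg,
      stepA_last hg.one_le, stepK_last hg.one_le]
    simp [Fin.sum_univ_four]

/-- The stage sum of the local error of the adjoint steps has order four. -/
theorem sum_adjointDefect_le (hM : M.OrderConditions Λ) {lo hi : ℝ} (hlo : 0 < lo) (b : ℝ) :
    ∃ C > 0, ∀ {m N : ℕ} {T Tstar κ : ℝ} {h : ℕ → ℝ} {v : ℝ → Vec m}, 0 < Tstar →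
      IsGrid M lo hi T Tstar N h → (∀ n, 1 ≤ n → n ≤ N → entrySum (M.B (ratio h n)) ≤ b) →
      0 ≤ κ → (∀ n < N, |M.hatA 3 0 * (1 - ratio h (n + 1) ^ 3)| ≤ κ * h n) →
      ContDiffOn ℝ 4 v (Icc 0 Tstar) → ∀ n, 1 ≤ n → n < N →
        ‖∑ i, adjointDefect M Tstar N h v n i‖ ≤ C * (1 + κ) * (h n * (h n ^ 3 *
          max (localNorm M Tstar N h v 3 n) (localNorm M Tstar N h v 4 n))) := by
  set X := 1 + (1 + |hi|) * M.cstar with hX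
  have hX1 : 1 ≤ X := IsGrid.one_le_nodeBound M hi
  have hcX : ∀ j, M.c j ≤ X := IsGrid.c_le hi
  set q := M.coeffBound + |b| with hq
  have hcb := M.coeffBound_nonneg
  have hq0 : M.coeffBound ≤ q := by linarith [abs_nonneg b]
  have hq1 : 0 ≤ q := hcb.trans hq0
  refine ⟨12 * q * X ^ 4 + 1, by positivity, ?_⟩
  intro m N T Tstar κ h v hT hg hb hκ hsm hv n h1n hnN
  have hσ := hg.ratio_pos hlo (Nat.succ_pos n) hnN
  have hn := hg.pos n hnN.le
  set L := max (localNorm M Tstar N h v 3 n) (localNorm M Tstar N h v 4 n) with hL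
  have hL0 : 0 ≤ L := le_max_of_le_left (localNorm_nonneg _ _ _)
  have hx : ∀ k ≤ 4, ∀ x ∈ Icc (gridPoint h n) (max (gridPoint h n + h n * M.cstar)
        (gridPoint h (n + 1) + h (n + 1) * M.cstar)),
      ‖iteratedDerivWithin k v (Icc 0 Tstar) x‖ ≤ localNorm M Tstar N h v k n := by
    intro k hk x hx
    rcases hg.mem_cell_or hnN hx with hx | hx
    · exact hg.norm_le_localNorm hT hv hk hnN.le (by omega) (by omega) hx
    · exact hg.norm_le_localNorm hT hv hk hnN (by omega) (by omega) hx
  have hend : ∀ j, gridPoint h n + h n * M.c j ≤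
      max (gridPoint h n + h n * M.cstar) (gridPoint h (n + 1) + h (n + 1) * M.cstar) :=
    fun j => le_max_of_le_left (hg.node_mem_cell hM.c_nonneg hnN.le j).2
  -- row sums, as the stage sum of the transposed matrices is taken
  have h1 := norm_functional_le_of_order_four (D := fun k => iteratedDerivWithin k v (Icc 0 Tstar))
    (a := gridPoint h n) (b := max (gridPoint h n + h n * M.cstar)
      (gridPoint h (n + 1) + h (n + 1) * M.cstar)) (h := h n) (X := X) (q := q)
    (M3 := L) (M4 := L) (δ := κ * h n)
    (α := fun j => colSum M.Aᵀ j) (β := fun j => colSum (M.B (ratio h (n + 1)))ᵀ j)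
    (κ := fun j => -colSum M.Kᵀ j)
    (x := M.c) (y := fun j => 1 + ratio h (n + 1) * M.c j) (z := M.c)
    (fun k hk => hg.hasDeriv_Icc hT hv hnN hk)
    ((hx 3 (by norm_num) _ ⟨le_rfl, le_max_of_le_left (le_add_of_nonneg_right
      (mul_nonneg hn.le (by linarith [M.one_le_cstar])))⟩).trans (le_max_left _ _))
    (fun x h => (hx 4 le_rfl x h).trans (le_max_right _ _))
    hn.le hX1
    (fun j => by
      have e1 := abs_colSum_le M.Aᵀ j
      rw [entrySum_transpose] at e1
      exact (e1.trans M.entrySum_le_coeffBound.1.1).trans hq0)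
    (fun j => by
      have e1 := abs_colSum_le (M.B (ratio h (n + 1)))ᵀ j
      rw [entrySum_transpose] at e1
      have e2 := hb (n + 1) (by omega) hnN
      linarith [le_abs_self b])
    (fun j => by
      have e1 := abs_colSum_le M.Kᵀ j
      rw [entrySum_transpose] at e1
      rw [abs_neg]
      exact (e1.trans M.entrySum_le_coeffBound.2.1).trans hq0)
    hM.c_nonneg (fun j => (hg.node_le hM.c_nonneg hlo hnN j).1) hM.c_nonneg
    hcX (fun j => (hg.node_le hM.c_nonneg hlo hnN j).2) hcX
    hend
    (fun j => by
      rw [hg.node_eq hnN]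
      exact le_max_of_le_right (hg.node_mem_cell hM.c_nonneg hnN j).2)
    hend
    (by
      refine Finset.sum_congr rfl fun j _ => ?_
      simp only [colSum, Matrix.transpose_apply]
      exact (hM.sum_B _ j).symm)
    (by
      have e := Finset.sum_congr (rfl : (Finset.univ : Finset (Fin 4)) = _)
        fun i _ => hM.adjoint_one (ratio h (n + 1)) hσ.ne' i
      simp only [Fin.sum_univ_four, colSum, Matrix.transpose_apply] at e ⊢
      linear_combination e)
    (by
      have e := Finset.sum_congr (rfl : (Finset.univ : Finset (Fin 4)) = _)
        fun i _ => hM.adjoint_two (ratio h (n + 1)) hσ.ne' i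
      simp only [Fin.sum_univ_four, colSum, Matrix.transpose_apply] at e ⊢
      linear_combination e)
    (by
      refine le_trans (le_of_eq ?_) (hsm n hnN)
      congr 1
      rw [← hM.adjoint_three (ratio h (n + 1))]
      simp only [Fin.sum_univ_four, colSum, Matrix.transpose_apply]
      ring)
  refine le_trans (le_of_eq ?_) (h1.trans ?_)
  · congr 1
    simp only [adjointDefect, if_neg hnN.ne, Pi.sub_apply, Pi.smul_apply, Pi.add_apply,
      Finset.sum_sub_distrib, Finset.sum_add_distrib, ← Finset.smul_sum, sum_stageMul,
      stepA_mid h1n hnN, stepK_mid h1n hnN]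
    simp only [colSum, exactStages, iteratedDerivWithin_zero, hg.node_eq hnN, neg_smul,
      Finset.sum_neg_distrib, smul_neg, sub_neg_eq_add]
  · have f3 : 0 ≤ 12 * q * X ^ 4 * κ * (h n ^ 4 * L) := by positivity
    have f4 : 0 ≤ h n ^ 4 * L := by positivity
    nlinarith

/-- The approximation of the end value has order three. -/
theorem endValue_sub_le (hM : M.OrderConditions Λ) :
    ∃ C > 0, ∀ {m N : ℕ} {lo hi T Tstar : ℝ} {h : ℕ → ℝ} {v : ℝ → Vec m}, 0 < Tstar →
      IsGrid M lo hi T Tstar N h → ContDiffOn ℝ 4 v (Icc 0 Tstar) →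
        ‖endValue M (exactStages M h v N) - v T‖ ≤
          C * (h N ^ 3 * localNorm M Tstar N h v 3 N) := by
  set X := 1 + (1 + |(0 : ℝ)|) * M.cstar with hX
  have hX1 : 1 ≤ X := IsGrid.one_le_nodeBound M 0
  have hcX : ∀ j, M.c j ≤ X := IsGrid.c_le 0
  have hcb := M.coeffBound_nonneg
  refine ⟨12 * (M.coeffBound + 1) * X ^ 3 + 1, by positivity, ?_⟩
  intro m N lo hi T Tstar h v hT hg hv
  have hL := localNorm_nonneg (M := M) (Tstar := Tstar) (N := N) (h := h) v 3 N
  have hhn := hg.pos N le_rfl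
  have hw : ∀ i, |M.w i| ≤ M.coeffBound + 1 := fun i => (abs_colSum_le M.AN i).trans
    (M.entrySum_le_coeffBound.1.2.2.trans (by linarith))
  have h1 := norm_functional_le_of_order_three (D := fun k => iteratedDerivWithin k v (Icc 0 Tstar))
    (a := gridPoint h N) (b := gridPoint h N + h N * M.cstar) (h := h N) (X := X)
    (q := M.coeffBound + 1) (M := localNorm M Tstar N h v 3 N)
    (α := M.w) (β := ![1, 0, 0, 0]) (κ := fun _ => 0)
    (x := M.c) (y := fun _ => 1) (z := fun _ => 0)
    (fun k hk => hg.hasDeriv_cell hT hv le_rfl (by omega))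
    (fun x hx => hg.norm_le_localNorm hT hv (by omega) le_rfl (by omega) (by omega) hx)
    hhn.le hX1 hw (abs_single_le (by rw [abs_one]; linarith))
    (fun j => by rw [abs_zero]; linarith)
    hM.c_nonneg (fun _ => zero_le_one) (fun _ => le_rfl) hcX (fun _ => hX1)
    (fun _ => by linarith)
    (fun j => (hg.node_mem_cell hM.c_nonneg le_rfl j).2)
    (fun j => by gcongr; exact M.one_le_cstar)
    (fun j => by
      rw [mul_zero, add_zero]
      exact le_add_of_nonneg_right (mul_nonneg hhn.le (by linarith [M.one_le_cstar])))
    (by have e := hM.w_pow 0 (by omega); simpa [Fin.sum_univ_four] using e)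
    (by have e := hM.w_pow 1 (by omega); simpa [Fin.sum_univ_four] using e)
    (by have e := hM.w_pow 2 (by omega); simpa [Fin.sum_univ_four] using e)
  refine le_trans (le_of_eq ?_) (h1.trans ?_)
  · simp only [endValue, exactStages, iteratedDerivWithin_zero, ← hg.sum_eq, gridPoint_succ]
    simp [Fin.sum_univ_four]
  · have h0 : 0 ≤ h N ^ 3 * localNorm M Tstar N h v 3 N := by positivity
    linarith

lemma stepK_mean (hM : M.OrderConditions Λ) (N n : ℕ) (j : Fin 4) :
    ∑ i, M.stepK N n i j * M.c i = colSum (M.stepK N n) j * M.c j := by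
  unfold stepK
  split_ifs
  · exact hM.start_mean j
  · exact hM.end_mean j
  · obtain ⟨k, hk⟩ := hM.diag_K
    simp only [hk, colSum, Finset.sum_mul]
    refine Finset.sum_congr rfl fun i _ => ?_
    by_cases h : i = j
    · rw [h]
    · simp [Matrix.diagonal_apply_ne _ h]

/-- Up to order two, `K_n^T` acts on the stages of a smooth function like the diagonal matrix of
its column sums. -/
theorem stageMul_stepK_sub_le (hM : M.OrderConditions Λ) :
    ∃ C > 0, ∀ {m N : ℕ} {lo hi T Tstar : ℝ} {h : ℕ → ℝ} {v : ℝ → Vec m}, 0 < Tstar →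
      IsGrid M lo hi T Tstar N h → ContDiffOn ℝ 4 v (Icc 0 Tstar) → ∀ n ≤ N, ∀ l ≤ 1, ∀ i,
        ‖stageMul (M.stepK N n)ᵀ (exactStages M h (iteratedDerivWithin l v (Icc 0 Tstar)) n) i -
          colSum (M.stepK N n) i • exactStages M h (iteratedDerivWithin l v (Icc 0 Tstar)) n i‖ ≤
          C * (h n ^ 2 * localNorm M Tstar N h v (l + 2) n) := by
  set X := 1 + (1 + |(0 : ℝ)|) * M.cstar with hX
  have hX1 : 1 ≤ X := IsGrid.one_le_nodeBound M 0
  have hcX : ∀ j, M.c j ≤ X := IsGrid.c_le 0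
  have hcb := M.coeffBound_nonneg
  refine ⟨12 * M.coeffBound * X ^ 2 + 1, by positivity, ?_⟩
  intro m N lo hi T Tstar h v hT hg hv n hn l hl i
  have hL := localNorm_nonneg (M := M) (Tstar := Tstar) (N := N) (h := h) v (l + 2) n
  have hhn := hg.pos n hn
  have hK : ∀ i j, |M.stepK N n i j| ≤ M.coeffBound := fun i j =>
    (abs_le_entrySum _ i j).trans (M.entrySum_stepK_le N n)
  have h1 := functional_sub_taylor_le (K := 2) (by norm_num)
    (D := fun k => iteratedDerivWithin (l + k) v (Icc 0 Tstar))
    (a := gridPoint h n) (b := gridPoint h n + h n * M.cstar) (h := h n) (X := X)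
    (q := M.coeffBound) (M := localNorm M Tstar N h v (l + 2) n)
    (α := fun j => M.stepK N n j i) (β := ![colSum (M.stepK N n) i, 0, 0, 0]) (κ := fun _ => 0)
    (x := M.c) (y := fun _ => M.c i) (z := fun _ => 0)
    (fun k hk => hg.hasDeriv_cell hT hv hn (by omega))
    (fun x hx => hg.norm_le_localNorm hT hv (by omega) hn (by omega) (by omega) hx)
    hhn.le hX1 (fun j => hK j i)
    (abs_single_le ((abs_colSum_le _ i).trans (M.entrySum_stepK_le N n)))
    (fun j => by rw [abs_zero]; exact hcb)
    hM.c_nonneg (fun _ => hM.c_nonneg i) (fun _ => le_rfl) hcX (fun _ => hcX i)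
    (fun _ => by linarith)
    (fun j => (hg.node_mem_cell hM.c_nonneg hn j).2)
    (fun j => (hg.node_mem_cell hM.c_nonneg hn i).2)
    (fun j => by
      rw [mul_zero, add_zero]
      exact le_add_of_nonneg_right (mul_nonneg hhn.le (by linarith [M.one_le_cstar])))
  rw [Finset.sum_eq_zero (s := Finset.range 2), sub_zero] at h1
  · refine le_trans (le_of_eq ?_) (h1.trans ?_)
    · simp only [stageMul, exactStages, Matrix.transpose_apply]
      simp [Fin.sum_univ_four]
    · have h0 : 0 ≤ h n ^ 2 * localNorm M Tstar N h v (l + 2) n := by positivity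
      linarith
  · intro k hk
    have e1 := hM.stepK_mean N n i
    have : k = 0 ∨ k = 1 := by simp only [Finset.mem_range] at hk; omega
    rcases this with rfl | rfl
    · simp [Fin.sum_univ_four, colSum]
    · simp [Fin.sum_univ_four, colSum] at e1 ⊢
      simp [e1]

/-- For diagonal matrices the column sums are the diagonal entries. -/
lemma stageMul_transpose_of_diagonal {X : Matrix (Fin 4) (Fin 4) ℝ}
    (hX : ∃ k, X = Matrix.diagonal k) (Y : Fin 4 → Vec m) (i : Fin 4) :
    stageMul Xᵀ Y i = colSum X i • Y i := by
  obtain ⟨k, rfl⟩ := hX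
  simp [stageMul, colSum, Matrix.diagonal_apply]

end PeerTriplet.OrderConditions
/-! ### Lipschitz estimates for the right-hand sides -/

/-- The mean value theorem in each variable on a product of balls. -/
lemma norm_sub_le_of_partial {F : Vec m → Vec m → Vec m} {a b : Vec m} {ρ c₁ c₂ : ℝ}
    (hd : ∀ x z, ‖x - a‖ < ρ → ‖z - b‖ < ρ →
      DifferentiableAt ℝ (fun w : Vec m × Vec m => F w.1 w.2) (x, z))
    (h₁ : ∀ x z, ‖x - a‖ < ρ → ‖z - b‖ < ρ → ‖fderiv ℝ (fun w => F w z) x‖ ≤ c₁)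
    (h₂ : ∀ x z, ‖x - a‖ < ρ → ‖z - b‖ < ρ → ‖fderiv ℝ (fun w => F x w) z‖ ≤ c₂)
    {x z x' z' : Vec m} (hx : ‖x - a‖ < ρ) (hz : ‖z - b‖ < ρ) (hx' : ‖x' - a‖ < ρ)
    (hz' : ‖z' - b‖ < ρ) : ‖F x z - F x' z'‖ ≤ c₁ * ‖x - x'‖ + c₂ * ‖z - z'‖ := by
  have e1 : ‖F x z - F x' z‖ ≤ c₁ * ‖x - x'‖ := by
    refine (convex_ball a ρ).norm_image_sub_le_of_norm_fderiv_le (𝕜 := ℝ) (f := fun w => F w z)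
      (fun w hw => ?_) (fun w hw => h₁ w z (mem_ball_iff_norm.1 hw) hz)
      (mem_ball_iff_norm.2 hx') (mem_ball_iff_norm.2 hx)
    exact DifferentiableAt.comp (f := fun w => (w, z)) w (hd w z (mem_ball_iff_norm.1 hw) hz)
      (by fun_prop)
  have e2 : ‖F x' z - F x' z'‖ ≤ c₂ * ‖z - z'‖ := by
    refine (convex_ball b ρ).norm_image_sub_le_of_norm_fderiv_le (𝕜 := ℝ) (f := fun w => F x' w)
      (fun w hw => ?_) (fun w hw => h₂ x' w hx' (mem_ball_iff_norm.1 hw))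
      (mem_ball_iff_norm.2 hz') (mem_ball_iff_norm.2 hz)
    exact DifferentiableAt.comp (f := fun w => (x', w)) w (hd x' w hx' (mem_ball_iff_norm.1 hw))
      (by fun_prop)
  calc ‖F x z - F x' z'‖ = ‖(F x z - F x' z) + (F x' z - F x' z')‖ := by abel_nf
    _ ≤ _ := (norm_add_le _ _).trans (add_le_add e1 e2)

/-- `φ(y, p)` is homogeneous in `p` for the admissible scaling factors. -/
lemma ControlProblem.phi_smul {Q : ControlProblem m d} {u : Vec m → Vec m → Vec d} {Λ : Set ℝ}
    {D : Set (Vec m × Vec m)} (hu : IsControlLaw Q u Λ D) {z : Vec m × Vec m} (hz : z ∈ D) {r : ℝ}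
    (hr : r ∈ Λ) : Q.phi u z.1 (r • z.2) = r • Q.phi u z.1 z.2 := by
  unfold ControlProblem.phi
  rw [hu.scaling z hz r hr, map_smul, smul_neg]

/-- The gradient of a quadratic polynomial is Lipschitz continuous with the bound of the Hessian. -/
lemma IsQuadratic.norm_gradient_sub_le {C : Vec m → ℝ} (hC : IsQuadratic C) {Γ : ℝ}
    (hΓ : ∀ x, ‖fderiv ℝ (gradient C) x‖ ≤ Γ) (x z : Vec m) :
    ‖gradient C x - gradient C z‖ ≤ Γ * ‖x - z‖ := by
  obtain ⟨c₀, b, S, hS, hC⟩ := hC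
  have hgrad : gradient C = fun x => b + S x := by
    funext x
    refine HasGradientAt.gradient ?_
    rw [hasGradientAt_iff_hasFDerivAt]
    have hsym : ∀ a c, ⟪S a, c⟫ = ⟪a, S c⟫ := fun a c => by
      have h := (ContinuousLinearMap.isSelfAdjoint_iff_isSymmetric.1 hS) a c
      simpa using h
    have h1 := ((hasFDerivAt_const c₀ x).add ((hasFDerivAt_const b x).inner ℝ
      (hasFDerivAt_id (𝕜 := ℝ) x))).add
        (((S.hasFDerivAt (x := x)).inner ℝ (hasFDerivAt_id (𝕜 := ℝ) x)).const_mul (1 / 2))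
    refine (h1.congr_of_eventuallyEq (Filter.Eventually.of_forall fun z => hC z)).congr_fderiv ?_
    ext v
    simp [fderivInnerCLM_apply, hsym]
    have h2 : ⟪v, S x⟫ = ⟪x, S v⟫ := (real_inner_comm _ _).trans (hsym x v)
    rw [h2]
    ring
  have hd : Differentiable ℝ (gradient C) := by
    rw [hgrad]
    exact (differentiable_const b).add S.differentiable
  exact convex_univ.norm_image_sub_le_of_norm_fderiv_le (𝕜 := ℝ) (fun w _ => hd w)
    (fun w _ => hΓ w) (mem_univ z) (mem_univ x)

namespace IsRegularSolution

variable {Q : ControlProblem m d} {u : Vec m → Vec m → Vec d} {Λ : Set ℝ} {L : Bounds}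
  {T Tstar : ℝ} {y p : ℝ → Vec m}

lemma Tstar_pos (hr : IsRegularSolution Q u Λ L T Tstar y p) : 0 < Tstar := hr.T_pos.trans_le hr.T_le

lemma bounds_nonneg (hr : IsRegularSolution Q u Λ L T Tstar y p) :
    0 ≤ L.dyG ∧ 0 ≤ L.dpG ∧ 0 ≤ L.dyPhi ∧ 0 ≤ L.dpPhi ∧ 0 ≤ L.hessC := by
  obtain ⟨ρ, hρ, -, hb⟩ := hr.tubular
  have hz : (y 0, p 0) ∈ tube Tstar y p ρ :=
    ⟨0, ⟨le_rfl, hr.Tstar_pos.le⟩, by simpa using hρ, by simpa using hρ⟩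
  exact ⟨(norm_nonneg _).trans (hb.dyG_le _ hz), (norm_nonneg _).trans (hb.dpG_le _ hz),
    (norm_nonneg _).trans (hb.dyPhi_le _ hz), (norm_nonneg _).trans (hb.dpPhi_le _ hz),
    (norm_nonneg _).trans (hr.hessC_le 0)⟩

lemma iteratedDeriv_y (hr : IsRegularSolution Q u Λ L T Tstar y p) {t : ℝ}
    (ht : t ∈ Icc 0 Tstar) :
    iteratedDerivWithin 1 y (Icc 0 Tstar) t = Q.g u (y t) (p t) := by
  rw [iteratedDerivWithin_one]
  exact (hr.deriv_y t ht).derivWithin (uniqueDiffOn_Icc hr.Tstar_pos t ht)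

lemma iteratedDeriv_p (hr : IsRegularSolution Q u Λ L T Tstar y p) {t : ℝ}
    (ht : t ∈ Icc 0 Tstar) :
    iteratedDerivWithin 1 p (Icc 0 Tstar) t = Q.phi u (y t) (p t) := by
  rw [iteratedDerivWithin_one]
  exact (hr.deriv_p t ht).derivWithin (uniqueDiffOn_Icc hr.Tstar_pos t ht)

end IsRegularSolution

namespace HasDerivBounds

variable {Q : ControlProblem m d} {u : Vec m → Vec m → Vec d} {L : Bounds} {Tstar ρ t : ℝ}
  {y p : ℝ → Vec m} {x z x' z' : Vec m}

lemma norm_g_sub_le (hb : HasDerivBounds Q u L (tube Tstar y p ρ)) (ht : t ∈ Icc 0 Tstar)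
    (hx : ‖x - y t‖ < ρ) (hz : ‖z - p t‖ < ρ) (hx' : ‖x' - y t‖ < ρ) (hz' : ‖z' - p t‖ < ρ) :
    ‖Q.g u x z - Q.g u x' z'‖ ≤ L.dyG * ‖x - x'‖ + L.dpG * ‖z - z'‖ :=
  norm_sub_le_of_partial (F := Q.g u) (a := y t) (b := p t) (ρ := ρ)
    (fun a b ha hb' => hb.diff_g (a, b) ⟨t, ht, ha, hb'⟩)
    (fun a b ha hb' => hb.dyG_le (a, b) ⟨t, ht, ha, hb'⟩)
    (fun a b ha hb' => hb.dpG_le (a, b) ⟨t, ht, ha, hb'⟩) hx hz hx' hz'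

lemma norm_phi_sub_le (hb : HasDerivBounds Q u L (tube Tstar y p ρ)) (ht : t ∈ Icc 0 Tstar)
    (hx : ‖x - y t‖ < ρ) (hz : ‖z - p t‖ < ρ) (hx' : ‖x' - y t‖ < ρ) (hz' : ‖z' - p t‖ < ρ) :
    ‖Q.phi u x z - Q.phi u x' z'‖ ≤ L.dyPhi * ‖x - x'‖ + L.dpPhi * ‖z - z'‖ :=
  norm_sub_le_of_partial (F := Q.phi u) (a := y t) (b := p t) (ρ := ρ)
    (fun a b ha hb' => hb.diff_phi (a, b) ⟨t, ht, ha, hb'⟩)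
    (fun a b ha hb' => hb.dyPhi_le (a, b) ⟨t, ht, ha, hb'⟩)
    (fun a b ha hb' => hb.dpPhi_le (a, b) ⟨t, ht, ha, hb'⟩) hx hz hx' hz'

/-- The Lipschitz estimate for `φ` at a stage value `X` that is close to `k p(t)`. -/
lemma norm_phi_scaled_sub_le {Λ : Set ℝ} (hu : IsControlLaw Q u Λ (tube Tstar y p ρ))
    (hb : HasDerivBounds Q u L (tube Tstar y p ρ)) (ht : t ∈ Icc 0 Tstar) {k : ℝ} (hk : k ∈ Λ)
    (hk0 : k ≠ 0) (hx : ‖x - y t‖ < ρ) (hz : ‖k⁻¹ • z - p t‖ < ρ) (hx' : ‖x' - y t‖ < ρ)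
    (hz' : ‖k⁻¹ • z' - p t‖ < ρ) :
    ‖Q.phi u x z - Q.phi u x' z'‖ ≤ |k| * L.dyPhi * ‖x - x'‖ + L.dpPhi * ‖z - z'‖ := by
  have e1 : Q.phi u x z = k • Q.phi u x (k⁻¹ • z) := by
    rw [← ControlProblem.phi_smul hu (z := (x, k⁻¹ • z)) ⟨t, ht, hx, hz⟩ hk, smul_inv_smul₀ hk0]
  have e2 : Q.phi u x' z' = k • Q.phi u x' (k⁻¹ • z') := by
    rw [← ControlProblem.phi_smul hu (z := (x', k⁻¹ • z')) ⟨t, ht, hx', hz'⟩ hk,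
      smul_inv_smul₀ hk0]
  rw [e1, e2, ← smul_sub, norm_smul, Real.norm_eq_abs]
  refine (mul_le_mul_of_nonneg_left (hb.norm_phi_sub_le ht hx hz hx' hz')
    (abs_nonneg k)).trans (le_of_eq ?_)
  rw [← smul_sub, norm_smul, norm_inv, Real.norm_eq_abs]
  have : |k| ≠ 0 := abs_ne_zero.2 hk0
  field_simp

end HasDerivBounds

/-! ### The fixed point iteration -/

/-- `(Y', P')` results from `(Y, P)` by one step of the fixed point iteration for the discrete
boundary value problem, up to defects `r` and `s`: the functions `g` and `φ` are evaluated at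
`(Y, P)`, then the linear recursions are solved, the forward one first. -/
structure IsIterate (M : PeerTriplet) (Q : ControlProblem m d) (u : Vec m → Vec m → Vec d) (N : ℕ)
    (h : ℕ → ℝ) (Y P Y' P' r s : ℕ → Fin 4 → Vec m) : Prop where
  start : stageMul M.A0 (Y' 0) = (fun i => M.a i • Q.y0) +
    h 0 • stageMul M.K0 (fun j => Q.g u (Y 0 j) (P 0 j)) + r 0
  forward : ∀ n, 1 ≤ n → n ≤ N → stageMul (M.stepA N n) (Y' n) =
    stageMul (M.B (ratio h n)) (Y' (n - 1)) +
      h n • stageMul (M.stepK N n) (fun j => Q.g u (Y n j) (P n j)) + r n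
  adjoint : ∀ n < N, stageMul (M.stepA N n)ᵀ (P' n) =
    stageMul (M.B (ratio h (n + 1)))ᵀ (P' (n + 1)) -
      h n • (fun i => Q.phi u (Y n i) (stageMul (M.stepK N n)ᵀ (P n) i)) + s n
  final : stageMul M.ANᵀ (P' N) = (fun i => M.w i • gradient Q.C (endValue M (Y' N))) -
    h N • (fun i => Q.phi u (Y N i) (stageMul (M.stepK N N)ᵀ (P N) i)) + s N

lemma isDiscreteSolution_iff_isIterate {M : PeerTriplet} {Q : ControlProblem m d}
    {u : Vec m → Vec m → Vec d} {N : ℕ} (hN : 1 ≤ N) {h : ℕ → ℝ} {Y P : ℕ → Fin 4 → Vec m} :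
    IsDiscreteSolution M Q u N h Y P ↔ IsIterate M Q u N h Y P Y P 0 0 := by
  constructor
  · intro H
    refine ⟨?_, fun n h1 h2 => ?_, fun n hn => ?_, ?_⟩
    · funext i; simpa using H.start i
    · funext i; simpa using H.forward n h1 h2 i
    · funext i; simpa using H.adjoint n hn i
    · funext i; simpa [PeerTriplet.stepK_last hN] using H.final i
  · intro H
    refine ⟨fun i => ?_, fun n h1 h2 i => ?_, fun n hn i => ?_, fun i => ?_⟩
    · simpa using congrFun H.start i
    · simpa using congrFun (H.forward n h1 h2) i
    · simpa using congrFun (H.adjoint n hn) i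
    · simpa [PeerTriplet.stepK_last hN] using congrFun H.final i

/-- The stages `Y_n`, `P_n` and the scaled stages `K_n^T P_n` lie in the tube of radius `ρ`. -/
def IsNear (M : PeerTriplet) (N : ℕ) (h : ℕ → ℝ) (y p : ℝ → Vec m) (ρ : ℝ)
    (Y P : ℕ → Fin 4 → Vec m) : Prop :=
  ∀ n ≤ N, ∀ i, ‖Y n i - exactStages M h y n i‖ < ρ ∧ ‖P n i - exactStages M h p n i‖ < ρ ∧
    ‖(colSum (M.stepK N n) i)⁻¹ • stageMul (M.stepK N n)ᵀ (P n) i - exactStages M h p n i‖ < ρ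

namespace PeerTriplet.OrderConditions

variable {M : PeerTriplet} {Λ : Set ℝ}

lemma colSum_stepK (hM : M.OrderConditions Λ) (N n : ℕ) (i : Fin 4) :
    colSum (M.stepK N n) i ∈ Λ ∧ colSum (M.stepK N n) i ≠ 0 := by
  have h1 := hM.colSum_mem i
  have h2 := hM.colSum_ne i
  unfold stepK
  split_ifs
  exacts [⟨h1.2.1, h2.2.1⟩, ⟨h1.2.2, h2.2.2⟩, ⟨h1.1, h2.1⟩]

/-- One step of the fixed point iteration halves distances, up to the defects. The factor that
multiplies the Lipschitz constants is made small by `ζ`; the coupling through the objective function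
only enters in composition with the forward step, so that a bound for its Hessian is enough. -/
theorem iterate_sub_le (hM : M.OrderConditions Λ) {S : Set ℝ} (hS : M.IsDamped S) :
    ∃ ζ > 0, ∃ C > 0, ∀ {m d N : ℕ} {Q : ControlProblem m d} {u : Vec m → Vec m → Vec d}
      {L : Bounds} {lo hi T Tstar ρ : ℝ} {y p : ℝ → Vec m} {h : ℕ → ℝ}
      {Y P Y' P' Z R Z' R' r s : ℕ → Fin 4 → Vec m} {e δ : ℝ},
      IsRegularSolution Q u Λ L T Tstar y p → IsControlLaw Q u Λ (tube Tstar y p ρ) →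
      HasDerivBounds Q u L (tube Tstar y p ρ) → Contractive ⟨ζ, ζ, ζ, ζ⟩ L T →
      IsGrid M lo hi T Tstar N h → (∀ n, 1 ≤ n → n ≤ N → ratio h n ∈ S) →
      IsNear M N h y p ρ Y P → IsNear M N h y p ρ Z R →
      IsIterate M Q u N h Y P Y' P' 0 0 → IsIterate M Q u N h Z R Z' R' r s →
      (∀ n ≤ N, ‖Y n - Z n‖ ≤ e ∧ ‖P n - R n‖ ≤ e) →
      (∀ n ≤ N, ‖r n‖ ≤ δ ∧ ‖s n‖ ≤ δ) →
      ∑ n ∈ Finset.Icc 1 (N - 1), ‖∑ i, r n i‖ ≤ δ →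
      ∑ n ∈ Finset.Icc 1 (N - 1), ‖∑ i, s n i‖ ≤ δ →
      ∀ n ≤ N, ‖Y' n - Z' n‖ ≤ e / 2 + C * δ ∧ ‖P' n - R' n‖ ≤ e / 2 + C * δ := by
  obtain ⟨Cf, hCf, hfs⟩ := hM.forward_stability hS
  obtain ⟨Ca, hCa, has⟩ := hM.adjoint_stability hS
  set c := M.coeffBound with hc
  have hc0 : 0 ≤ c := M.coeffBound_nonneg
  refine ⟨5 * c * Cf + 5 * c * Ca + 5 * c ^ 3 * Ca * Cf + 1, by positivity,
    2 * Cf + 2 * Ca + Ca * c ^ 2 * Cf, by positivity, ?_⟩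
  intro m d N Q u L lo hi T Tstar ρ y p h Y P Y' P' Z R Z' R' r s e δ hr hu hb hcon hg hσ hY hZ
    hIY hIZ he hδ hrs hss
  set ζ := 5 * c * Cf + 5 * c * Ca + 5 * c ^ 3 * Ca * Cf + 1 with hζ
  obtain ⟨l1, l2, l3, l4, l5⟩ := hr.bounds_nonneg
  have hT := hr.T_pos
  have he0 : 0 ≤ e := (norm_nonneg _).trans (he 0 (by omega)).1
  have hδ0 : 0 ≤ δ := (norm_nonneg _).trans (hδ 0 (by omega)).1
  have hN := hg.one_le
  set W := (L.dyG + L.dpG) * T with hW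
  set W' := (L.dyPhi + L.dpPhi) * T with hW'
  have hW0 : 0 ≤ W := by positivity
  have hW'0 : 0 ≤ W' := by positivity
  have hζ0 : 0 < ζ := by positivity
  have hζW : ζ * W ≤ 1 / 2 := by
    have := hcon.1
    simp only at this
    rw [hW]
    linarith
  have hcon2 : ζ * W' + 2 * L.hessC ≤ 1 / 2 := by
    have := hcon.2
    simp only at this
    rw [hW']
    linarith
  have hζW' : ζ * W' ≤ 1 / 2 := by linarith
  have hΓ : L.hessC ≤ 1 / 4 := by nlinarith [mul_nonneg hζ0.le hW'0]
  have hG : ∀ n ≤ N, ‖(fun j => Q.g u (Y n j) (P n j)) - fun j => Q.g u (Z n j) (R n j)‖ ≤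
      (L.dyG + L.dpG) * e := by
    intro n hn
    refine (pi_norm_le_iff_of_nonneg (by positivity)).2 fun j => ?_
    obtain ⟨a1, a2, -⟩ := hY n hn j
    obtain ⟨b1, b2, -⟩ := hZ n hn j
    refine (hb.norm_g_sub_le (hg.node_mem hM.c_nonneg hn j) a1 a2 b1 b2).trans ?_
    have e1 := (norm_le_pi_norm (Y n - Z n) j).trans (he n hn).1
    have e2 := (norm_le_pi_norm (P n - R n) j).trans (he n hn).2
    rw [Pi.sub_apply] at e1 e2
    nlinarith
  have hΦ : ∀ n ≤ N, ‖(fun i => Q.phi u (Y n i) (stageMul (M.stepK N n)ᵀ (P n) i)) -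
      fun i => Q.phi u (Z n i) (stageMul (M.stepK N n)ᵀ (R n) i)‖ ≤
        c * ((L.dyPhi + L.dpPhi) * e) := by
    intro n hn
    refine (pi_norm_le_iff_of_nonneg (by positivity)).2 fun j => ?_
    obtain ⟨a1, -, a3⟩ := hY n hn j
    obtain ⟨b1, -, b3⟩ := hZ n hn j
    obtain ⟨k1, k2⟩ := hM.colSum_stepK N n j
    refine (hb.norm_phi_scaled_sub_le hu (hg.node_mem hM.c_nonneg hn j) k1 k2 a1 a3 b1
      b3).trans ?_
    have e1 := (norm_le_pi_norm (Y n - Z n) j).trans (he n hn).1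
    have e3 : ‖stageMul (M.stepK N n)ᵀ (P n) j - stageMul (M.stepK N n)ᵀ (R n) j‖ ≤ c * e := by
      have e4 := norm_le_pi_norm (stageMul (M.stepK N n)ᵀ (P n - R n)) j
      rw [stageMul_sub, Pi.sub_apply] at e4
      refine e4.trans ?_
      rw [← stageMul_sub]
      refine (norm_stageMul_le _ _).trans ?_
      rw [entrySum_transpose]
      exact mul_le_mul (M.entrySum_stepK_le N n) (he n hn).2 (norm_nonneg _) hc0
    have e5 : |colSum (M.stepK N n) j| ≤ c := (abs_colSum_le _ _).trans (M.entrySum_stepK_le N n)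
    rw [Pi.sub_apply] at e1
    have f1 : |colSum (M.stepK N n) j| * L.dyPhi * ‖Y n j - Z n j‖ ≤ c * L.dyPhi * e :=
      mul_le_mul (mul_le_mul_of_nonneg_right e5 l3) e1 (norm_nonneg _) (by positivity)
    have f2 := mul_le_mul_of_nonneg_left e3 l4
    linarith
  -- `Y' - Z'` solves the forward recursion with the inhomogeneities `f`; `c` bounds the factors `K_n`
  set f : ℕ → Fin 4 → Vec m := fun n => h n • stageMul (M.stepK N n)
    ((fun j => Q.g u (Y n j) (P n j)) - fun j => Q.g u (Z n j) (R n j)) - r n with hf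
  have hfK : ∀ n ≤ N, ‖h n • stageMul (M.stepK N n)
      ((fun j => Q.g u (Y n j) (P n j)) - fun j => Q.g u (Z n j) (R n j))‖ ≤
        h n * (c * ((L.dyG + L.dpG) * e)) := by
    intro n hn
    have hn0 := (hg.pos n hn).le
    rw [norm_smul, Real.norm_eq_abs, abs_of_nonneg hn0]
    refine mul_le_mul_of_nonneg_left ((norm_stageMul_le _ _).trans ?_) hn0
    exact mul_le_mul (M.entrySum_stepK_le N n) (hG n hn) (norm_nonneg _) hc0
  have hIcc : ∀ n ∈ Finset.Icc 1 (N - 1), n ≤ N := fun n hn => by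
    rw [Finset.mem_Icc] at hn; omega
  have hfwd := hfs (Z := fun n => Y' n - Z' n) (r := f) (R := c * W * e + δ)
    (Q := 4 * (c * W * e) + δ) hN hσ
    (by
      rw [stageMul_sub, hIY.start, hIZ.start, hf]
      simp only [stepK_zero, stageMul_sub, smul_sub, Pi.zero_apply]
      abel)
    (fun n h1 h2 => by
      rw [stageMul_sub, stageMul_sub, hIY.forward n h1 h2, hIZ.forward n h1 h2, hf]
      simp only [stageMul_sub, smul_sub, Pi.zero_apply]
      abel)
    (fun n hn => by
      refine (norm_sub_le _ _).trans (add_le_add ((hfK n hn).trans ?_) (hδ n hn).1)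
      have := mul_le_mul_of_nonneg_right (hg.step_le hn)
        (by positivity : 0 ≤ c * ((L.dyG + L.dpG) * e))
      refine this.trans (le_of_eq ?_)
      rw [hW]; ring)
    (by
      have h1 : ∀ n ∈ Finset.Icc 1 (N - 1), ‖∑ i, f n i‖ ≤
          h n * (4 * (c * ((L.dyG + L.dpG) * e))) + ‖∑ i, r n i‖ := by
        intro n hn
        simp only [hf, Pi.sub_apply, Finset.sum_sub_distrib]
        refine (norm_sub_le _ _).trans (add_le_add_left ?_ _)
        exact (norm_sum_stages_le _).trans (by linarith [hfK n (hIcc n hn)])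
      refine (Finset.sum_le_sum h1).trans ?_
      rw [Finset.sum_add_distrib, ← Finset.sum_mul]
      refine add_le_add ?_ hrs
      have := mul_le_mul_of_nonneg_right (hg.sum_step_le hIcc)
        (by positivity : 0 ≤ 4 * (c * ((L.dyG + L.dpG) * e)))
      refine this.trans (le_of_eq ?_)
      rw [hW]; ring)
  have hE : ∀ n ≤ N, ‖Y' n - Z' n‖ ≤ Cf * (5 * (c * W * e) + 2 * δ) := fun n hn =>
    (hfwd n hn).trans (le_of_eq (by ring))
  -- `P' - R'` solves the adjoint recursion with `t`, where the end value enters through the Hessian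
  set t : ℕ → Fin 4 → Vec m := fun n => (if n = N then
      (fun i => M.w i • (gradient Q.C (endValue M (Y' N)) - gradient Q.C (endValue M (Z' N))))
      else 0) - h n • ((fun i => Q.phi u (Y n i) (stageMul (M.stepK N n)ᵀ (P n) i)) -
      fun i => Q.phi u (Z n i) (stageMul (M.stepK N n)ᵀ (R n) i)) - s n with ht
  have htK : ∀ n ≤ N, ‖h n • ((fun i => Q.phi u (Y n i) (stageMul (M.stepK N n)ᵀ (P n) i)) -
      fun i => Q.phi u (Z n i) (stageMul (M.stepK N n)ᵀ (R n) i))‖ ≤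
        h n * (c * ((L.dyPhi + L.dpPhi) * e)) := by
    intro n hn
    have hn0 := (hg.pos n hn).le
    rw [norm_smul, Real.norm_eq_abs, abs_of_nonneg hn0]
    exact mul_le_mul_of_nonneg_left (hΦ n hn) hn0
  set E := Cf * (5 * (c * W * e) + 2 * δ) with hEdef
  have hE0 : 0 ≤ E := by positivity
  have hw : ∀ n ≤ N, ‖(if n = N then
      (fun i => M.w i • (gradient Q.C (endValue M (Y' N)) - gradient Q.C (endValue M (Z' N))))
      else (0 : Fin 4 → Vec m))‖ ≤ c * (1 / 4 * (c * E)) := by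
    intro n hn
    split_ifs with h1
    · refine (pi_norm_le_iff_of_nonneg (by positivity)).2 fun i => ?_
      rw [norm_smul, Real.norm_eq_abs]
      refine mul_le_mul ((abs_colSum_le M.AN i).trans M.entrySum_le_coeffBound.1.2.2) ?_
        (norm_nonneg _) hc0
      refine (hr.quadratic.norm_gradient_sub_le hr.hessC_le _ _).trans ?_
      refine mul_le_mul hΓ ?_ (norm_nonneg _) (by norm_num)
      have h2 : endValue M (Y' N) - endValue M (Z' N) = ∑ j, M.w j • (Y' N - Z' N) j := by
        simp [endValue, smul_sub, Finset.sum_sub_distrib]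
      rw [h2]
      refine (norm_sum_smul_le _ _).trans (mul_le_mul ?_ (hE N le_rfl) (norm_nonneg _) hc0)
      refine le_trans ?_ M.entrySum_le_coeffBound.1.2.2
      rw [← entrySum_transpose]
      exact Finset.sum_le_sum fun j _ => Finset.abs_sum_le_sum_abs _ _
    · rw [norm_zero]; positivity
  have hadj := has (Z := fun n => P' n - R' n) (r := t) (σ := ratio h)
    (R := c * (1 / 4 * (c * E)) + c * W' * e + δ) (Q := 4 * (c * W' * e) + δ) hN hσ
    (by
      rw [stageMul_sub, hIY.final, hIZ.final, ht]
      funext i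
      simp only [if_true, smul_sub, Pi.zero_apply, Pi.add_apply, Pi.sub_apply]
      abel)
    (fun n h1 => by
      rw [stageMul_sub, stageMul_sub, hIY.adjoint n h1, hIZ.adjoint n h1, ht]
      simp only [if_neg h1.ne, smul_sub, Pi.zero_apply]
      abel)
    (fun n hn => by
      refine (norm_sub_le _ _).trans (add_le_add ((norm_sub_le _ _).trans (add_le_add (hw n hn)
        ((htK n hn).trans ?_))) (hδ n hn).2)
      have := mul_le_mul_of_nonneg_right (hg.step_le hn)
        (by positivity : 0 ≤ c * ((L.dyPhi + L.dpPhi) * e))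
      refine this.trans (le_of_eq ?_)
      rw [hW']; ring)
    (by
      have h1 : ∀ n ∈ Finset.Icc 1 (N - 1), ‖∑ i, t n i‖ ≤
          h n * (4 * (c * ((L.dyPhi + L.dpPhi) * e))) + ‖∑ i, s n i‖ := by
        intro n hn
        have hnN : n ≠ N := by rw [Finset.mem_Icc] at hn; omega
        simp only [ht, if_neg hnN, zero_sub]
        simp only [Pi.sub_apply, Finset.sum_sub_distrib]
        refine (norm_sub_le _ _).trans (add_le_add_left ?_ _)
        refine (norm_sum_stages_le _).trans ?_
        rw [norm_neg]
        linarith [htK n (hIcc n hn)]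
      refine (Finset.sum_le_sum h1).trans ?_
      rw [Finset.sum_add_distrib, ← Finset.sum_mul]
      refine add_le_add ?_ hss
      have := mul_le_mul_of_nonneg_right (hg.sum_step_le hIcc)
        (by positivity : 0 ≤ 4 * (c * ((L.dyPhi + L.dpPhi) * e)))
      refine this.trans (le_of_eq ?_)
      rw [hW']; ring)
  -- each product of a stability constant and `W` or `W'` is part of `ζ W` or `ζ W'`
  have g1 : 5 * c * Cf * W ≤ 1 / 2 := by
    refine le_trans (mul_le_mul_of_nonneg_right ?_ hW0) hζW
    have : 0 ≤ 5 * c * Ca + 5 * c ^ 3 * Ca * Cf := by positivity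
    linarith
  have g2 : 5 * c * Ca * W' + 5 * c ^ 3 * Ca * Cf * W ≤ 1 := by
    have e1 : 5 * c * Ca * W' ≤ ζ * W' := by
      refine mul_le_mul_of_nonneg_right ?_ hW'0
      have : 0 ≤ 5 * c * Cf + 5 * c ^ 3 * Ca * Cf := by positivity
      linarith
    have e2 : 5 * c ^ 3 * Ca * Cf * W ≤ ζ * W := by
      refine mul_le_mul_of_nonneg_right ?_ hW0
      have : 0 ≤ 5 * c * Cf + 5 * c * Ca := by positivity
      linarith
    linarith
  have g3 : 5 * c * Ca * W' + 5 * c ^ 3 * Ca * Cf * W / 4 ≤ 1 / 2 := by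
    have e1 : (5 * c * Ca + 5 * c ^ 3 * Ca * Cf / 4) * (1 / 2) ≤ ζ * (1 / 2) := by
      have : 0 ≤ 5 * c * Cf := by positivity
      have : 0 ≤ 5 * c ^ 3 * Ca * Cf := by positivity
      linarith
    have e2 : W' ≤ 1 / (2 * ζ) := by rw [le_div_iff₀ (by positivity)]; linarith
    have e3 : W ≤ 1 / (2 * ζ) := by rw [le_div_iff₀ (by positivity)]; linarith
    calc 5 * c * Ca * W' + 5 * c ^ 3 * Ca * Cf * W / 4
        ≤ 5 * c * Ca * (1 / (2 * ζ)) + 5 * c ^ 3 * Ca * Cf * (1 / (2 * ζ)) / 4 := by gcongr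
      _ = (5 * c * Ca + 5 * c ^ 3 * Ca * Cf / 4) * (1 / 2) / ζ := by field_simp
      _ ≤ 1 / 2 := by rw [div_le_iff₀ hζ0]; linarith
  intro n hn
  constructor
  · refine (hE n hn).trans ?_
    have := mul_le_mul_of_nonneg_right g1 he0
    have h2 : 0 ≤ (2 * Ca + Ca * c ^ 2 * Cf) * δ := by positivity
    rw [hEdef]
    linarith
  · refine (hadj n hn).trans ?_
    have h1 := mul_le_mul_of_nonneg_right g3 he0
    have h2 : 0 ≤ 2 * Cf * δ := by positivity
    have h3 : 0 ≤ Ca * c ^ 2 * Cf * δ := by positivity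
    rw [hEdef]
    linarith

end PeerTriplet.OrderConditions
/-- The defect of the exact solution in the adjoint steps. Besides the local error it contains the
error of the end value and the deviation of `K_n` from a diagonal matrix. -/
def solutionDefect (M : PeerTriplet) (Q : ControlProblem m d) (u : Vec m → Vec m → Vec d)
    (Tstar : ℝ) (N : ℕ) (h : ℕ → ℝ) (y p : ℝ → Vec m) (n : ℕ) : Fin 4 → Vec m :=
  adjointDefect M Tstar N h p n + h n • ((fun i => Q.phi u (exactStages M h y n i)
      (stageMul (M.stepK N n)ᵀ (exactStages M h p n) i)) -
    stageMul (M.stepK N n)ᵀ (exactStages M h (iteratedDerivWithin 1 p (Icc 0 Tstar)) n)) +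
  if n = N then (fun i => M.w i • (p (gridPoint h (N + 1)) -
    gradient Q.C (endValue M (exactStages M h y N)))) else 0

open Classical in
/-- The contribution of the boundary steps to the error bound. -/
def boundaryTerm (M : PeerTriplet) (Tstar : ℝ) (p : ℝ → Vec m) (N : ℕ) (h : ℕ → ℝ) : ℝ :=
  if (∃ k, M.K0 = Matrix.diagonal k) ∧ ∃ k, M.KN = Matrix.diagonal k then 0
  else boundaryBound M Tstar p N h

namespace PeerTriplet.OrderConditions

variable {M : PeerTriplet} {Λ : Set ℝ}

lemma isIterate_exact (hM : M.OrderConditions Λ) {Q : ControlProblem m d}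
    {u : Vec m → Vec m → Vec d} {L : Bounds} {lo hi T Tstar : ℝ} {y p : ℝ → Vec m} {N : ℕ}
    {h : ℕ → ℝ} (hr : IsRegularSolution Q u Λ L T Tstar y p)
    (hg : IsGrid M lo hi T Tstar N h) :
    IsIterate M Q u N h (exactStages M h y) (exactStages M h p) (exactStages M h y)
      (exactStages M h p) (forwardDefect M Tstar N h y) (solutionDefect M Q u Tstar N h y p) := by
  have hy : ∀ n ≤ N, exactStages M h (iteratedDerivWithin 1 y (Icc 0 Tstar)) n =
      fun j => Q.g u (exactStages M h y n j) (exactStages M h p n j) := by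
    intro n hn
    funext j
    exact hr.iteratedDeriv_y (hg.node_mem hM.c_nonneg hn j)
  refine ⟨?_, fun n h1 hn => ?_, fun n hn => ?_, ?_⟩
  · rw [forwardDefect, if_pos rfl, hr.init_y, hy 0 (by omega), stepA_zero, stepK_zero]
    abel
  · rw [forwardDefect, if_neg (by omega), hy n hn]
    abel
  · rw [solutionDefect, adjointDefect, if_neg hn.ne, if_neg hn.ne, smul_sub]
    abel
  · rw [solutionDefect, adjointDefect, if_pos rfl, if_pos rfl, smul_sub, stepA_last hg.one_le]
    have : (fun i => M.w i • (p (gridPoint h (N + 1)) -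
        gradient Q.C (endValue M (exactStages M h y N)))) =
      (fun i => M.w i • p (gridPoint h (N + 1))) -
        fun i => M.w i • gradient Q.C (endValue M (exactStages M h y N)) := by
      funext i; simp [smul_sub]
    rw [this]
    abel

/-- The defect of the exact solution is bounded by the right-hand side of the error estimate. -/
theorem exact_defect_le (hM : M.OrderConditions Λ) {lo hi : ℝ} (hlo : 0 < lo) (b : ℝ) :
    ∃ C > 0, ∀ {m d N : ℕ} {Q : ControlProblem m d} {u : Vec m → Vec m → Vec d}
      {L : Bounds} {T Tstar ρ κ : ℝ} {y p : ℝ → Vec m} {h : ℕ → ℝ} {δ : ℝ},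
      IsRegularSolution Q u Λ L T Tstar y p → IsControlLaw Q u Λ (tube Tstar y p ρ) →
      HasDerivBounds Q u L (tube Tstar y p ρ) → IsGrid M lo hi T Tstar N h →
      (∀ n, 1 ≤ n → n ≤ N → entrySum (M.B (ratio h n)) ≤ b) → 0 ≤ κ →
      (∀ n, 1 ≤ n → n ≤ N → |(M.hatA 0 3 - 1) * (ratio h n ^ 3 - 1)| ≤ κ * h n) →
      (∀ n < N, |M.hatA 3 0 * (1 - ratio h (n + 1) ^ 3)| ≤ κ * h n) →
      IsNear M N h y p ρ (exactStages M h y) (exactStages M h p) →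
      C * (1 + κ) * (1 + T) * (1 + L.dpPhi + L.hessC) *
        (errorBound M Tstar y p N h + boundaryTerm M Tstar p N h) ≤ δ →
      (∀ n ≤ N, ‖forwardDefect M Tstar N h y n‖ ≤ δ ∧
        ‖solutionDefect M Q u Tstar N h y p n‖ ≤ δ) ∧
      ∑ n ∈ Finset.Icc 1 (N - 1), ‖∑ i, forwardDefect M Tstar N h y n i‖ ≤ δ ∧
      ∑ n ∈ Finset.Icc 1 (N - 1), ‖∑ i, solutionDefect M Q u Tstar N h y p n i‖ ≤ δ := by
  obtain ⟨C1, hC1, h1⟩ := hM.forwardDefect_le (hi := hi) hlo b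
  obtain ⟨C2, hC2, h2⟩ := hM.sum_forwardDefect_le (hi := hi) hlo b
  obtain ⟨C3, hC3, h3⟩ := hM.adjointDefect_le (hi := hi) hlo b
  obtain ⟨C4, hC4, h4⟩ := hM.sum_adjointDefect_le (hi := hi) hlo b
  obtain ⟨C5, hC5, h5⟩ := hM.endValue_sub_le
  obtain ⟨C6, hC6, h6⟩ := hM.stageMul_stepK_sub_le
  set c := M.coeffBound with hc
  have hc0 : 0 ≤ c := M.coeffBound_nonneg
  refine ⟨C1 + C2 + C3 + C4 + c * C5 + C6, by positivity, ?_⟩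
  intro m d N Q u L T Tstar ρ κ y p h δ hr hu hb hg hB hκ hs1 hs2 hnear hδ
  obtain ⟨l1, l2, l3, l4, l5⟩ := hr.bounds_nonneg
  have hT := hr.T_pos
  have hTs := hr.Tstar_pos
  have hρ : 0 < ρ := (norm_nonneg _).trans_lt (hnear 0 (by omega) 0).1
  have hgy := hg.seminorm_nonneg y
  have hgp := hg.seminorm_nonneg p
  have hbt : 0 ≤ boundaryTerm M Tstar p N h := by
    unfold boundaryTerm boundaryBound
    split_ifs
    · exact le_rfl
    · have := localNorm_nonneg (M := M) (Tstar := Tstar) (N := N) (h := h) p 2 0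
      have := localNorm_nonneg (M := M) (Tstar := Tstar) (N := N) (h := h) p 2 N
      have := (hg.pos 0 (by omega)).le
      have := (hg.pos N le_rfl).le
      positivity
  set G := errorBound M Tstar y p N h + boundaryTerm M Tstar p N h with hG
  have hG0 : 0 ≤ G := by rw [hG, errorBound]; positivity
  have hyG : gridSeminorm M Tstar N h y ≤ G := by rw [hG, errorBound]; linarith
  have hpG : gridSeminorm M Tstar N h p ≤ G := by rw [hG, errorBound]; linarith
  have hbG : gridSeminorm M Tstar N h p + boundaryTerm M Tstar p N h ≤ G := by
    rw [hG, errorBound]; linarith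
  have hterm : ∀ (v : ℝ → Vec m), ∀ n ≤ N, h n ^ 3 * localNorm M Tstar N h v 3 n ≤
      gridSeminorm M Tstar N h v := fun v n hn =>
    (mul_le_mul_of_nonneg_left (le_max_left _ _) (pow_nonneg (hg.pos n hn).le 3)).trans
      (le_gridSeminorm hn v)
  -- the target absorbs each of the partial constants
  set E := (1 + κ) * (1 + T) * (1 + L.dpPhi + L.hessC) with hE
  have hE1 : 1 ≤ 1 + κ := by linarith
  have hE2 : 1 ≤ 1 + T := by linarith
  have hE3 : 1 ≤ 1 + L.dpPhi + L.hessC := by linarith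
  have hEone : 1 ≤ E := by
    rw [hE]; exact one_le_mul_of_one_le_of_one_le (one_le_mul_of_one_le_of_one_le hE1 hE2) hE3
  have hETκ : (1 + κ) * T ≤ E := by
    rw [hE]
    calc (1 + κ) * T ≤ (1 + κ) * (1 + T) := by gcongr; linarith
      _ ≤ _ := le_mul_of_one_le_right (by positivity) hE3
  have hEL : 1 + L.dpPhi + L.hessC ≤ E := by
    rw [hE]; exact le_mul_of_one_le_left (by positivity) (one_le_mul_of_one_le_of_one_le hE1 hE2)
  have hδ' : (C1 + C2 + C3 + C4 + c * C5 + C6) * (E * G) ≤ δ := by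
    refine le_trans (le_of_eq ?_) hδ
    rw [hE]; ring
  have hEG : 0 ≤ E * G := by positivity
  have hGEG : G ≤ E * G := le_mul_of_one_le_left hG0 hEone
  have hIcc : ∀ n ∈ Finset.Icc 1 (N - 1), 1 ≤ n ∧ n < N := fun n hn => by
    have := hg.one_le
    rw [Finset.mem_Icc] at hn; omega
  have hpc : 0 ≤ c * C5 * (E * G) := by positivity
  have hsum : ∀ (D : ℕ → Fin 4 → Vec m) (v : ℝ → Vec m) (C : ℝ), 0 ≤ C →
      gridSeminorm M Tstar N h v ≤ G →
      (∀ n, 1 ≤ n → n < N → ‖∑ i, D n i‖ ≤ C * (1 + κ) * (h n * (h n ^ 3 *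
        max (localNorm M Tstar N h v 3 n) (localNorm M Tstar N h v 4 n)))) →
      ∑ n ∈ Finset.Icc 1 (N - 1), ‖∑ i, D n i‖ ≤ C * (E * G) := by
    intro D v C hC hv hD
    have e1 : ∀ n ∈ Finset.Icc 1 (N - 1), ‖∑ i, D n i‖ ≤ h n * (C * (1 + κ) * G) := by
      intro n hn
      obtain ⟨n1, n2⟩ := hIcc n hn
      refine (hD n n1 n2).trans ?_
      have := mul_le_mul_of_nonneg_left ((le_gridSeminorm n2.le v).trans hv) (hg.pos n n2.le).le
      have := mul_le_mul_of_nonneg_left this (by positivity : 0 ≤ C * (1 + κ))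
      linarith
    refine (Finset.sum_le_sum e1).trans ?_
    rw [← Finset.sum_mul]
    have e2 := mul_le_mul_of_nonneg_right (hg.sum_step_le fun n hn => (hIcc n hn).2.le)
      (by positivity : 0 ≤ C * (1 + κ) * G)
    refine e2.trans ?_
    have e3 := mul_le_mul_of_nonneg_right hETκ (by positivity : 0 ≤ C * G)
    linarith
  -- for diagonal `K_n` the scaling of the control law makes this part of the defect vanish
  have hdiag : ∀ n ≤ N, (∃ k, M.stepK N n = Matrix.diagonal k) →
      (fun i => Q.phi u (exactStages M h y n i)
        (stageMul (M.stepK N n)ᵀ (exactStages M h p n) i)) -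
      stageMul (M.stepK N n)ᵀ (exactStages M h (iteratedDerivWithin 1 p (Icc 0 Tstar)) n) = 0 := by
    intro n hn hk
    funext i
    have ht := hg.node_mem hM.c_nonneg hn i
    simp only [Pi.sub_apply, stageMul_transpose_of_diagonal hk, Pi.zero_apply]
    rw [sub_eq_zero]
    have e1 := ControlProblem.phi_smul hu (z := (exactStages M h y n i, exactStages M h p n i))
      ⟨_, ht, by simpa [exactStages] using hρ, by simpa [exactStages] using hρ⟩
      (hM.colSum_stepK N n i).1
    rw [e1]
    congr 1
    exact (hr.iteratedDeriv_p ht).symm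
  have hdev : ∀ n ≤ N, ‖h n • ((fun i => Q.phi u (exactStages M h y n i)
        (stageMul (M.stepK N n)ᵀ (exactStages M h p n) i)) -
      stageMul (M.stepK N n)ᵀ (exactStages M h (iteratedDerivWithin 1 p (Icc 0 Tstar)) n))‖ ≤
      C6 * (E * G) := by
    intro n hn
    have hn0 := hg.pos n hn
    have hz : 0 ≤ C6 * (E * G) := by positivity
    have hp := hr.smooth_p
    by_cases hmid : 1 ≤ n ∧ n < N
    · rw [hdiag n hn (by rw [stepK_mid hmid.1 hmid.2]; exact hM.diag_K), smul_zero, norm_zero]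
      exact hz
    have hn' : n = 0 ∨ n = N := by omega
    by_cases hd : (∃ k, M.K0 = Matrix.diagonal k) ∧ ∃ k, M.KN = Matrix.diagonal k
    · rw [hdiag n hn, smul_zero, norm_zero]
      · exact hz
      · rcases hn' with rfl | rfl
        · rw [stepK_zero]; exact hd.1
        · rw [stepK_last hg.one_le]; exact hd.2
    have hbb : h n ^ 3 * localNorm M Tstar N h p 2 n ≤ boundaryTerm M Tstar p N h := by
      rw [boundaryTerm, if_neg hd, boundaryBound]
      have e1 := localNorm_nonneg (M := M) (Tstar := Tstar) (N := N) (h := h) p 2 0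
      have e2 := localNorm_nonneg (M := M) (Tstar := Tstar) (N := N) (h := h) p 2 N
      have e3 := mul_nonneg (pow_nonneg (hg.pos 0 (by omega)).le 3) e1
      have e4 := mul_nonneg (pow_nonneg (hg.pos N le_rfl).le 3) e2
      rcases hn' with rfl | rfl <;> linarith
    have hl2 := localNorm_nonneg (M := M) (Tstar := Tstar) (N := N) (h := h) p 2 n
    have hl3 := localNorm_nonneg (M := M) (Tstar := Tstar) (N := N) (h := h) p 3 n
    have e1 : ‖(fun i => Q.phi u (exactStages M h y n i)
          (stageMul (M.stepK N n)ᵀ (exactStages M h p n) i)) -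
        stageMul (M.stepK N n)ᵀ (exactStages M h (iteratedDerivWithin 1 p (Icc 0 Tstar)) n)‖ ≤
        L.dpPhi * (C6 * (h n ^ 2 * localNorm M Tstar N h p 2 n)) +
          C6 * (h n ^ 2 * localNorm M Tstar N h p 3 n) := by
      refine (pi_norm_le_iff_of_nonneg (by positivity)).2 fun i => ?_
      have ht := hg.node_mem hM.c_nonneg hn i
      obtain ⟨k1, k2⟩ := hM.colSum_stepK N n i
      have f1 := hb.norm_phi_scaled_sub_le hu (t := gridPoint h n + h n * M.c i) ht k1 k2
        (x := exactStages M h y n i) (x' := exactStages M h y n i)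
        (z := stageMul (M.stepK N n)ᵀ (exactStages M h p n) i)
        (z' := colSum (M.stepK N n) i • exactStages M h p n i)
        (hnear n hn i).1 (hnear n hn i).2.2 (hnear n hn i).1
        (by rw [inv_smul_smul₀ k2]; exact (hnear n hn i).2.1)
      have f2 : Q.phi u (exactStages M h y n i) (colSum (M.stepK N n) i • exactStages M h p n i) =
          colSum (M.stepK N n) i •
            exactStages M h (iteratedDerivWithin 1 p (Icc 0 Tstar)) n i := by
        have e1 := ControlProblem.phi_smul hu
          (z := (exactStages M h y n i, exactStages M h p n i))
          ⟨_, ht, by simpa [exactStages] using hρ, by simpa [exactStages] using hρ⟩ k1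
        rw [e1]
        congr 1
        exact (hr.iteratedDeriv_p ht).symm
      have f3 := h6 hTs hg hp n hn 0 (by omega) i
      have f4 := h6 hTs hg hp n hn 1 le_rfl i
      rw [iteratedDerivWithin_zero] at f3
      rw [sub_self, norm_zero, mul_zero, zero_add, f2] at f1
      rw [norm_sub_rev] at f4
      rw [Pi.sub_apply]
      refine (norm_sub_le_norm_sub_add_norm_sub _ _ _).trans (add_le_add (f1.trans ?_) f4)
      exact mul_le_mul_of_nonneg_left f3 l4
    rw [norm_smul, Real.norm_eq_abs, abs_of_pos hn0]
    calc _ ≤ h n * (L.dpPhi * (C6 * (h n ^ 2 * localNorm M Tstar N h p 2 n)) +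
          C6 * (h n ^ 2 * localNorm M Tstar N h p 3 n)) := mul_le_mul_of_nonneg_left e1 hn0.le
      _ = C6 * (L.dpPhi * (h n ^ 3 * localNorm M Tstar N h p 2 n) +
          h n ^ 3 * localNorm M Tstar N h p 3 n) := by ring
      _ ≤ C6 * (L.dpPhi * boundaryTerm M Tstar p N h + gridSeminorm M Tstar N h p) := by
        have := hterm p n hn
        gcongr
      _ ≤ C6 * ((1 + L.dpPhi + L.hessC) * G) := by
        refine mul_le_mul_of_nonneg_left ?_ hC6.le
        have g1 : L.dpPhi * boundaryTerm M Tstar p N h ≤ L.dpPhi * G :=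
          mul_le_mul_of_nonneg_left (by linarith) l4
        have g2 : 0 ≤ L.hessC * G := by positivity
        linarith
      _ ≤ C6 * (E * G) := by gcongr
  have hend : ‖(if N = N then (fun i => M.w i • (p (gridPoint h (N + 1)) -
      gradient Q.C (endValue M (exactStages M h y N)))) else (0 : Fin 4 → Vec m))‖ ≤
        c * C5 * (E * G) := by
    rw [if_pos rfl]
    refine (pi_norm_le_iff_of_nonneg hpc).2 fun i => ?_
    rw [norm_smul, Real.norm_eq_abs, hg.sum_eq, hr.final_p, mul_assoc]
    refine mul_le_mul ((abs_colSum_le M.AN i).trans M.entrySum_le_coeffBound.1.2.2) ?_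
      (norm_nonneg _) hc0
    refine (hr.quadratic.norm_gradient_sub_le hr.hessC_le _ _).trans ?_
    rw [norm_sub_rev]
    have f1 := h5 hTs hg hr.smooth_y
    have f2 := hterm y N le_rfl
    calc L.hessC * _ ≤ L.hessC * (C5 * G) := by
          refine mul_le_mul_of_nonneg_left (f1.trans ?_) l5
          exact mul_le_mul_of_nonneg_left (f2.trans hyG) hC5.le
      _ ≤ (1 + L.dpPhi + L.hessC) * (C5 * G) := by gcongr; linarith
      _ ≤ E * (C5 * G) := by gcongr
      _ = _ := by ring
  have z1 : 0 ≤ C1 * (E * G) := by positivity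
  have z2 : 0 ≤ C2 * (E * G) := by positivity
  have z3 : 0 ≤ C3 * (E * G) := by positivity
  have z4 : 0 ≤ C4 * (E * G) := by positivity
  have z6 : 0 ≤ C6 * (E * G) := by positivity
  refine ⟨fun n hn => ⟨?_, ?_⟩, ?_, ?_⟩
  · have e1 := h1 hTs hg hB hr.smooth_y n hn
    have e2 := mul_le_mul_of_nonneg_left ((hterm y n hn).trans (hyG.trans hGEG)) hC1.le
    linarith
  · have e1 := h3 hTs hg hB hr.smooth_p n hn
    have e2 := mul_le_mul_of_nonneg_left ((hterm p n hn).trans (hpG.trans hGEG)) hC3.le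
    have e3 := hdev n hn
    have e4 : ‖(if n = N then (fun i => M.w i • (p (gridPoint h (N + 1)) -
        gradient Q.C (endValue M (exactStages M h y N)))) else (0 : Fin 4 → Vec m))‖ ≤
          c * C5 * (E * G) := by
      by_cases hnN : n = N
      · rw [hnN]; exact hend
      · rw [if_neg hnN, norm_zero]; exact hpc
    have e5 := (norm_add_le _ _).trans (add_le_add ((norm_add_le _ _).trans
      (add_le_add (e1.trans e2) e3)) e4)
    refine e5.trans ?_
    linarith
  · have := hsum _ y C2 hC2.le hyG fun n n1 n2 => h2 hTs hg hB hκ hs1 hr.smooth_y n n1 n2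
    linarith
  · have := hsum (solutionDefect M Q u Tstar N h y p) p C4 hC4.le hpG fun n n1 n2 => by
      have e1 := h4 hTs hg hB hκ hs2 hr.smooth_p n n1 n2
      have e2 : solutionDefect M Q u Tstar N h y p n = adjointDefect M Tstar N h p n := by
        rw [solutionDefect, hdiag n n2.le (by rw [stepK_mid n1 n2]; exact hM.diag_K),
          if_neg n2.ne, smul_zero, add_zero, add_zero]
      rw [e2]
      exact e1
    linarith

end PeerTriplet.OrderConditions
/-! ### Existence and uniqueness by contraction -/

/-- Banach's theorem on a closed ball that is mapped into itself. -/
lemma exists_fixedPoint_of_ball {F : Type*} [MetricSpace F] [CompleteSpace F] {f : F → F} {x₀ : F}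
    {r : ℝ} (hr : 0 ≤ r) (h₀ : dist (f x₀) x₀ ≤ r / 2)
    (hf : ∀ x ∈ Metric.closedBall x₀ r, ∀ z ∈ Metric.closedBall x₀ r,
      dist (f x) (f z) ≤ dist x z / 2) :
    ∃ x ∈ Metric.closedBall x₀ r, f x = x := by
  have hx₀ : x₀ ∈ Metric.closedBall x₀ r := Metric.mem_closedBall_self hr
  have hmaps : MapsTo f (Metric.closedBall x₀ r) (Metric.closedBall x₀ r) := by
    intro x hx
    have h1 := hf x hx x₀ hx₀
    have h2 := dist_triangle (f x) (f x₀) x₀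
    rw [Metric.mem_closedBall] at hx ⊢
    linarith
  have hcon : ContractingWith (1 / 2) (hmaps.restrict f _ _) := by
    refine ⟨by norm_num, LipschitzWith.of_dist_le_mul fun x z => ?_⟩
    have h1 := hf x x.2 z z.2
    rw [Subtype.dist_eq, Subtype.dist_eq]
    simp only [MapsTo.val_restrict_apply]
    push_cast
    linarith
  obtain ⟨z, hz, hfix, -⟩ := hcon.exists_fixedPoint' Metric.isClosed_closedBall.isComplete hmaps
    hx₀ (edist_ne_top _ _)
  exact ⟨z, hz, hfix⟩

lemma IsIterate.congr {M : PeerTriplet} {Q : ControlProblem m d}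
    {u : Vec m → Vec m → Vec d} {N : ℕ} {h : ℕ → ℝ} {Y P Z R Y' P' r s : ℕ → Fin 4 → Vec m}
    (hI : IsIterate M Q u N h Y P Y' P' r s) (hYZ : ∀ n ≤ N, Y n = Z n ∧ P n = R n) :
    IsIterate M Q u N h Z R Y' P' r s := by
  refine ⟨?_, fun n h1 hn => ?_, fun n hn => ?_, ?_⟩
  · rw [hI.start, (hYZ 0 (by omega)).1, (hYZ 0 (by omega)).2]
  · rw [hI.forward n h1 hn, (hYZ n hn).1, (hYZ n hn).2]
  · rw [hI.adjoint n hn, (hYZ n hn.le).1, (hYZ n hn.le).2]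
  · rw [hI.final, (hYZ N le_rfl).1, (hYZ N le_rfl).2]

namespace PeerTriplet.OrderConditions

variable {M : PeerTriplet} {Λ : Set ℝ}

lemma det_stepA (hM : M.OrderConditions Λ) (N n : ℕ) : (M.stepA N n).det ≠ 0 := by
  unfold stepA
  split_ifs
  exacts [hM.det_A0, hM.det_AN, hM.det_A]

/-- The linear recursions of the fixed point iteration are solvable. -/
lemma exists_isIterate (hM : M.OrderConditions Λ) (Q : ControlProblem m d)
    (u : Vec m → Vec m → Vec d) (N : ℕ) (h : ℕ → ℝ) (Y P : ℕ → Fin 4 → Vec m) :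
    ∃ Y' P', IsIterate M Q u N h Y P Y' P' 0 0 := by
  set Y' : ℕ → Fin 4 → Vec m := fun n => Nat.rec
    (stageMul M.A0⁻¹ ((fun i => M.a i • Q.y0) +
      h 0 • stageMul M.K0 (fun j => Q.g u (Y 0 j) (P 0 j))))
    (fun n Z => stageMul (M.stepA N (n + 1))⁻¹ (stageMul (M.B (ratio h (n + 1))) Z +
      h (n + 1) • stageMul (M.stepK N (n + 1))
        (fun j => Q.g u (Y (n + 1) j) (P (n + 1) j)))) n with hY'
  set Z' : ℕ → Fin 4 → Vec m := fun k => Nat.rec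
    (stageMul (M.ANᵀ)⁻¹ ((fun i => M.w i • gradient Q.C (endValue M (Y' N))) -
      h N • (fun i => Q.phi u (Y N i) (stageMul (M.stepK N N)ᵀ (P N) i))))
    (fun k Z => stageMul ((M.stepA N (N - (k + 1)))ᵀ)⁻¹
      (stageMul (M.B (ratio h (N - (k + 1) + 1)))ᵀ Z - h (N - (k + 1)) •
        (fun i => Q.phi u (Y (N - (k + 1)) i)
          (stageMul (M.stepK N (N - (k + 1)))ᵀ (P (N - (k + 1))) i)))) k with hZ'
  refine ⟨Y', fun n => Z' (N - n), ?_, fun n h1 hn => ?_, fun n hn => ?_, ?_⟩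
  · simp only [hY', Pi.zero_apply, add_zero]
    exact stageMul_mul_inv hM.det_A0 _
  · obtain ⟨n, rfl⟩ : ∃ n', n = n' + 1 := ⟨n - 1, by omega⟩
    simp only [hY', Pi.zero_apply, add_zero, Nat.add_sub_cancel]
    exact stageMul_mul_inv (hM.det_stepA N (n + 1)) _
  · obtain ⟨k, hk, rfl⟩ : ∃ k, k + 1 ≤ N ∧ n = N - (k + 1) :=
      ⟨N - n - 1, by omega, by omega⟩
    have e1 : N - (N - (k + 1)) = k + 1 := by omega
    have e2 : N - (N - (k + 1) + 1) = k := by omega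
    simp only [e1, e2, Pi.zero_apply, add_zero]
    simp only [hZ']
    exact stageMul_mul_inv (by rw [Matrix.det_transpose]; exact hM.det_stepA N _) _
  · simp only [Nat.sub_self, Pi.zero_apply, add_zero]
    simp only [hZ']
    exact stageMul_mul_inv (by rw [Matrix.det_transpose]; exact hM.det_AN) _

/-- The weighted norms of the error are equivalent to the maximum norm. -/
lemma globalError_equiv (hM : M.OrderConditions Λ) : ∃ C ≥ 1, ∀ {m N : ℕ} {h : ℕ → ℝ}
    {y p : ℝ → Vec m} {Y P : ℕ → Fin 4 → Vec m} {e : ℝ},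
    ((∀ n ≤ N, ‖Y n - exactStages M h y n‖ ≤ e ∧ ‖P n - exactStages M h p n‖ ≤ e) →
      globalError M y p N h Y P ≤ C * e) ∧
    (globalError M y p N h Y P ≤ e →
      ∀ n ≤ N, ‖Y n - exactStages M h y n‖ ≤ C * e ∧ ‖P n - exactStages M h p n‖ ≤ C * e) := by
  set U := (M.A * M.W)ᵀ with hU
  have hUdet : U.det ≠ 0 := by
    rw [hU, Matrix.det_transpose, Matrix.det_mul]
    exact mul_ne_zero hM.det_A hM.det_W
  have hWdet : M.W⁻¹.det ≠ 0 := by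
    rw [Matrix.det_nonsing_inv, Ring.inverse_eq_inv']
    exact inv_ne_zero hM.det_W
  have n1 := entrySum_nonneg M.W
  have n2 := entrySum_nonneg M.W⁻¹
  have n3 := entrySum_nonneg U
  have n4 := entrySum_nonneg U⁻¹
  have hWW : (M.W⁻¹)⁻¹ = M.W := Matrix.nonsing_inv_nonsing_inv _ (isUnit_iff_ne_zero.2 hM.det_W)
  refine ⟨1 + entrySum M.W + entrySum M.W⁻¹ + 4 * entrySum U + entrySum U⁻¹, by
    change _ ≤ _; linarith, ?_⟩
  intro m N h y p Y P e
  constructor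
  · intro H
    have he : 0 ≤ e := (norm_nonneg _).trans (H 0 (by omega)).1
    refine max_le ?_ ?_
    · refine Real.iSup_le (fun n => Real.iSup_le (fun i => ?_) (by positivity)) (by positivity)
      refine (norm_le_pi_norm (stageMul M.W⁻¹ (Y n - exactStages M h y n)) i).trans ?_
      refine (norm_stageMul_le _ _).trans (mul_le_mul (by linarith) (H n (by omega)).1
        (norm_nonneg _) (by linarith))
    · refine Real.iSup_le (fun n => ?_) (by positivity)
      refine (sum_norm_le (stageMul U (P n - exactStages M h p n))).trans ?_
      have e1 := norm_stageMul_le U (P n - exactStages M h p n)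
      have e2 := mul_le_mul_of_nonneg_left (H n (by omega)).2 n3
      have e3 : 0 ≤ (1 + entrySum M.W + entrySum M.W⁻¹ + entrySum U⁻¹) * e := by positivity
      linarith
  · intro H n hn
    have h1 : stateError M y N h Y ≤ e := (le_max_left _ _).trans H
    have h2 : adjointError M p N h P ≤ e := (le_max_right _ _).trans H
    have a1 : ‖stageMul M.W⁻¹ (Y n - exactStages M h y n)‖ ≤ e := by
      have hb : ∀ i, ‖stageMul M.W⁻¹ (Y n - exactStages M h y n) i‖ ≤ e := fun i => by
        refine le_trans ?_ h1
        refine le_trans ?_ (le_ciSup (f := fun n : Fin (N + 1) => ⨆ i : Fin 4,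
          ‖stageMul M.W⁻¹ (fun j => Y n j - exactStages M h y n j) i‖)
          (Finite.bddAbove_range _) ⟨n, by omega⟩)
        exact le_ciSup (f := fun i : Fin 4 =>
          ‖stageMul M.W⁻¹ (fun j => Y n j - exactStages M h y n j) i‖)
          (Finite.bddAbove_range _) i
      exact (pi_norm_le_iff_of_nonneg ((norm_nonneg _).trans (hb 0))).2 hb
    have a2 : ‖stageMul U (P n - exactStages M h p n)‖ ≤ e := by
      refine (norm_le_sum_norm _).trans (le_trans ?_ h2)
      exact le_ciSup (f := fun n : Fin (N + 1) => ∑ i : Fin 4,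
          ‖stageMul (M.A * M.W)ᵀ (fun j => P n j - exactStages M h p n j) i‖)
          (Finite.bddAbove_range _) ⟨n, by omega⟩
    have he : 0 ≤ e := (norm_nonneg _).trans a1
    constructor
    · rw [← stageMul_inv_mul hWdet (Y n - exactStages M h y n), hWW]
      exact (norm_stageMul_le _ _).trans (mul_le_mul (by linarith) a1 (norm_nonneg _)
        (by linarith))
    · rw [← stageMul_inv_mul hUdet (P n - exactStages M h p n)]
      exact (norm_stageMul_le _ _).trans (mul_le_mul (by linarith) a2 (norm_nonneg _)
        (by linarith))

/-- On fine grids, stages close to the exact ones lie in the tube, also after scaling. -/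
lemma exists_isNear (hM : M.OrderConditions Λ) {Tstar ρ : ℝ} (hρ : 0 < ρ) {y p : ℝ → Vec m}
    (hp : ContinuousOn p (Icc 0 Tstar)) : ∃ r > 0, ∃ H > 0, ∀ {N : ℕ} {lo hi T : ℝ} {h : ℕ → ℝ}
      {Y P : ℕ → Fin 4 → Vec m}, IsGrid M lo hi T Tstar N h → (∀ n ≤ N, h n ≤ H) →
      (∀ n ≤ N, ‖Y n - exactStages M h y n‖ ≤ r ∧ ‖P n - exactStages M h p n‖ ≤ r) →
      IsNear M N h y p ρ Y P := by
  set kb := ∑ i, (|(colSum M.K i)⁻¹| + |(colSum M.K0 i)⁻¹| + |(colSum M.KN i)⁻¹|) with hkb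
  have hkb0 : 0 ≤ kb := Finset.sum_nonneg fun i _ => by positivity
  have hkbi : ∀ N n i, |(colSum (M.stepK N n) i)⁻¹| ≤ kb := by
    intro N n i
    refine le_trans ?_ (Finset.single_le_sum (f := fun i => |(colSum M.K i)⁻¹| +
      |(colSum M.K0 i)⁻¹| + |(colSum M.KN i)⁻¹|) (fun i _ => by positivity) (Finset.mem_univ i))
    have e1 := abs_nonneg (colSum M.K i)⁻¹
    have e2 := abs_nonneg (colSum M.K0 i)⁻¹
    have e3 := abs_nonneg (colSum M.KN i)⁻¹
    unfold stepK
    split_ifs <;> linarith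
  set c := M.coeffBound with hc
  have hc0 : 0 ≤ c := M.coeffBound_nonneg
  set η := ρ / (4 * (kb * c + 1)) with hη
  have hη0 : 0 < η := by positivity
  have hη1 : kb * c * (2 * η) + 2 * η = ρ / 2 := by
    rw [hη]; field_simp; ring
  have hη2 : 0 ≤ kb * c * (2 * η) := by positivity
  obtain ⟨H', hH', hunif⟩ := Metric.uniformContinuousOn_iff.1
    (isCompact_Icc.uniformContinuousOn_of_continuous hp) η hη0
  have hcs : 0 < M.cstar := by linarith [M.one_le_cstar]
  refine ⟨η, hη0, H' / (2 * M.cstar), by positivity, ?_⟩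
  intro N lo hi T h Y P hg hH hYP n hn i
  obtain ⟨a1, a2⟩ := hYP n hn
  have b1 := (norm_le_pi_norm (Y n - exactStages M h y n) i).trans a1
  have b2 : ∀ j, ‖P n j - exactStages M h p n j‖ ≤ η := fun j =>
    (norm_le_pi_norm (P n - exactStages M h p n) j).trans a2
  rw [Pi.sub_apply] at b1
  refine ⟨by linarith, by linarith [b2 i], ?_⟩
  have hosc : ∀ j, ‖exactStages M h p n j - exactStages M h p n i‖ ≤ η := by
    intro j
    rw [← dist_eq_norm]
    refine (hunif _ (hg.node_mem hM.c_nonneg hn j) _ (hg.node_mem hM.c_nonneg hn i) ?_).le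
    rw [Real.dist_eq, add_sub_add_left_eq_sub, ← mul_sub, abs_mul, abs_of_pos (hg.pos n hn)]
    have e1 : |M.c j - M.c i| ≤ M.cstar := by
      rw [abs_le]
      constructor <;> linarith [hM.c_nonneg i, hM.c_nonneg j, M.c_le_cstar i, M.c_le_cstar j]
    calc h n * |M.c j - M.c i| ≤ H' / (2 * M.cstar) * M.cstar :=
          mul_le_mul (hH n hn) e1 (abs_nonneg _) (by positivity)
      _ = H' / 2 := by field_simp
      _ < H' := by linarith
  obtain ⟨-, k2⟩ := hM.colSum_stepK N n i
  -- the weights `K_ji / k_i` have sum one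
  have key : (colSum (M.stepK N n) i)⁻¹ • stageMul (M.stepK N n)ᵀ (P n) i -
      exactStages M h p n i = (colSum (M.stepK N n) i)⁻¹ • ∑ j, (M.stepK N n) j i •
        (P n j - exactStages M h p n i) := by
    simp only [stageMul, Matrix.transpose_apply, smul_sub, Finset.sum_sub_distrib,
      ← Finset.sum_smul]
    rw [show ∑ j, M.stepK N n j i = colSum (M.stepK N n) i from rfl, inv_smul_smul₀ k2]
  rw [key, norm_smul, Real.norm_eq_abs]
  have e1 : ‖∑ j, (M.stepK N n) j i • (P n j - exactStages M h p n i)‖ ≤ c * (2 * η) := by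
    refine (norm_sum_smul_le _ (fun j => P n j - exactStages M h p n i)).trans
      (mul_le_mul ?_ ?_ (norm_nonneg _) hc0)
    · refine le_trans ?_ (M.entrySum_stepK_le N n)
      rw [← entrySum_transpose]
      exact Finset.single_le_sum (f := fun i => ∑ j, |(M.stepK N n)ᵀ i j|)
        (fun _ _ => Finset.sum_nonneg fun _ _ => abs_nonneg _) (Finset.mem_univ i)
    · refine (pi_norm_le_iff_of_nonneg (by positivity)).2 fun j => ?_
      refine (norm_sub_le_norm_sub_add_norm_sub _ (exactStages M h p n j) _).trans ?_
      linarith [b2 j, hosc j]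
  have e2 := mul_le_mul (hkbi N n i) e1 (norm_nonneg _) hkb0
  linarith

end PeerTriplet.OrderConditions

/-- The stage vectors of the steps `0, ..., N` as a point of a complete metric space. -/
def restrictStages (N : ℕ) (Y P : ℕ → Fin 4 → Vec m) :
    (Fin (N + 1) → Fin 4 → Vec m) × (Fin (N + 1) → Fin 4 → Vec m) :=
  (fun n => Y n, fun n => P n)

lemma dist_restrictStages_le {N : ℕ} {Y P Z R : ℕ → Fin 4 → Vec m} {e : ℝ} (he : 0 ≤ e) :
    dist (restrictStages N Y P) (restrictStages N Z R) ≤ e ↔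
      ∀ n ≤ N, ‖Y n - Z n‖ ≤ e ∧ ‖P n - R n‖ ≤ e := by
  rw [Prod.dist_eq, max_le_iff, dist_pi_le_iff he, dist_pi_le_iff he]
  simp only [restrictStages, dist_eq_norm]
  constructor
  · intro H n hn
    exact ⟨H.1 ⟨n, by omega⟩, H.2 ⟨n, by omega⟩⟩
  · intro H
    exact ⟨fun n => (H n (by omega)).1, fun n => (H n (by omega)).2⟩

/-- Continuation of finitely many stage vectors to a sequence. -/
def extendStages (N : ℕ) (Y : Fin (N + 1) → Fin 4 → Vec m) (n : ℕ) : Fin 4 → Vec m :=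
  Y (Fin.ofNat (N + 1) n)

lemma restrictStages_extendStages (N : ℕ)
    (x : (Fin (N + 1) → Fin 4 → Vec m) × (Fin (N + 1) → Fin 4 → Vec m)) :
    restrictStages N (extendStages N x.1) (extendStages N x.2) = x := by
  have h : ∀ n : Fin (N + 1), Fin.ofNat (N + 1) (n : ℕ) = n := fun n => by
    apply Fin.ext
    simp [Fin.ofNat, Nat.mod_eq_of_lt n.2]
  ext1 <;> funext n <;> simp only [restrictStages, extendStages, h]

lemma errorBound_add_nonneg {M : PeerTriplet} {lo hi T Tstar : ℝ} {N : ℕ} {h : ℕ → ℝ}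
    (hg : IsGrid M lo hi T Tstar N h) (y p : ℝ → Vec m) :
    0 ≤ errorBound M Tstar y p N h + boundaryTerm M Tstar p N h := by
  have h1 := hg.seminorm_nonneg y
  have h2 := hg.seminorm_nonneg p
  have h3 := mul_nonneg (pow_nonneg (hg.pos 0 (by omega)).le 3)
    (localNorm_nonneg (M := M) (Tstar := Tstar) (N := N) (h := h) p 2 0)
  have h4 := mul_nonneg (pow_nonneg (hg.pos N le_rfl).le 3)
    (localNorm_nonneg (M := M) (Tstar := Tstar) (N := N) (h := h) p 2 N)
  unfold errorBound boundaryTerm boundaryBound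
  split_ifs <;> linarith

/-- The error bound is of order `H^3` for a maximal stepsize `H`. -/
lemma exists_errorBound_le {M : PeerTriplet} {Tstar : ℝ} (hT : 0 < Tstar) {y p : ℝ → Vec m}
    (hy : ContDiffOn ℝ 4 y (Icc 0 Tstar)) (hp : ContDiffOn ℝ 4 p (Icc 0 Tstar)) :
    ∃ C ≥ 0, ∀ {N : ℕ} {lo hi T H : ℝ} {h : ℕ → ℝ}, IsGrid M lo hi T Tstar N h →
      (∀ n ≤ N, h n ≤ H) →
      errorBound M Tstar y p N h + boundaryTerm M Tstar p N h ≤ C * H ^ 3 := by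
  have hb : ∀ v : ℝ → Vec m, ContDiffOn ℝ 4 v (Icc 0 Tstar) → ∀ k ≤ 4, ∃ C ≥ 0,
      ∀ x ∈ Icc 0 Tstar, ‖iteratedDerivWithin k v (Icc 0 Tstar) x‖ ≤ C := by
    intro v hv k hk
    obtain ⟨C, hC⟩ := isCompact_Icc.exists_bound_of_continuousOn
      (continuousOn_iteratedDerivWithin hT hv hk)
    exact ⟨C, (norm_nonneg _).trans (hC 0 ⟨le_rfl, hT.le⟩), hC⟩
  obtain ⟨a3, ha3, h3⟩ := hb y hy 3 (by norm_num)
  obtain ⟨a4, ha4, h4⟩ := hb y hy 4 le_rfl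
  obtain ⟨b2, hb2, g2⟩ := hb p hp 2 (by norm_num)
  obtain ⟨b3, hb3, g3⟩ := hb p hp 3 (by norm_num)
  obtain ⟨b4, hb4, g4⟩ := hb p hp 4 le_rfl
  refine ⟨a3 + a4 + b3 + b4 + 2 * b2, by change 0 ≤ _; positivity, ?_⟩
  intro N lo hi T H h hg hH
  have hH0 : 0 ≤ H := (hg.pos 0 (by omega)).le.trans (hH 0 (by omega))
  have hpow : ∀ n ≤ N, h n ^ 3 ≤ H ^ 3 := fun n hn =>
    pow_le_pow_left₀ (hg.pos n hn).le (hH n hn) 3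
  have hH3 : 0 ≤ H ^ 3 := by positivity
  have hs : ∀ (v : ℝ → Vec m) (c3 c4 : ℝ), 0 ≤ c3 → 0 ≤ c4 →
      (∀ x ∈ Icc 0 Tstar, ‖iteratedDerivWithin 3 v (Icc 0 Tstar) x‖ ≤ c3) →
      (∀ x ∈ Icc 0 Tstar, ‖iteratedDerivWithin 4 v (Icc 0 Tstar) x‖ ≤ c4) →
      gridSeminorm M Tstar N h v ≤ H ^ 3 * (c3 + c4) := by
    intro v c3 c4 hc3 hc4 e3 e4
    refine Real.iSup_le (fun n => ?_) (by positivity)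
    refine mul_le_mul (hpow n (by omega)) (max_le ?_ ?_)
      (le_max_of_le_left (localNorm_nonneg _ _ _)) hH3
    · linarith [hg.localNorm_le (n := n) hc3 e3]
    · linarith [hg.localNorm_le (n := n) hc4 e4]
  have q1 := hs y a3 a4 ha3 ha4 h3 h4
  have q2 := hs p b3 b4 hb3 hb4 g3 g4
  have q3 : ∀ n ≤ N, h n ^ 3 * localNorm M Tstar N h p 2 n ≤ H ^ 3 * b2 := fun n hn =>
    mul_le_mul (hpow n hn) (hg.localNorm_le hb2 g2) (localNorm_nonneg _ _ _) hH3
  have q4 : boundaryTerm M Tstar p N h ≤ 2 * (H ^ 3 * b2) := by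
    unfold boundaryTerm boundaryBound
    split_ifs
    · positivity
    · linarith [q3 0 (by omega), q3 N le_rfl]
  unfold errorBound
  linarith

/-! ### Convergence from order conditions and damping -/

lemma abs_cube_sub_one_le {σ hi : ℝ} (h0 : 0 ≤ σ) (h1 : σ ≤ hi) :
    |σ ^ 3 - 1| ≤ (hi ^ 2 + hi + 1) * |σ - 1| := by
  rw [show σ ^ 3 - 1 = (σ ^ 2 + σ + 1) * (σ - 1) by ring, abs_mul,
    abs_of_nonneg (by positivity : 0 ≤ σ ^ 2 + σ + 1)]
  gcongr

namespace PeerTriplet.OrderConditions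

variable {M : PeerTriplet} {Λ : Set ℝ}

/-- The general convergence theorem. The order conditions and the damping of the nontrivial part of
`A⁻¹ B(σ)` give an error of order three; the two error terms that do not cancel for `σ ≠ 1` are
absent if `1^T A c^3 = 1` and `(c^3)^T A 1 = 0`, and are small on smooth grids. -/
theorem convergesOn (hM : M.OrderConditions Λ) {lo hi : ℝ} (hlo : 0 < lo) {S : Set ℝ}
    (hS : M.IsDamped S) :
    ∃ ζ : Zeta, ∀ (L : Bounds) (T κ : ℝ), ∃ μ > 0, ∀ (m d : ℕ) (Q : ControlProblem m d)
      (u : Vec m → Vec m → Vec d) (Tstar : ℝ) (y p : ℝ → Vec m) (Grid : ℕ → (ℕ → ℝ) → Prop),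
      IsRegularSolution Q u Λ L T Tstar y p → Contractive ζ L T →
      (∃ H > 0, ∀ N h, Grid N h → (∀ n ≤ N, h n ≤ H) → IsGrid M lo hi T Tstar N h ∧
        (∀ n, 1 ≤ n → n ≤ N → ratio h n ∈ S) ∧
        (M.hatA 0 3 = 1 ∧ M.hatA 3 0 = 0 ∨ IsSmoothGrid κ N h)) →
      ConvergesOn M Q u y p Grid
        (fun N h => μ * (errorBound M Tstar y p N h + boundaryTerm M Tstar p N h)) := by
  obtain ⟨b, hb⟩ := hS.bounded
  obtain ⟨ζ, hζ, C, hC, hcontr⟩ := hM.iterate_sub_le hS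
  obtain ⟨D, hD, hdefect⟩ := hM.exact_defect_le (hi := hi) hlo b
  obtain ⟨G, hG, hequiv⟩ := hM.globalError_equiv
  have hG0 : 0 < G := lt_of_lt_of_le one_pos hG
  refine ⟨⟨ζ, ζ, ζ, ζ⟩, fun L T κ => ?_⟩
  set κ' := (|M.hatA 0 3 - 1| + |M.hatA 3 0|) * (|hi| ^ 2 + |hi| + 1) * (1 + |hi|) * |κ| with hκ'
  have hκ0 : 0 ≤ κ' := by positivity
  set F := D * (1 + κ') * (1 + |T|) * (1 + |L.dpPhi| + |L.hessC|) with hF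
  have hF0 : 0 < F := by positivity
  refine ⟨2 * G * C * F, by positivity, ?_⟩
  intro m d Q u Tstar y p Grid hr hcon hgrid
  obtain ⟨H0, hH0, hgrid⟩ := hgrid
  obtain ⟨ρ, hρ, hu, hbd⟩ := hr.tubular
  obtain ⟨r, hr0, H1, hH1, hnear⟩ := hM.exists_isNear hρ hr.smooth_p.continuousOn
  obtain ⟨E, hE, herr⟩ := exists_errorBound_le (M := M) hr.Tstar_pos hr.smooth_y hr.smooth_p
  have hE' : 0 ≤ E := hE
  obtain ⟨l1, l2, l3, l4, l5⟩ := hr.bounds_nonneg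
  have hT := hr.T_pos
  -- `r / G ^ 2` is the radius on which the iteration is a contraction into itself
  set r' := r / G ^ 2 with hr'
  have hr'0 : 0 < r' := by positivity
  have hr'r : r' ≤ r := div_le_self hr0.le (one_le_pow₀ hG)
  set η := r' / (2 * (C * F * (E + 1))) with hη
  have hη0 : 0 < η := by positivity
  refine ⟨r / G, by positivity, min (min H0 H1) (min 1 η), by positivity, ?_⟩
  intro N h hNh hfine
  have hf0 : ∀ n ≤ N, h n ≤ H0 := fun n hn =>
    (hfine n hn).trans ((min_le_left _ _).trans (min_le_left _ _))
  have hf1 : ∀ n ≤ N, h n ≤ H1 := fun n hn =>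
    (hfine n hn).trans ((min_le_left _ _).trans (min_le_right _ _))
  have hf2 : ∀ n ≤ N, h n ≤ min 1 η := fun n hn => (hfine n hn).trans (min_le_right _ _)
  obtain ⟨hg, hσ, hsm⟩ := hgrid N h hNh hf0
  have hN := hg.one_le
  have hhi : ∀ n, 1 ≤ n → n ≤ N → 0 ≤ ratio h n ∧ ratio h n ≤ |hi| := fun n h1 hn =>
    ⟨hlo.le.trans (hg.ratio_mem n h1 hn).1, (hg.ratio_mem n h1 hn).2.trans (le_abs_self _)⟩
  have hcube : ∀ n, 1 ≤ n → n ≤ N → IsSmoothGrid κ N h →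
      |ratio h n ^ 3 - 1| ≤ (|hi| ^ 2 + |hi| + 1) * (|κ| * h n) := by
    intro n h1 hn hs
    refine (abs_cube_sub_one_le (hhi n h1 hn).1 (hhi n h1 hn).2).trans ?_
    gcongr
    exact (hs n h1 hn).trans (mul_le_mul_of_nonneg_right (le_abs_self κ) (hg.pos n hn).le)
  have hs1 : ∀ n, 1 ≤ n → n ≤ N → |(M.hatA 0 3 - 1) * (ratio h n ^ 3 - 1)| ≤ κ' * h n := by
    intro n h1 hn
    have hp := hg.pos n hn
    rcases hsm with ⟨e1, -⟩ | hs
    · rw [e1, sub_self, zero_mul, abs_zero]; positivity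
    · rw [abs_mul]
      calc |M.hatA 0 3 - 1| * |ratio h n ^ 3 - 1|
          ≤ (|M.hatA 0 3 - 1| + |M.hatA 3 0|) * ((|hi| ^ 2 + |hi| + 1) * (|κ| * h n)) := by
            gcongr
            · linarith [abs_nonneg (M.hatA 3 0)]
            · exact hcube n h1 hn hs
        _ ≤ (|M.hatA 0 3 - 1| + |M.hatA 3 0|) * ((|hi| ^ 2 + |hi| + 1) * (|κ| * h n)) *
            (1 + |hi|) := le_mul_of_one_le_right (by positivity) (by linarith [abs_nonneg hi])
        _ = κ' * h n := by rw [hκ']; ring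
  have hs2 : ∀ n < N, |M.hatA 3 0 * (1 - ratio h (n + 1) ^ 3)| ≤ κ' * h n := by
    intro n hn
    have hp := hg.pos n hn.le
    rcases hsm with ⟨-, e1⟩ | hs
    · rw [e1, zero_mul, abs_zero]; positivity
    · have hstep : h (n + 1) ≤ h n * |hi| := by
        have e1 : h (n + 1) = h n * ratio h (n + 1) := by
          rw [ratio, Nat.add_sub_cancel, mul_div_cancel₀ _ hp.ne']
        rw [e1]
        exact mul_le_mul_of_nonneg_left (hhi (n + 1) (by omega) hn).2 hp.le
      rw [abs_mul, abs_sub_comm]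
      have hx := abs_nonneg hi
      calc |M.hatA 3 0| * |ratio h (n + 1) ^ 3 - 1|
          ≤ (|M.hatA 0 3 - 1| + |M.hatA 3 0|) *
              ((|hi| ^ 2 + |hi| + 1) * (|κ| * (h n * |hi|))) := by
            gcongr
            · linarith [abs_nonneg (M.hatA 0 3 - 1)]
            · exact (hcube (n + 1) (by omega) hn hs).trans (by gcongr)
        _ ≤ (|M.hatA 0 3 - 1| + |M.hatA 3 0|) *
              ((|hi| ^ 2 + |hi| + 1) * (|κ| * (h n * (1 + |hi|)))) := by
            gcongr
            linarith
        _ = κ' * h n := by rw [hκ']; ring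
  have hex : IsNear M N h y p ρ (exactStages M h y) (exactStages M h p) :=
    hnear hg hf1 fun n _ => by simp [hr0.le]
  have hebnn := errorBound_add_nonneg hg y p
  set δ := F * (errorBound M Tstar y p N h + boundaryTerm M Tstar p N h) with hδ
  have hδ0 : 0 ≤ δ := by positivity
  obtain ⟨d1, d2, d3⟩ := hdefect hr hu hbd hg (fun n h1 hn => hb _ (hσ n h1 hn)) hκ0 hs1 hs2 hex
    (δ := δ) (by rw [hδ, hF, abs_of_nonneg l4, abs_of_nonneg l5, abs_of_pos hT])
  have hIE := hM.isIterate_exact hr hg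
  have hδsmall : C * δ ≤ r' / 2 := by
    have hmin : min 1 η ^ 3 ≤ η := by
      have e1 : 0 < min 1 η := by positivity
      calc min 1 η ^ 3 ≤ min 1 η ^ 1 := pow_le_pow_of_le_one e1.le (min_le_left _ _) (by norm_num)
        _ ≤ η := by rw [pow_one]; exact min_le_right _ _
    have e2 := herr hg hf2
    calc C * δ ≤ C * (F * ((E + 1) * η)) := by
          rw [hδ]
          gcongr
          refine e2.trans ?_
          gcongr
          linarith
      _ = r' / 2 := by rw [hη]; field_simp
  have hclose : ∀ {Y P : ℕ → Fin 4 → Vec m}, globalError M y p N h Y P ≤ r / G →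
      ∀ n ≤ N, ‖Y n - exactStages M h y n‖ ≤ r ∧ ‖P n - exactStages M h p n‖ ≤ r := by
    intro Y P hYP n hn
    have := (hequiv (Y := Y) (P := P)).2 hYP n hn
    rwa [mul_div_cancel₀ _ hG0.ne'] at this
  refine ⟨?_, ?_, ?_⟩
  · choose f g hfg using fun (x : (Fin (N + 1) → Fin 4 → Vec m) × (Fin (N + 1) → Fin 4 → Vec m)) =>
      hM.exists_isIterate Q u N h (extendStages N x.1) (extendStages N x.2)
    set x₀ := restrictStages N (exactStages M h y) (exactStages M h p) with hx₀
    have hball : ∀ x ∈ Metric.closedBall x₀ r', ∀ n ≤ N,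
        ‖extendStages N x.1 n - exactStages M h y n‖ ≤ r' ∧
        ‖extendStages N x.2 n - exactStages M h p n‖ ≤ r' := by
      intro x hx
      rw [Metric.mem_closedBall, ← restrictStages_extendStages N x, hx₀] at hx
      exact (dist_restrictStages_le hr'0.le).1 hx
    have hnearball : ∀ x ∈ Metric.closedBall x₀ r',
        IsNear M N h y p ρ (extendStages N x.1) (extendStages N x.2) := fun x hx =>
      hnear hg hf1 fun n hn => ⟨(hball x hx n hn).1.trans hr'r, (hball x hx n hn).2.trans hr'r⟩
    have hself : dist (restrictStages N (f x₀) (g x₀)) x₀ ≤ r' / 2 := by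
      rw [hx₀, dist_restrictStages_le (by positivity), ← hx₀]
      intro n hn
      have hz : ∀ n ≤ N, ‖extendStages N x₀.1 n - exactStages M h y n‖ ≤ 0 ∧
          ‖extendStages N x₀.2 n - exactStages M h p n‖ ≤ 0 :=
        (dist_restrictStages_le le_rfl).1 (by rw [restrictStages_extendStages, ← hx₀, dist_self])
      have := hcontr hr hu hbd hcon hg hσ (hnearball x₀ (Metric.mem_closedBall_self hr'0.le)) hex
        (hfg x₀) hIE hz d1 d2 d3 n hn
      constructor <;> linarith [this.1, this.2]
    have hcon' : ∀ x ∈ Metric.closedBall x₀ r', ∀ z ∈ Metric.closedBall x₀ r',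
        dist (restrictStages N (f x) (g x)) (restrictStages N (f z) (g z)) ≤ dist x z / 2 := by
      intro x hx z hz
      have hd : ∀ n ≤ N, ‖extendStages N x.1 n - extendStages N z.1 n‖ ≤ dist x z ∧
          ‖extendStages N x.2 n - extendStages N z.2 n‖ ≤ dist x z :=
        (dist_restrictStages_le dist_nonneg).1 (by
          rw [restrictStages_extendStages, restrictStages_extendStages])
      rw [dist_restrictStages_le (by positivity)]
      intro n hn
      have := hcontr hr hu hbd hcon hg hσ (hnearball x hx) (hnearball z hz) (hfg x) (hfg z) hd
        (δ := 0) (fun n _ => by simp) (by simp) (by simp) n hn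
      simpa using this
    obtain ⟨x, hx, hfix⟩ := exists_fixedPoint_of_ball
      (f := fun x => restrictStages N (f x) (g x)) hr'0.le hself hcon'
    have hxe : ∀ n ≤ N, f x n = extendStages N x.1 n ∧ g x n = extendStages N x.2 n := by
      have := (dist_restrictStages_le (Y := f x) (P := g x) (Z := extendStages N x.1)
        (R := extendStages N x.2) (N := N) le_rfl).1 (by
          rw [restrictStages_extendStages, hfix, dist_self])
      intro n hn
      obtain ⟨e1, e2⟩ := this n hn
      exact ⟨sub_eq_zero.1 (norm_le_zero_iff.1 e1), sub_eq_zero.1 (norm_le_zero_iff.1 e2)⟩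
    refine ⟨f x, g x, ?_, ?_⟩
    · rw [isDiscreteSolution_iff_isIterate hN]
      exact (hfg x).congr fun n hn => ⟨(hxe n hn).1.symm, (hxe n hn).2.symm⟩
    · refine ((hequiv (e := r')).1 fun n hn => ?_).trans (le_of_eq ?_)
      · rw [(hxe n hn).1, (hxe n hn).2]
        exact hball x hx n hn
      · rw [hr']; field_simp
  · intro Y P Y' P' h1 e1 h2 e2
    rw [isDiscreteSolution_iff_isIterate hN] at h1 h2
    set e := dist (restrictStages N Y P) (restrictStages N Y' P') with he
    have he0 : 0 ≤ e := dist_nonneg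
    have hd : ∀ n ≤ N, ‖Y n - Y' n‖ ≤ e ∧ ‖P n - P' n‖ ≤ e :=
      (dist_restrictStages_le he0).1 le_rfl
    have hd' : e ≤ e / 2 := by
      have := hcontr hr hu hbd hcon hg hσ (hnear hg hf1 (hclose e1)) (hnear hg hf1 (hclose e2))
        h1 h2 hd (δ := 0) (fun n _ => by simp) (by simp) (by simp)
      simp only [mul_zero, add_zero] at this
      exact (dist_restrictStages_le (by positivity)).2 this
    have hez : e = 0 := by linarith
    intro n hn
    obtain ⟨f1, f2⟩ := hd n hn
    rw [hez] at f1 f2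
    exact ⟨sub_eq_zero.1 (norm_le_zero_iff.1 f1), sub_eq_zero.1 (norm_le_zero_iff.1 f2)⟩
  · intro Y P h1 e1
    rw [isDiscreteSolution_iff_isIterate hN] at h1
    set e := dist (restrictStages N Y P)
      (restrictStages N (exactStages M h y) (exactStages M h p)) with he
    have he0 : 0 ≤ e := dist_nonneg
    have hd := (dist_restrictStages_le he0).1 he.ge
    have hd' : e ≤ e / 2 + C * δ :=
      (dist_restrictStages_le (by positivity)).2 (hcontr hr hu hbd hcon hg hσ
        (hnear hg hf1 (hclose e1)) hex h1 hIE hd d1 d2 d3)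
    have hfin := (hequiv (e := 2 * (C * δ))).1 fun n hn =>
      ⟨(hd n hn).1.trans (by linarith), (hd n hn).2.trans (by linarith)⟩
    refine hfin.trans (le_of_eq ?_)
    rw [hδ]; ring

end PeerTriplet.OrderConditions

/-! ### Absorption of the boundary terms on smooth grids -/

lemma ConvergesOn.mono {M : PeerTriplet} {Q : ControlProblem m d} {u : Vec m → Vec m → Vec d}
    {y p : ℝ → Vec m} {Grid : ℕ → (ℕ → ℝ) → Prop} {b b' : ℕ → (ℕ → ℝ) → ℝ}
    (hc : ConvergesOn M Q u y p Grid b)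
    (hb : ∃ H > 0, ∀ N h, Grid N h → (∀ n ≤ N, h n ≤ H) → b N h ≤ b' N h) :
    ConvergesOn M Q u y p Grid b' := by
  obtain ⟨ε, hε, H, hH, hc⟩ := hc
  obtain ⟨H', hH', hb⟩ := hb
  refine ⟨ε, hε, min H H', lt_min hH hH', fun N h hN hh => ?_⟩
  obtain ⟨h1, h2, h3⟩ := hc N h hN fun n hn => (hh n hn).trans (min_le_left _ _)
  exact ⟨h1, h2, fun Y P hs he => (h3 Y P hs he).trans
    (hb N h hN fun n hn => (hh n hn).trans (min_le_right _ _))⟩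

lemma boundaryBound_nonneg {M : PeerTriplet} {lo hi T Tstar : ℝ} {N : ℕ} {h : ℕ → ℝ}
    (hg : IsGrid M lo hi T Tstar N h) (p : ℝ → Vec m) : 0 ≤ boundaryBound M Tstar p N h := by
  have h1 := (hg.pos 0 (by omega)).le
  have h2 := (hg.pos N le_rfl).le
  have h3 := localNorm_nonneg (M := M) (Tstar := Tstar) (N := N) (h := h) p 2 0
  have h4 := localNorm_nonneg (M := M) (Tstar := Tstar) (N := N) (h := h) p 2 N
  unfold boundaryBound
  positivity

lemma boundaryTerm_le {M : PeerTriplet} {lo hi T Tstar : ℝ} {N : ℕ} {h : ℕ → ℝ}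
    (hg : IsGrid M lo hi T Tstar N h) (p : ℝ → Vec m) :
    boundaryTerm M Tstar p N h ≤ boundaryBound M Tstar p N h := by
  unfold boundaryTerm
  split_ifs
  exacts [boundaryBound_nonneg hg p, le_rfl]

/-- All steps of a fine smooth grid are comparable: since `σ_n ≤ exp (κ h_n)` and
`σ_n⁻¹ ≤ exp (2 κ h_n)`, the products of the ratios are bounded by `exp (2 κ T)`. -/
lemma IsGrid.step_comparable {M : PeerTriplet} {lo hi T Tstar κ : ℝ} {N : ℕ} {h : ℕ → ℝ}
    (hg : IsGrid M lo hi T Tstar N h) (hκ : 0 ≤ κ) (hs : IsSmoothGrid κ N h)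
    (hfine : ∀ n ≤ N, κ * h n ≤ 1 / 2) {n : ℕ} (hn : n ≤ N) :
    h n ≤ h 0 * Real.exp (2 * κ * T) ∧ h 0 ≤ h n * Real.exp (2 * κ * T) := by
  have key : ∀ n ≤ N, h n ≤ h 0 * Real.exp (2 * κ * gridPoint h (n + 1)) ∧
      h 0 ≤ h n * Real.exp (2 * κ * gridPoint h (n + 1)) := by
    intro n
    induction n with
    | zero =>
      intro _
      have h0 := hg.pos 0 (by omega)
      have : 1 ≤ Real.exp (2 * κ * gridPoint h (0 + 1)) := by
        apply Real.one_le_exp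
        have : 0 ≤ gridPoint h (0 + 1) := by simpa [gridPoint] using h0.le
        positivity
      constructor <;> exact le_mul_of_one_le_right h0.le this
    | succ n ih =>
      intro hn
      obtain ⟨i1, i2⟩ := ih (by omega)
      have hp := hg.pos n (by omega)
      have hp' := hg.pos (n + 1) hn
      have hσ := abs_le.1 (hs (n + 1) (by omega) hn)
      have hf := hfine (n + 1) hn
      have hx : 0 ≤ κ * h (n + 1) := by positivity
      have hr := hg.mul_ratio hn
      have he := Real.add_one_le_exp (2 * (κ * h (n + 1)))
      have hsplit : Real.exp (2 * κ * gridPoint h (n + 1 + 1)) =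
          Real.exp (2 * κ * gridPoint h (n + 1)) * Real.exp (2 * (κ * h (n + 1))) := by
        rw [gridPoint_succ h (n + 1), ← Real.exp_add]
        congr 1; ring
      have e1 : h (n + 1) ≤ h n * Real.exp (2 * (κ * h (n + 1))) := by
        rw [← hr]
        refine mul_le_mul_of_nonneg_left ?_ hp.le
        rw [hr]
        linarith [hσ.2]
      have e2 : h n ≤ h (n + 1) * Real.exp (2 * (κ * h (n + 1))) := by
        rw [← hr, mul_assoc]
        refine le_mul_of_one_le_right hp.le ?_
        rw [hr]
        have f1 : 1 - κ * h (n + 1) ≤ ratio h (n + 1) := by linarith [hσ.1]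
        calc (1 : ℝ) ≤ (1 - κ * h (n + 1)) * (2 * (κ * h (n + 1)) + 1) := by nlinarith
          _ ≤ ratio h (n + 1) * Real.exp (2 * (κ * h (n + 1))) := by
            gcongr
            linarith
      rw [hsplit]
      constructor
      · calc h (n + 1) ≤ h n * Real.exp (2 * (κ * h (n + 1))) := e1
          _ ≤ h 0 * Real.exp (2 * κ * gridPoint h (n + 1)) *
              Real.exp (2 * (κ * h (n + 1))) := by gcongr
          _ = _ := by ring
      · calc h 0 ≤ h n * Real.exp (2 * κ * gridPoint h (n + 1)) := i2
          _ ≤ h (n + 1) * Real.exp (2 * (κ * h (n + 1))) *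
              Real.exp (2 * κ * gridPoint h (n + 1)) := by gcongr
          _ = _ := by ring
  have hle : gridPoint h (n + 1) ≤ T := by
    unfold gridPoint
    exact hg.sum_step_le fun k hk => by rw [Finset.mem_range] at hk; omega
  obtain ⟨k1, k2⟩ := key n hn
  have h0 := hg.pos 0 (by omega)
  have hn' := hg.pos n hn
  exact ⟨k1.trans (by gcongr), k2.trans (by gcongr)⟩

lemma IsGrid.exists_mem_cell {M : PeerTriplet} {lo hi T Tstar : ℝ} {N : ℕ} {h : ℕ → ℝ}
    (hg : IsGrid M lo hi T Tstar N h) {t : ℝ} (ht : t ∈ Icc 0 T) : ∃ n ≤ N, t ∈ cell M h n := by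
  have key : ∀ k ≤ N, t ≤ gridPoint h (k + 1) → ∃ n ≤ k, t ∈ cell M h n := by
    intro k
    induction k with
    | zero =>
      intro _ hk
      refine ⟨0, le_rfl, by simpa [gridPoint] using ht.1, hk.trans ?_⟩
      rw [gridPoint_succ]
      have := le_mul_of_one_le_right (hg.pos 0 (by omega)).le M.one_le_cstar
      linarith
    | succ k ih =>
      intro hk htk
      rcases le_total t (gridPoint h (k + 1)) with hle | hle
      · obtain ⟨n, hn, hc⟩ := ih (by omega) hle
        exact ⟨n, by omega, hc⟩
      · refine ⟨k + 1, le_rfl, hle, htk.trans ?_⟩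
        rw [gridPoint_succ h (k + 1)]
        have := le_mul_of_one_le_right (hg.pos (k + 1) hk).le M.one_le_cstar
        linarith
  exact key N le_rfl (by rw [hg.sum_eq]; exact ht.2)

/-- On fine smooth grids the boundary terms are dominated by the order three error bound of a
solution with a nonzero third derivative: all steps are comparable, so that `h_0^3` and `h_N^3` can
be replaced by `h_n^3` for the step `n` with such a derivative. -/
lemma exists_boundaryBound_le {M : PeerTriplet} {Tstar T κ : ℝ} (hT : 0 < Tstar)
    {y p : ℝ → Vec m} (hy : ContDiffOn ℝ 4 y (Icc 0 Tstar)) (hp : ContDiffOn ℝ 4 p (Icc 0 Tstar))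
    (hne : ∃ t ∈ Icc 0 T, iteratedDerivWithin 3 y (Icc 0 Tstar) t ≠ 0 ∨
      iteratedDerivWithin 3 p (Icc 0 Tstar) t ≠ 0) :
    ∃ C ≥ 0, ∃ H > 0, ∀ {N : ℕ} {lo hi : ℝ} {h : ℕ → ℝ}, IsGrid M lo hi T Tstar N h →
      IsSmoothGrid κ N h → (∀ n ≤ N, h n ≤ H) →
      boundaryBound M Tstar p N h ≤ C * errorBound M Tstar y p N h := by
  obtain ⟨t, ht, hne⟩ := hne
  obtain ⟨B, hB⟩ := isCompact_Icc.exists_bound_of_continuousOn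
    (continuousOn_iteratedDerivWithin hT hp (k := 2) (by norm_num))
  have hB0 : 0 ≤ B := (norm_nonneg _).trans (hB 0 ⟨le_rfl, hT.le⟩)
  set D := ‖iteratedDerivWithin 3 y (Icc 0 Tstar) t‖ + ‖iteratedDerivWithin 3 p (Icc 0 Tstar) t‖
    with hD
  have hD0 : 0 < D := by
    rcases hne with hne | hne
    · have := norm_pos_iff.2 hne; positivity
    · have := norm_pos_iff.2 hne; positivity
  set e := Real.exp (2 * |κ| * T) with he
  have he0 : 0 < e := Real.exp_pos _
  refine ⟨(e ^ 3 + (e ^ 2) ^ 3) * B / D, by change 0 ≤ _; positivity, 1 / (2 * (|κ| + 1)),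
    by positivity, ?_⟩
  intro N lo hi h hg hs hH
  have hs' : IsSmoothGrid |κ| N h := fun n h1 hn =>
    (hs n h1 hn).trans (mul_le_mul_of_nonneg_right (le_abs_self κ) (hg.pos n hn).le)
  have hfine : ∀ n ≤ N, |κ| * h n ≤ 1 / 2 := fun n hn => by
    calc |κ| * h n ≤ (|κ| + 1) * (1 / (2 * (|κ| + 1))) := by
          gcongr
          · exact (hg.pos n hn).le
          · linarith
          · exact hH n hn
      _ = 1 / 2 := by field_simp
  obtain ⟨n, hn, htn⟩ := hg.exists_mem_cell ht
  have hnpos := hg.pos n hn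
  have h0pos := hg.pos 0 (by omega)
  have hNpos := hg.pos N le_rfl
  have c0 := (hg.step_comparable (abs_nonneg κ) hs' hfine hn).2
  have cN := (hg.step_comparable (abs_nonneg κ) hs' hfine le_rfl).1
  have cN' : h N ≤ h n * e ^ 2 := by
    calc h N ≤ h 0 * e := cN
      _ ≤ h n * e * e := by gcongr
      _ = _ := by ring
  have hloc : ∀ v : ℝ → Vec m, ContDiffOn ℝ 4 v (Icc 0 Tstar) →
      h n ^ 3 * ‖iteratedDerivWithin 3 v (Icc 0 Tstar) t‖ ≤ gridSeminorm M Tstar N h v := by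
    intro v hv
    refine le_trans ?_ (le_gridSeminorm hn v)
    gcongr
    exact (hg.norm_le_localNorm hT hv (by norm_num) hn (by omega) (by omega) htn).trans
      (le_max_left _ _)
  have hE : h n ^ 3 * D ≤ errorBound M Tstar y p N h := by
    rw [hD, mul_add]
    exact add_le_add (hloc y hy) (hloc p hp)
  have hl : ∀ k, localNorm M Tstar N h p 2 k ≤ B := fun k => hg.localNorm_le hB0 hB
  have hl0 : ∀ k, 0 ≤ localNorm M Tstar N h p 2 k := fun k => localNorm_nonneg _ _ _
  calc boundaryBound M Tstar p N h ≤ (h n * e) ^ 3 * B + (h n * e ^ 2) ^ 3 * B := by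
        unfold boundaryBound
        gcongr
        exacts [hl0 0, hl 0, hl0 N, hl N]
    _ = (e ^ 3 + (e ^ 2) ^ 3) * B / D * (h n ^ 3 * D) := by field_simp
    _ ≤ _ := by gcongr

/-! ### Damping in transformed coordinates -/

namespace PeerTriplet

variable {M : PeerTriplet} {Λ : Set ℝ}

/-- The matrix `V^T (B(σ) - A 1 1^T A) V`. As `A 1 1^T A` is the part of `B(σ)` that carries the
principal eigenvector `1`, damping is a property of the remainder. -/
def hatRest (M : PeerTriplet) (σ : ℝ) : Matrix (Fin 4) (Fin 4) ℝ :=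
  M.hatB σ - Matrix.of fun i j => M.hatA i 0 * M.hatA 0 j

lemma continuousOn_hatB (hb : Continuous M.b44) : ContinuousOn M.hatB (Ioi 0) := by
  have h1 : ContinuousOn (fun σ : ℝ => σ⁻¹) (Ioi 0) :=
    continuousOn_inv₀.mono fun x hx => (ne_of_gt hx)
  have h2 : ContinuousOn (fun σ : ℝ => (σ ^ 2)⁻¹) (Ioi 0) :=
    (continuousOn_pow 2).inv₀ fun x hx => pow_ne_zero 2 (ne_of_gt hx)
  refine continuousOn_pi.2 fun i => continuousOn_pi.2 fun j => ?_
  have h3 : ∀ a b c : ℝ, ContinuousOn (fun σ : ℝ => a + σ * b + σ ^ 2 * c) (Ioi 0) := fun a b c =>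
    Continuous.continuousOn (by fun_prop)
  have h4 : ∀ a b : ℝ, ContinuousOn (fun σ : ℝ => a + σ * b) (Ioi 0) := fun a b =>
    Continuous.continuousOn (by fun_prop)
  fin_cases i <;> fin_cases j <;> simp only [hatB, Matrix.of_apply] <;>
    first
      | exact continuousOn_const
      | exact h1.mul continuousOn_const
      | exact h2.mul continuousOn_const
      | exact hb.continuousOn
      | exact h4 _ _
      | exact h3 _ _ _

lemma exists_entrySum_B_le (hb : Continuous M.b44) {lo hi : ℝ} (hlo : 0 < lo) :
    ∃ b, ∀ σ ∈ Icc lo hi, entrySum (M.B σ) ≤ b := by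
  have h0 : ContinuousOn M.B (Icc lo hi) := by
    have h1 := (continuousOn_hatB hb).mono fun x (hx : x ∈ Icc lo hi) => hlo.trans_le hx.1
    rw [continuousOn_iff_continuous_domRestrict] at h1 ⊢
    exact (continuous_const.matrix_mul h1).matrix_mul continuous_const
  obtain ⟨b, hb⟩ := isCompact_Icc.bddAbove_image (f := fun σ => entrySum (M.B σ)) (K := Icc lo hi)
    (by
      unfold entrySum
      refine continuousOn_finsetSum _ fun i _ => continuousOn_finsetSum _ fun j _ => ?_
      exact (continuousOn_pi.1 (continuousOn_pi.1 h0 i) j).abs)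
  exact ⟨b, fun σ hσ => hb ⟨σ, hσ, rfl⟩⟩

namespace OrderConditions

/-- With respect to the basis that `T V^T A` defines, the nontrivial part of `A⁻¹ B(σ)` is
`T E T⁻¹` where `E = V^T (B(σ) - A 1 1^T A) V (V^T A V)⁻¹`. -/
lemma isDamped_of_hat (hM : M.OrderConditions Λ) (hb : Continuous M.b44) {lo hi : ℝ}
    (hlo : 0 < lo) {S : Set ℝ} (hS : S ⊆ Icc lo hi) {T T' : Matrix (Fin 4) (Fin 4) ℝ}
    (hT : T * T' = 1) {γ : ℝ} (hγ : γ < 1) (E : ℝ → Matrix (Fin 4) (Fin 4) ℝ)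
    (hE : ∀ σ ∈ S, E σ * M.hatA = M.hatRest σ)
    (hR : ∀ σ ∈ S, ∀ i, ∑ j, |(T * E σ * T') i j| ≤ γ) : M.IsDamped S := by
  obtain ⟨b, hb⟩ := exists_entrySum_B_le hb (hi := hi) hlo
  refine ⟨⟨b, fun σ hσ => hb σ (hS hσ)⟩, T * M.Vᵀ * M.A, max γ 0, ?_, le_max_right _ _,
    max_lt hγ one_pos, fun σ hσ => ⟨T * E σ * T', ?_, fun i => (hR σ hσ i).trans (le_max_left _ _)⟩⟩
  · have h1 : T.det ≠ 0 := fun h => by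
      have := congrArg Matrix.det hT
      rw [Matrix.det_mul, h, zero_mul, Matrix.det_one] at this
      exact zero_ne_one this
    rw [Matrix.det_mul, Matrix.det_mul, Matrix.det_transpose]
    exact mul_ne_zero (mul_ne_zero h1 hM.det_V) hM.det_A
  · have hT' : T' * T = 1 := mul_eq_one_comm.1 hT
    have hmean : M.A * meanProj M.A = Matrix.vecMulVec (fun i => ∑ k, M.A i k) (colSum M.A) := by
      ext i j
      simp only [Matrix.mul_apply, meanProj, Matrix.of_apply, ← Finset.sum_mul,
        Matrix.vecMulVec_apply]
    have hV : (Matrix.of fun i j => M.hatA i 0 * M.hatA 0 j) =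
        M.Vᵀ * (M.A * meanProj M.A) * M.V := by
      have c0 : ∀ i, M.V i 0 = 1 := fun i => by simp [V]
      rw [hmean, Matrix.mul_vecMulVec, Matrix.vecMulVec_mul]
      ext i j
      rw [Matrix.of_apply, Matrix.vecMulVec_apply]
      congr 1
      · simp only [hatA, Matrix.mul_assoc]
        rw [Matrix.mul_apply, Matrix.mulVec, dotProduct]
        simp only [Matrix.mul_apply, c0, mul_one]
      · simp only [hatA, Matrix.mul_apply, Matrix.vecMul, dotProduct, Matrix.transpose_apply, c0,
          one_mul, colSum]
    have hAi : M.A * M.A⁻¹ = 1 := Matrix.mul_nonsing_inv _ (isUnit_iff_ne_zero.2 hM.det_A)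
    have h1 : M.Vᵀ * (M.B σ - M.A * meanProj M.A) * M.V = E σ * (M.Vᵀ * M.A * M.V) := by
      rw [show M.Vᵀ * M.A * M.V = M.hatA from rfl, hE σ hσ, hatRest, hV, ← hM.V_B_V,
        Matrix.mul_sub, Matrix.sub_mul]
    have h2 : M.Vᵀ * (M.B σ - M.A * meanProj M.A) = E σ * (M.Vᵀ * M.A) := by
      have := congrArg (· * M.V⁻¹) h1
      simp only [← Matrix.mul_assoc] at this
      rw [Matrix.mul_assoc _ M.V, Matrix.mul_assoc _ M.V, hM.V_mul_inv] at this
      simpa [Matrix.mul_assoc] using this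
    calc T * M.Vᵀ * M.A * (M.A⁻¹ * M.B σ - meanProj M.A)
        = T * (M.Vᵀ * ((M.A * M.A⁻¹) * M.B σ - M.A * meanProj M.A)) := by
          simp only [Matrix.mul_sub, Matrix.mul_assoc]
      _ = T * (E σ * (M.Vᵀ * M.A)) := by rw [hAi, Matrix.one_mul, h2]
      _ = T * E σ * (T' * T) * (M.Vᵀ * M.A) := by
          rw [hT', Matrix.mul_one]; simp only [Matrix.mul_assoc]
      _ = T * E σ * T' * (T * M.Vᵀ * M.A) := by simp only [Matrix.mul_assoc]

/-- Damping at `σ = 1` with a strict bound extends to a neighbourhood of `1`. -/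
lemma exists_isDamped (hM : M.OrderConditions Λ) (hb : Continuous M.b44)
    {T T' E : Matrix (Fin 4) (Fin 4) ℝ} (hT : T * T' = 1) (hE : E * M.hatA = M.hatRest 1)
    (hR : ∀ i, ∑ j, |(T * E * T') i j| < 1) :
    ∃ δ > 0, M.IsDamped (Icc (1 - δ) (1 + δ)) := by
  have hdet : M.hatA.det ≠ 0 := by
    rw [hatA, Matrix.det_mul, Matrix.det_mul, Matrix.det_transpose]
    exact mul_ne_zero (mul_ne_zero hM.det_V hM.det_A) hM.det_V
  have hAi : M.hatA * M.hatA⁻¹ = 1 := Matrix.mul_nonsing_inv _ (isUnit_iff_ne_zero.2 hdet)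
  have hAi' : M.hatA⁻¹ * M.hatA = 1 := Matrix.nonsing_inv_mul _ (isUnit_iff_ne_zero.2 hdet)
  have hE1 : E = M.hatRest 1 * M.hatA⁻¹ := by
    rw [← hE, Matrix.mul_assoc, hAi, Matrix.mul_one]
  have hcont : ContinuousAt (fun σ => T * (M.hatRest σ * M.hatA⁻¹) * T') 1 := by
    have h1 : ContinuousAt M.hatRest 1 :=
      ((continuousOn_hatB hb).continuousAt (Ioi_mem_nhds one_pos)).sub continuousAt_const
    have h2 : Continuous fun X : Matrix (Fin 4) (Fin 4) ℝ => T * (X * M.hatA⁻¹) * T' :=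
      (continuous_const.matrix_mul (continuous_id.matrix_mul continuous_const)).matrix_mul
        continuous_const
    exact h2.continuousAt.comp h1
  have hsum : ∀ i, ContinuousAt
      (fun σ => ∑ j, |(T * (M.hatRest σ * M.hatA⁻¹) * T') i j|) 1 := fun i =>
    tendsto_finsetSum _ fun j _ => ((continuousAt_pi.1 (continuousAt_pi.1 hcont i) j)).abs
  obtain ⟨γ, hγ, hγ1⟩ : ∃ γ, (∀ i, ∑ j, |(T * E * T') i j| < γ) ∧ γ < 1 := by
    obtain ⟨i₀, hi₀⟩ := Finite.exists_max fun i => ∑ j, |(T * E * T') i j|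
    obtain ⟨γ, h1, h2⟩ := exists_between (hR i₀)
    exact ⟨γ, fun i => (hi₀ i).trans_lt h1, h2⟩
  have hev : ∀ᶠ σ in 𝓝 (1 : ℝ), ∀ i, ∑ j, |(T * (M.hatRest σ * M.hatA⁻¹) * T') i j| < γ :=
    Filter.eventually_all.2 fun i => (hsum i).eventually_lt continuousAt_const (by
      rw [← hE1]; exact hγ i)
  obtain ⟨δ, hδ, hball⟩ := Metric.eventually_nhds_iff.1 hev
  refine ⟨min (δ / 2) (1 / 2), by positivity, ?_⟩
  have hd1 : min (δ / 2) (1 / 2) ≤ δ / 2 := min_le_left _ _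
  have hd2 : min (δ / 2) (1 / 2) ≤ 1 / 2 := min_le_right _ _
  refine hM.isDamped_of_hat hb (lo := 1 / 2) (hi := 3 / 2) (by norm_num) ?_ hT hγ1
    (fun σ => M.hatRest σ * M.hatA⁻¹) (fun σ _ => ?_) fun σ hσ i => (hball ?_ i).le
  · exact Icc_subset_Icc (by linarith) (by linarith)
  · rw [Matrix.mul_assoc, hAi', Matrix.mul_one]
  · rw [Real.dist_eq, abs_lt]
    constructor <;> linarith [hσ.1, hσ.2]

end OrderConditions

end PeerTriplet

/-! ### Matrices with four rows and columns -/

lemma forall_fin_four {p : Fin 4 → Prop} (h0 : p 0) (h1 : p 1) (h2 : p 2) (h3 : p 3) (i : Fin 4) :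
    p i := by
  fin_cases i
  exacts [h0, h1, h2, h3]

lemma diagonal_four (a b c d : ℝ) : Matrix.diagonal ![a, b, c, d] =
    !![a, 0, 0, 0; 0, b, 0, 0; 0, 0, c, 0; 0, 0, 0, d] := by
  ext i j
  fin_cases i <;> fin_cases j <;> simp [Matrix.diagonal]

lemma one_four : (1 : Matrix (Fin 4) (Fin 4) ℝ) =
    !![1, 0, 0, 0; 0, 1, 0, 0; 0, 0, 1, 0; 0, 0, 0, 1] := by
  ext i j
  fin_cases i <;> fin_cases j <;> simp

lemma PeerTriplet.V_eq (M : PeerTriplet) : M.V =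
    !![1, M.c 0, M.c 0 ^ 2, M.c 0 ^ 3; 1, M.c 1, M.c 1 ^ 2, M.c 1 ^ 3;
      1, M.c 2, M.c 2 ^ 2, M.c 2 ^ 3; 1, M.c 3, M.c 3 ^ 2, M.c 3 ^ 3] := by
  ext i j
  fin_cases i <;> fin_cases j <;> simp [PeerTriplet.V]

lemma det_four (X : Matrix (Fin 4) (Fin 4) ℝ) : X.det =
    (X 0 0 * X 1 1 - X 0 1 * X 1 0) * (X 2 2 * X 3 3 - X 2 3 * X 3 2) -
    (X 0 0 * X 1 2 - X 0 2 * X 1 0) * (X 2 1 * X 3 3 - X 2 3 * X 3 1) +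
    (X 0 0 * X 1 3 - X 0 3 * X 1 0) * (X 2 1 * X 3 2 - X 2 2 * X 3 1) +
    (X 0 1 * X 1 2 - X 0 2 * X 1 1) * (X 2 0 * X 3 3 - X 2 3 * X 3 0) -
    (X 0 1 * X 1 3 - X 0 3 * X 1 1) * (X 2 0 * X 3 2 - X 2 2 * X 3 0) +
    (X 0 2 * X 1 3 - X 0 3 * X 1 2) * (X 2 0 * X 3 1 - X 2 1 * X 3 0) := by
  simp [Matrix.det_succ_row_zero, Fin.sum_univ_succ, Fin.succAbove]
  ring

/-- Entrywise bounds with row sums less than one. -/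
lemma sum_abs_lt_one_of_bound {X : Matrix (Fin 4) (Fin 4) ℝ} {b : Matrix (Fin 4) (Fin 4) ℝ}
    (h : ∀ i j, -b i j ≤ X i j ∧ X i j ≤ b i j) (hb : ∀ i, ∑ j, b i j < 1) (i : Fin 4) :
    ∑ j, |X i j| < 1 :=
  (Finset.sum_le_sum fun j _ => abs_le.2 (h i j)).trans_lt (hb i)

/-- The conditions on single rows and columns of the coefficients, combined. -/
lemma PeerTriplet.orderConditions_of_forall {M : PeerTriplet} {Λ : Set ℝ}
    (hc : Function.Injective M.c) (hdet : M.A.det ≠ 0 ∧ M.A0.det ≠ 0 ∧ M.AN.det ≠ 0 ∧ M.W.det ≠ 0)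
    (hatA_eq : ∃ a b c d e f g : ℝ, M.hatA =
      !![1, 1, 1, a; 0, 1 / 2, 2 / 3, b; 0, 1 / 3, 1 / 2, c; d, e, f, g])
    (diag_K : ∃ k : Fin 4 → ℝ, M.K = Matrix.diagonal k)
    (hpow : ∀ k : ℕ, k ≤ 3 → ∑ i, M.K i i * M.c i ^ k = 1 / (k + 1) ∧
      (k ≤ 2 → ∑ j, M.w j * M.c j ^ k = 1))
    (hrow : ∀ i, 0 ≤ M.c i ∧ ∑ j, M.A0 i j * M.c j = ∑ j, M.K0 i j ∧
      ∑ j, M.A0 i j * M.c j ^ 2 = 2 * ∑ j, M.K0 i j * M.c j ∧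
      ∑ j, M.AN i j = ∑ j, M.A i j ∧
      ∑ j, M.AN i j * M.c j - ∑ j, M.KN i j = ∑ j, M.A i j * M.c j - ∑ j, M.K i j ∧
      ∑ j, M.AN i j * M.c j ^ 2 - 2 * ∑ j, M.KN i j * M.c j =
        ∑ j, M.A i j * M.c j ^ 2 - 2 * ∑ j, M.K i j * M.c j)
    (hcol : ∀ j, ∑ i, M.A0 i j = ∑ i, M.A i j ∧
      ∑ i, M.A0 i j * M.c i + ∑ i, M.K0 i j = ∑ i, M.A i j * M.c i + ∑ i, M.K i j ∧
      ∑ i, M.A0 i j * M.c i ^ 2 + 2 * ∑ i, M.K0 i j * M.c i =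
        ∑ i, M.A i j * M.c i ^ 2 + 2 * ∑ i, M.K i j * M.c i ∧
      ∑ i, M.AN i j * M.c i + ∑ i, M.KN i j = M.w j ∧
      ∑ i, M.AN i j * M.c i ^ 2 + 2 * ∑ i, M.KN i j * M.c i = M.w j ∧
      ∑ i, M.K0 i j * M.c i = colSum M.K0 j * M.c j ∧
      ∑ i, M.KN i j * M.c i = colSum M.KN j * M.c j)
    (hsum : ∀ i, (colSum M.K i ∈ Λ ∧ colSum M.K0 i ∈ Λ ∧ colSum M.KN i ∈ Λ) ∧
      colSum M.K i ≠ 0 ∧ colSum M.K0 i ≠ 0 ∧ colSum M.KN i ≠ 0) : M.OrderConditions Λ where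
  c_nonneg i := (hrow i).1
  det_V := Matrix.det_vandermonde_ne_zero_iff.2 hc
  det_A := hdet.1
  det_A0 := hdet.2.1
  det_AN := hdet.2.2.1
  det_W := hdet.2.2.2
  hatA_eq := hatA_eq
  diag_K := diag_K
  quad k hk := (hpow k hk).1
  start_one i := (hrow i).2.1
  start_two i := (hrow i).2.2.1
  start_adj_zero j := (hcol j).1
  start_adj_one j := (hcol j).2.1
  start_adj_two j := (hcol j).2.2.1
  end_zero i := (hrow i).2.2.2.1
  end_one i := (hrow i).2.2.2.2.1
  end_two i := (hrow i).2.2.2.2.2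
  w_pow k hk := (hpow k (by omega)).2 hk
  end_adj_one j := (hcol j).2.2.2.1
  end_adj_two j := (hcol j).2.2.2.2.1
  colSum_mem i := (hsum i).1
  colSum_ne i := (hsum i).2
  start_mean j := (hcol j).2.2.2.2.2.1
  end_mean j := (hcol j).2.2.2.2.2.2

/-! ### The triplet for general grids -/

namespace AP4o33vg

lemma hatA_eq : AP4o33vg.hatA = !![1, 1, 1, 1; 0, 1 / 2, 2 / 3, 7 / 9; 0, 1 / 3, 1 / 2, 35 / 54;
    0, 5 / 18, 11 / 27, 46 / 81] := by
  ext i j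
  revert i j
  refine forall_fin_four ?_ ?_ ?_ ?_ <;> refine forall_fin_four ?_ ?_ ?_ ?_ <;>
  simp only [PeerTriplet.hatA, Matrix.mul_apply, Fin.sum_univ_four, PeerTriplet.V, AP4o33vg,
    Matrix.transpose_apply, Matrix.of_apply, Matrix.cons_val] <;> norm_num

lemma orderConditions : AP4o33vg.OrderConditions (Ioi 0) := by
  refine PeerTriplet.orderConditions_of_forall (fun i j => ?_) ?_ ⟨_, _, _, _, _, _, _, hatA_eq⟩
    ⟨_, rfl⟩ (fun k hk => ?_) ?_ ?_ ?_
  · revert i j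
    refine forall_fin_four ?_ ?_ ?_ ?_ <;> refine forall_fin_four ?_ ?_ ?_ ?_ <;>
      simp only [AP4o33vg, Matrix.cons_val] <;> norm_num
  · simp only [det_four, AP4o33vg, Matrix.of_apply, Matrix.cons_val]
    norm_num
  · interval_cases k <;> simp only [AP4o33vg, PeerTriplet.w, diagonal_four, Fin.sum_univ_four,
      Matrix.of_apply, Matrix.cons_val] <;> norm_num
  · refine forall_fin_four ?_ ?_ ?_ ?_ <;> simp only [AP4o33vg, diagonal_four, Fin.sum_univ_four,
      Matrix.of_apply, Matrix.cons_val] <;> norm_num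
  · refine forall_fin_four ?_ ?_ ?_ ?_ <;> simp only [AP4o33vg, PeerTriplet.w, colSum,
      diagonal_four, Fin.sum_univ_four, Matrix.of_apply, Matrix.cons_val] <;> norm_num
  · refine forall_fin_four ?_ ?_ ?_ ?_ <;> simp only [AP4o33vg, colSum, diagonal_four,
      Fin.sum_univ_four, Matrix.of_apply, Matrix.cons_val, mem_Ioi] <;> norm_num

lemma isDamped : AP4o33vg.IsDamped (Icc 0.5 1.8) := by
  refine orderConditions.isDamped_of_hat (by unfold AP4o33vg; fun_prop) (lo := 0.5) (hi := 1.8)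
    (by norm_num) subset_rfl (T := Matrix.diagonal ![1, 13 / 20, 100, 1])
    (T' := Matrix.diagonal ![1, 20 / 13, 1 / 100, 1]) ?_ (γ := 9 / 10) (by norm_num)
    (fun σ => !![0, 0, 0, 0; 0, -1 / 16 * σ⁻¹, -3 / 8 * σ⁻¹, 9 / 16 * σ⁻¹; 0, 0, 0, 0;
      0, -117 / 5360 + σ / 36 - 9 / 80 * σ ^ 2, -351 / 2680 + 3 / 2 * σ - 27 / 40 * σ ^ 2,
      1053 / 5360 - 7 / 4 * σ + 81 / 80 * σ ^ 2]) (fun σ _ => ?_) fun σ hσ => ?_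
  · rw [Matrix.diagonal_mul_diagonal, ← Matrix.diagonal_one]
    congr 1
    funext i
    revert i
    refine forall_fin_four ?_ ?_ ?_ ?_ <;> simp only [Matrix.cons_val] <;> norm_num
  · have hK : AP4o33vg.hatK 2 2 = 11 / 54 := by
      simp only [PeerTriplet.hatK, Matrix.mul_apply, Fin.sum_univ_four, PeerTriplet.V, AP4o33vg,
        diagonal_four, Matrix.transpose_apply, Matrix.of_apply, Matrix.cons_val]
      norm_num
    have hb : AP4o33vg.b44 σ = 13 / 1340 + σ ^ 2 / 20 := rfl
    ext i j
    revert i j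
    refine forall_fin_four ?_ ?_ ?_ ?_ <;> refine forall_fin_four ?_ ?_ ?_ ?_ <;>
      simp only [PeerTriplet.hatRest, PeerTriplet.hatB, hatA_eq, hK, Matrix.mul_apply,
        Matrix.sub_apply, Fin.sum_univ_four, Matrix.of_apply, Matrix.cons_val, hb] <;> ring
  · obtain ⟨h1, h2⟩ := hσ
    norm_num at h1 h2
    have hi : σ⁻¹ ≤ 2 := by
      rw [inv_le_comm₀ (by linarith) (by norm_num)]; linarith
    have hi0 : 0 < σ⁻¹ := inv_pos.2 (by linarith)
    have h3 := mul_nonneg (sub_nonneg.2 h1) (sub_nonneg.2 h2)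
    refine forall_fin_four ?_ ?_ ?_ ?_ <;>
      simp only [diagonal_four, Matrix.mul_apply, Fin.sum_univ_four, Matrix.of_apply,
        Matrix.cons_val, mul_zero, zero_mul, add_zero, zero_add, abs_zero]
    · norm_num
    · rcases abs_cases (13 / 20 * (-1 / 16 * σ⁻¹) * (20 / 13)) with a | a <;>
      rcases abs_cases (13 / 20 * (-3 / 8 * σ⁻¹) * (1 / 100)) with b | b <;>
      rcases abs_cases (13 / 20 * (9 / 16 * σ⁻¹) * 1) with c | c <;> linarith
    · norm_num
    · have ha : |-117 / 5360 + σ / 36 - 9 / 80 * σ ^ 2| ≤ 117 / 5360 - σ / 36 + 9 / 80 * σ ^ 2 := by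
        rw [abs_le]
        constructor <;> nlinarith [sq_nonneg (σ - 1 / 8)]
      have hb : |-351 / 2680 + 3 / 2 * σ - 27 / 40 * σ ^ 2| ≤ 71 / 100 := by
        rw [abs_le]
        constructor <;> nlinarith [sq_nonneg (σ - 10 / 9)]
      have hc : |1053 / 5360 - 7 / 4 * σ + 81 / 80 * σ ^ 2| ≤
          22 / 25 - 20 / 13 * (117 / 5360 - σ / 36 + 9 / 80 * σ ^ 2) := by
        rw [abs_le]
        constructor <;> nlinarith [sq_nonneg (σ - 1)]
      rw [abs_mul, abs_mul _ (1 / 100 : ℝ), one_mul, one_mul, one_mul, mul_one,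
        abs_of_pos (by norm_num : (0 : ℝ) < 20 / 13), abs_of_pos (by norm_num : (0 : ℝ) < 1 / 100)]
      linarith

end AP4o33vg

/-! ### The triplet for smooth grids with diagonal boundary matrices -/

namespace AP4o33vs

lemma hatA_eq : AP4o33vs.hatA =
    !![1, 1, 1, 1; 0, 1 / 2, 2 / 3, 1352355823 / 1749009504; 0, 1 / 3, 1 / 2,
      33148755468968855 / 51550422867280392; 1010743874247749 / 10000000000000000,
      349532089405541260166685328153 / 1378353552601080000000000000000,
      215358472936832923215388872526200541 / 537155406277061684640000000000000000,
      815014860726097769833585087417462851205601939627 / 1451745220668361648532674664085120000000000000000] := by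
  ext i j
  revert i j
  refine forall_fin_four ?_ ?_ ?_ ?_ <;> refine forall_fin_four ?_ ?_ ?_ ?_ <;>
  simp only [PeerTriplet.hatA, Matrix.mul_apply, Fin.sum_univ_four, PeerTriplet.V, AP4o33vs,
    Matrix.transpose_apply, Matrix.of_apply, Matrix.cons_val] <;> norm_num

lemma hatK_eq : AP4o33vs.hatK 2 2 = 41589769382194639 / 206201691469121568 := by
  simp only [PeerTriplet.hatK, Matrix.mul_apply, Fin.sum_univ_four, PeerTriplet.V, AP4o33vs,
    diagonal_four, Matrix.transpose_apply, Matrix.of_apply, Matrix.cons_val]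
  norm_num

lemma orderConditions : AP4o33vs.OrderConditions (Ioi 0) := by
  refine PeerTriplet.orderConditions_of_forall (fun i j => ?_) ?_ ⟨_, _, _, _, _, _, _, hatA_eq⟩
    ⟨_, rfl⟩ (fun k hk => ?_) ?_ ?_ ?_
  · revert i j
    refine forall_fin_four ?_ ?_ ?_ ?_ <;> refine forall_fin_four ?_ ?_ ?_ ?_ <;>
      simp only [AP4o33vs, Matrix.cons_val] <;> norm_num
  · simp only [det_four, AP4o33vs, Matrix.of_apply, Matrix.cons_val]
    norm_num
  · interval_cases k <;> simp only [AP4o33vs, PeerTriplet.w, diagonal_four, Fin.sum_univ_four,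
      Matrix.of_apply, Matrix.cons_val] <;> norm_num
  · refine forall_fin_four ?_ ?_ ?_ ?_ <;> simp only [AP4o33vs, diagonal_four, Fin.sum_univ_four,
      Matrix.of_apply, Matrix.cons_val] <;> norm_num
  · refine forall_fin_four ?_ ?_ ?_ ?_ <;> simp only [AP4o33vs, PeerTriplet.w, colSum,
      diagonal_four, Fin.sum_univ_four, Matrix.of_apply, Matrix.cons_val] <;> norm_num
  · refine forall_fin_four ?_ ?_ ?_ ?_ <;> simp only [AP4o33vs, colSum, diagonal_four,
      Fin.sum_univ_four, Matrix.of_apply, Matrix.cons_val, mem_Ioi] <;> norm_num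

lemma exists_isDamped : ∃ δ > 0, AP4o33vs.IsDamped (Icc (1 - δ) (1 + δ)) := by
  -- `E` maps into the second and fourth coordinates. The large weights of the other two make their
  -- influence small, and the shear adapts the remaining block of order two.
  refine orderConditions.exists_isDamped (by unfold AP4o33vs; fun_prop)
    (T := !![1000, 0, 0, 0; 0, 1, 0, 29 / 25; 0, 0, 1000, 0; 0, 0, 0, 1 / 10])
    (T' := !![1 / 1000, 0, 0, 0; 0, 1, 0, -58 / 5; 0, 0, 1 / 1000, 0; 0, 0, 0, 10])
    (E := !![0, 0, 0, 0;
        -533408432486692675996883882837988014710676 / 661101596237020193443939822091184363136425,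
        4501470761982978869113809581857613240434241 / 661101596237020193443939822091184363136425,
        -18333608310698882430246618361660984408075421 / 1322203192474040386887879644182368726272850,
        211095390663113134492624129600000000000000 / 26444063849480807737757592883647374525457; 0,
        0, 0, 0;
        20656923724747611668275690500636594718715473560175522495198488960067 / 33549827587049913178089390544292820184681202456718750000000000000000,
        -189382641161855275505872100976184036191106476892940270426096172219056012310417290831 / 36504357616365192444682693394505253787676392772709705594842617812500000000000000000,
        8496616987356354656334995700482319965510389995930767716617980970533148788777377004821 / 803095867560034233783019254679115583328880640999613523086537591875000000000000000000,
        -20437347433959594078983886106800599732986095522878183 / 3354982758704991317808939054429282018468120245671875])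
    ?_ ?_ (sum_abs_lt_one_of_bound
      (b := !![0, 0, 0, 0; 1 / 100, 4 / 5, 1 / 100, 1 / 50; 0, 0, 0, 0; 1 / 100, 11 / 20, 1 / 100,
        1 / 10]) ?_ ?_)
  · ext i j
    revert i j
    refine forall_fin_four ?_ ?_ ?_ ?_ <;> refine forall_fin_four ?_ ?_ ?_ ?_ <;>
      simp only [Matrix.mul_apply, Fin.sum_univ_four, Matrix.of_apply, Matrix.cons_val,
        one_four] <;> norm_num
  · have hb : AP4o33vs.b44 1 = 443686006825938533 / 5000000000000000000 := by
      simp only [AP4o33vs]; norm_num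
    ext i j
    revert i j
    refine forall_fin_four ?_ ?_ ?_ ?_ <;> refine forall_fin_four ?_ ?_ ?_ ?_ <;>
      simp only [PeerTriplet.hatRest, PeerTriplet.hatB, hatA_eq, hatK_eq, Matrix.mul_apply,
        Matrix.sub_apply, Fin.sum_univ_four, Matrix.of_apply, Matrix.cons_val, hb] <;> norm_num
  · refine forall_fin_four ?_ ?_ ?_ ?_ <;> refine forall_fin_four ?_ ?_ ?_ ?_ <;>
      simp only [Matrix.mul_apply, Fin.sum_univ_four, Matrix.of_apply, Matrix.cons_val] <;>
      norm_num
  · refine forall_fin_four ?_ ?_ ?_ ?_ <;>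
      simp only [Fin.sum_univ_four, Matrix.of_apply, Matrix.cons_val] <;> norm_num

end AP4o33vs

/-! ### The A-stable triplet -/

namespace AP4o33va

lemma hatA_eq : AP4o33va.hatA =
    !![1, 1, 1, 51 / 46; 0, 1 / 2, 2 / 3, 130109 / 358938; 0, 1 / 3, 1 / 2,
      -554877447145 / 1114935369228; 129 / 28, -167255 / 9318618, -23930957 / 950499036,
      -8721237185033646667 / 3463218933508228968] := by
  ext i j
  revert i j
  refine forall_fin_four ?_ ?_ ?_ ?_ <;> refine forall_fin_four ?_ ?_ ?_ ?_ <;>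
  simp only [PeerTriplet.hatA, Matrix.mul_apply, Fin.sum_univ_four, PeerTriplet.V, AP4o33va,
    Matrix.transpose_apply, Matrix.of_apply, Matrix.cons_val] <;> norm_num

lemma hatK_eq : AP4o33va.hatK 2 2 = -23930957 / 1900998072 := by
  simp only [PeerTriplet.hatK, Matrix.mul_apply, Fin.sum_univ_four, PeerTriplet.V, AP4o33va,
    diagonal_four, Matrix.transpose_apply, Matrix.of_apply, Matrix.cons_val]
  norm_num

lemma orderConditions : AP4o33va.OrderConditions {r | r ≠ 0} := by
  refine PeerTriplet.orderConditions_of_forall (fun i j => ?_) ?_ ⟨_, _, _, _, _, _, _, hatA_eq⟩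
    ⟨_, rfl⟩ (fun k hk => ?_) ?_ ?_ ?_
  · revert i j
    refine forall_fin_four ?_ ?_ ?_ ?_ <;> refine forall_fin_four ?_ ?_ ?_ ?_ <;>
      simp only [AP4o33va, Matrix.cons_val] <;> norm_num
  · simp only [det_four, AP4o33va, Matrix.of_apply, Matrix.cons_val]
    norm_num
  · interval_cases k <;> simp only [AP4o33va, PeerTriplet.w, diagonal_four, Fin.sum_univ_four,
      Matrix.of_apply, Matrix.cons_val] <;> norm_num
  · refine forall_fin_four ?_ ?_ ?_ ?_ <;> simp only [AP4o33va, diagonal_four, Fin.sum_univ_four,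
      Matrix.of_apply, Matrix.cons_val] <;> norm_num
  · refine forall_fin_four ?_ ?_ ?_ ?_ <;> simp only [AP4o33va, PeerTriplet.w, colSum,
      diagonal_four, Fin.sum_univ_four, Matrix.of_apply, Matrix.cons_val] <;> norm_num
  · refine forall_fin_four ?_ ?_ ?_ ?_ <;> simp only [AP4o33va, colSum, diagonal_four,
      Fin.sum_univ_four, Matrix.of_apply, Matrix.cons_val, mem_ofPred_eq] <;> norm_num

lemma exists_isDamped : ∃ δ > 0, AP4o33va.IsDamped (Icc (1 - δ) (1 + δ)) := by
  -- The third row of `E` is nearly `1.288` times the second, which the shear removes. The weights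
  -- make the influence of the first and third coordinates small.
  refine orderConditions.exists_isDamped (by unfold AP4o33va; fun_prop)
    (T := !![10, 0, 0, 0; 0, 1, 0, 0; 0, -322 / 25, 10, 0; 0, 0, 0, 1 / 2])
    (T' := !![1 / 10, 0, 0, 0; 0, 1, 0, 0; 0, 161 / 125, 1 / 10, 0; 0, 0, 0, 2])
    (E := !![0, 0, 0, 0; 1884326817520631430603 / 13309551580693429962980,
        -5657263823529505791237 / 6654775790346714981490,
        2824197043469039706393 / 3327387895173357490745,
        -102250292423600155149 / 3327387895173357490745;
        242702507180819287989 / 1330955158069342996298,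
        -2185977667441851463793 / 1996432737104014494447,
        727516794697518925518 / 665477579034671498149,
        -26339806980864108774 / 665477579034671498149;
        2110601081181596358946551 / 2049670943426788214298920,
        -21847417660011125677838425646651 / 4775025136873462583988443323140,
        138474156069053971151267534069 / 46813971930131986117533758070,
        -16361248691330204332919 / 73202533693813864796390])
    ?_ ?_ (sum_abs_lt_one_of_bound
      (b := !![0, 0, 0, 0; 1 / 20, 1 / 4, 1 / 10, 1 / 10; 1 / 100, 1 / 100, 1 / 100, 1 / 100;
        1 / 10, 2 / 5, 1 / 5, 1 / 4]) ?_ ?_)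
  · ext i j
    revert i j
    refine forall_fin_four ?_ ?_ ?_ ?_ <;> refine forall_fin_four ?_ ?_ ?_ ?_ <;>
      simp only [Matrix.mul_apply, Fin.sum_univ_four, Matrix.of_apply, Matrix.cons_val,
        one_four] <;> norm_num
  · have hb : AP4o33va.b44 1 = 81 / 22 := by
      simp only [AP4o33va]; norm_num
    ext i j
    revert i j
    refine forall_fin_four ?_ ?_ ?_ ?_ <;> refine forall_fin_four ?_ ?_ ?_ ?_ <;>
      simp only [PeerTriplet.hatRest, PeerTriplet.hatB, hatA_eq, hatK_eq, Matrix.mul_apply,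
        Matrix.sub_apply, Fin.sum_univ_four, Matrix.of_apply, Matrix.cons_val, hb] <;> norm_num
  · refine forall_fin_four ?_ ?_ ?_ ?_ <;> refine forall_fin_four ?_ ?_ ?_ ?_ <;>
      simp only [Matrix.mul_apply, Fin.sum_univ_four, Matrix.of_apply, Matrix.cons_val] <;>
      norm_num
  · refine forall_fin_four ?_ ?_ ?_ ?_ <;>
      simp only [Fin.sum_univ_four, Matrix.of_apply, Matrix.cons_val] <;> norm_num

end AP4o33va

/-! ### The triplet with entries in `ℚ(√29)` -/

namespace AP4o43vs

/-- The reduction of polynomials in `√29`, up to the degree `7` of the entries of `V^T A V`. -/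
lemma sqrt_pow : √29 ^ 2 = (29 : ℝ) ∧ √29 ^ 3 = 29 * √29 ∧ √29 ^ 4 = (29 : ℝ) ^ 2 ∧
    √29 ^ 5 = 29 ^ 2 * √29 ∧ √29 ^ 6 = (29 : ℝ) ^ 3 ∧ √29 ^ 7 = 29 ^ 3 * √29 := by
  have h : √29 ^ 2 = (29 : ℝ) := Real.sq_sqrt (by norm_num)
  refine ⟨h, ?_, ?_, ?_, ?_, ?_⟩
  · rw [pow_succ, h]
  · rw [pow_mul √29 2 2, h]
  · rw [pow_succ, pow_mul √29 2 2, h]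
  · rw [pow_mul √29 2 3, h]
  · rw [pow_succ, pow_mul √29 2 3, h]

lemma lt_sqrt : 5.38516480 < √29 := Real.lt_sqrt_of_sq_lt (by norm_num)

lemma sqrt_lt : √29 < 5.38516481 := (Real.sqrt_lt' (by norm_num)).2 (by norm_num)

lemma hatA_eq : AP4o43vs.hatA =
    !![1, 1, 1, 1; 0, 1 / 2, 2 / 3, (187 - √29) / 240; 0, 1 / 3, 1 / 2, (127 - √29) / 200;
      -157 / 359, (30573 + 4351 * √29) / 215400, (760121 + 23277 * √29) / 2154000,
      (1395859 - 3892 * √29) / 2692500] := by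
  ext i j
  revert i j
  refine forall_fin_four ?_ ?_ ?_ ?_ <;> refine forall_fin_four ?_ ?_ ?_ ?_ <;>
  simp only [PeerTriplet.hatA, Matrix.mul_apply, Fin.sum_univ_four, PeerTriplet.V_eq, AP4o43vs,
    Matrix.transpose_apply, Matrix.of_apply, Matrix.cons_val] <;> ring_nf <;>
    try (simp only [sqrt_pow]; ring_nf)

lemma hatK_eq : AP4o43vs.hatK 2 2 = (127 - √29) / 600 := by
  simp only [PeerTriplet.hatK, Matrix.mul_apply, Fin.sum_univ_four, PeerTriplet.V_eq, AP4o43vs,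
    diagonal_four, Matrix.transpose_apply, Matrix.of_apply, Matrix.cons_val]
  ring_nf
  simp only [sqrt_pow]
  ring_nf

lemma orderConditions : AP4o43vs.OrderConditions (Ioi 0) := by
  have h1 := lt_sqrt
  have h2 := sqrt_lt
  have hsum : ∀ i, 0 < colSum AP4o43vs.K i ∧ 0 < colSum AP4o43vs.K0 i ∧
      0 < colSum AP4o43vs.KN i := by
    refine forall_fin_four ?_ ?_ ?_ ?_ <;> simp only [AP4o43vs, colSum, diagonal_four,
      Fin.sum_univ_four, Matrix.of_apply, Matrix.cons_val] <;> refine ⟨?_, ?_, ?_⟩ <;> linarith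
  refine PeerTriplet.orderConditions_of_forall (fun i j => ?_) ⟨?_, ?_, ?_, ?_⟩
    ⟨_, _, _, _, _, _, _, hatA_eq⟩ ⟨_, rfl⟩ (fun k hk => ?_) (fun i => ⟨?_, ?_, ?_, ?_, ?_, ?_⟩)
    (fun i => ⟨?_, ?_, ?_, ?_, ?_, ?_, ?_⟩) fun i =>
      ⟨hsum i, (hsum i).1.ne', (hsum i).2.1.ne', (hsum i).2.2.ne'⟩
  · revert i j
    refine forall_fin_four ?_ ?_ ?_ ?_ <;> refine forall_fin_four ?_ ?_ ?_ ?_ <;>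
      simp only [AP4o43vs, Matrix.cons_val] <;> intro h <;> first | trivial | (exfalso; linarith)
  · have h : AP4o43vs.A.det = (604421912 + 160547656 * √29) / 95556825 := by
      simp only [det_four, AP4o43vs, Matrix.of_apply, Matrix.cons_val]
      ring_nf
      simp only [sqrt_pow]
      ring_nf
    rw [h]
    exact ne_of_gt (by linarith)
  · have h : AP4o43vs.A0.det = (-1374973 - 262099 * √29) / 163800 := by
      simp only [det_four, AP4o43vs, Matrix.of_apply, Matrix.cons_val]
      ring_nf
      simp only [sqrt_pow]
      ring_nf
    rw [h]
    exact ne_of_lt (by linarith)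
  · have h : AP4o43vs.AN.det = (25582161289 + 4214130857 * √29) / 3057818400 := by
      simp only [det_four, AP4o43vs, Matrix.of_apply, Matrix.cons_val]
      ring_nf
      simp only [sqrt_pow]
      ring_nf
    rw [h]
    exact ne_of_gt (by linarith)
  · simp only [det_four, AP4o43vs, Matrix.of_apply, Matrix.cons_val]
    norm_num
  · refine ⟨?_, fun hk' => ?_⟩ <;> interval_cases k <;>
      simp only [AP4o43vs, PeerTriplet.w, diagonal_four, Fin.sum_univ_four, Matrix.of_apply,
        Matrix.cons_val] <;> norm_num <;> ring_nf <;>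
      try (simp only [sqrt_pow]; ring_nf)
  · revert i
    refine forall_fin_four ?_ ?_ ?_ ?_ <;> simp only [AP4o43vs, Matrix.cons_val] <;> linarith
  all_goals
    revert i
    refine forall_fin_four ?_ ?_ ?_ ?_ <;> simp only [AP4o43vs, PeerTriplet.w, colSum,
      diagonal_four, Fin.sum_univ_four, Matrix.of_apply, Matrix.cons_val] <;> ring_nf <;>
      try (simp only [sqrt_pow]; ring_nf)

lemma exists_isDamped : ∃ δ > 0, AP4o43vs.IsDamped (Icc (1 - δ) (1 + δ)) := by
  have h1 := lt_sqrt
  have h2 := sqrt_lt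
  refine orderConditions.exists_isDamped (by unfold AP4o43vs; fun_prop) (T := 1) (T' := 1)
    (E := !![0, 0, 0, 0; (-108932409 + 25484083 * √29) / 339199791,
        (-320242893 + 6495911 * √29) / 678399582, (2282546177 - 364170609 * √29) / 1356799164,
        (-249087483 + 58272521 * √29) / 339199791; 0, 0, 0, 0;
        (150975034725 - 29231697806 * √29) / 121772724969,
        (3093817351533 - 530655289634 * √29) / 1217727249690,
        (-9860083834717 + 1822143445881 * √29) / 1217727249690,
        (961624425 - 186189158 * √29) / 339199791])
    (Matrix.one_mul 1) ?_ (sum_abs_lt_one_of_bound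
      (b := !![0, 0, 0, 0; 9 / 100, 43 / 100, 1 / 4, 1 / 5; 0, 0, 0, 0; 3 / 50, 1 / 5, 1 / 20,
        7 / 50]) ?_ ?_)
  · have hb : AP4o43vs.b44 1 = (-22211593 + 2408659 * √29) / 21540000 := by
      simp only [AP4o43vs]; ring
    ext i j
    revert i j
    refine forall_fin_four ?_ ?_ ?_ ?_ <;> refine forall_fin_four ?_ ?_ ?_ ?_ <;>
      simp only [PeerTriplet.hatRest, PeerTriplet.hatB, hatA_eq, hatK_eq, Matrix.mul_apply,
        Matrix.sub_apply, Fin.sum_univ_four, Matrix.of_apply, Matrix.cons_val, hb] <;>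
      ring_nf <;>
      try (simp only [sqrt_pow]; ring_nf)
  · rw [Matrix.one_mul, Matrix.mul_one]
    refine forall_fin_four ?_ ?_ ?_ ?_ <;> refine forall_fin_four ?_ ?_ ?_ ?_ <;>
      simp only [Matrix.of_apply, Matrix.cons_val] <;> constructor <;> linarith
  · refine forall_fin_four ?_ ?_ ?_ ?_ <;>
      simp only [Fin.sum_univ_four, Matrix.of_apply, Matrix.cons_val] <;> norm_num

end AP4o43vs

/-! ### Convergence of the four triplets -/

lemma IsGrid.ratio_mem_of_smooth {M : PeerTriplet} {lo hi T Tstar κ δ : ℝ} {N : ℕ} {h : ℕ → ℝ}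
    (hg : IsGrid M lo hi T Tstar N h) (hs : IsSmoothGrid κ N h) (hδ : 0 < δ)
    (hfine : ∀ n ≤ N, h n ≤ δ / (|κ| + 1)) {n : ℕ} (h1 : 1 ≤ n) (hn : n ≤ N) :
    ratio h n ∈ Icc (1 - δ) (1 + δ) := by
  have h2 : |ratio h n - 1| ≤ δ := by
    calc |ratio h n - 1| ≤ κ * h n := hs n h1 hn
      _ ≤ (|κ| + 1) * (δ / (|κ| + 1)) := by
        gcongr
        · exact (hg.pos n hn).le
        · linarith [le_abs_self κ]
        · exact hfine n hn
      _ = δ := by field_simp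
  rw [abs_le] at h2
  constructor <;> linarith [h2.1, h2.2]

/-- On fine smooth grids the stepsize ratios are close to one, so that damping near `σ = 1` is
sufficient. -/
theorem PeerTriplet.OrderConditions.convergesOn_smooth {M : PeerTriplet} {Λ : Set ℝ}
    (hM : M.OrderConditions Λ) (hd : ∃ δ > 0, M.IsDamped (Icc (1 - δ) (1 + δ))) {lo : ℝ}
    (hlo : 0 < lo) (hi : ℝ) :
    ∃ ζ : Zeta, ∀ (L : Bounds) (T κ : ℝ), ∃ μ > 0, ∀ (m d : ℕ) (Q : ControlProblem m d)
      (u : Vec m → Vec m → Vec d) (Tstar : ℝ) (y p : ℝ → Vec m),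
      IsRegularSolution Q u Λ L T Tstar y p → Contractive ζ L T →
      ConvergesOn M Q u y p (fun N h => IsGrid M lo hi T Tstar N h ∧ IsSmoothGrid κ N h)
        (fun N h => μ * (errorBound M Tstar y p N h + boundaryTerm M Tstar p N h)) := by
  obtain ⟨δ, hδ, hd⟩ := hd
  obtain ⟨ζ, hζ⟩ := hM.convergesOn hlo (hi := hi) hd
  refine ⟨ζ, fun L T κ => ?_⟩
  obtain ⟨μ, hμ, hc⟩ := hζ L T κ
  refine ⟨μ, hμ, fun m d Q u Tstar y p hr hcon => hc m d Q u Tstar y p _ hr hcon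
    ⟨δ / (|κ| + 1), by positivity, fun N h hg hf => ⟨hg.1, fun n h1 hn =>
      hg.1.ratio_mem_of_smooth hg.2 hδ hf h1 hn, Or.inr hg.2⟩⟩⟩

end

theorem corollary3 :
    -- the triplet for general grids
    (∃ ζ : Zeta, ∀ (L : Bounds) (T : ℝ), ∃ μ > 0, ∀ (m d : ℕ) (Q : ControlProblem m d)
      (u : Vec m → Vec m → Vec d) (Tstar : ℝ) (y p : ℝ → Vec m),
      IsRegularSolution Q u (Set.Ioi 0) L T Tstar y p → Contractive ζ L T →
      ConvergesOn AP4o33vg Q u y p (fun N h => IsGrid AP4o33vg 0.5 1.8 T Tstar N h)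
        (fun N h => μ * errorBound AP4o33vg Tstar y p N h)) ∧
    -- the triplet for smooth grids with diagonal matrices in the boundary steps
    (∃ ζ : Zeta, ∀ (L : Bounds) (T κ : ℝ), ∃ μ > 0, ∀ (m d : ℕ) (Q : ControlProblem m d)
      (u : Vec m → Vec m → Vec d) (Tstar : ℝ) (y p : ℝ → Vec m),
      IsRegularSolution Q u (Set.Ioi 0) L T Tstar y p → Contractive ζ L T →
      ConvergesOn AP4o33vs Q u y p
        (fun N h => IsGrid AP4o33vs 0.65 1.80 T Tstar N h ∧ IsSmoothGrid κ N h)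
        (fun N h => μ * errorBound AP4o33vs Tstar y p N h)) ∧
    -- the two triplets for smooth grids with full matrices in the boundary steps
    (∀ (M : PeerTriplet) (Λ : Set ℝ) (lo hi : ℝ),
      (M = AP4o43vs ∧ Λ = Set.Ioi 0 ∧ lo = 0.47 ∧ hi = 1.79) ∨
        (M = AP4o33va ∧ Λ = {r | r ≠ 0} ∧ lo = 0.61 ∧ hi = 1.52) →
      ∃ ζ : Zeta, ∀ (L : Bounds) (T κ : ℝ), ∃ μ > 0, ∀ (m d : ℕ) (Q : ControlProblem m d)
        (u : Vec m → Vec m → Vec d) (Tstar : ℝ) (y p : ℝ → Vec m),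
        IsRegularSolution Q u Λ L T Tstar y p → Contractive ζ L T →
        ConvergesOn M Q u y p (fun N h => IsGrid M lo hi T Tstar N h ∧ IsSmoothGrid κ N h)
          (fun N h => μ * (errorBound M Tstar y p N h + boundaryBound M Tstar p N h)) ∧
        ((∃ t ∈ Set.Icc 0 T, iteratedDerivWithin 3 y (Set.Icc 0 Tstar) t ≠ 0 ∨
            iteratedDerivWithin 3 p (Set.Icc 0 Tstar) t ≠ 0) →
          ∃ μ' > 0, ConvergesOn M Q u y p
            (fun N h => IsGrid M lo hi T Tstar N h ∧ IsSmoothGrid κ N h)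
            (fun N h => μ' * errorBound M Tstar y p N h))) := by
  refine ⟨?_, ?_, ?_⟩
  · obtain ⟨ζ, hζ⟩ := AP4o33vg.orderConditions.convergesOn (lo := 0.5) (by norm_num) (hi := 1.8)
      AP4o33vg.isDamped
    refine ⟨ζ, fun L T => ?_⟩
    obtain ⟨μ, hμ, hc⟩ := hζ L T 0
    refine ⟨μ, hμ, fun m d Q u Tstar y p hr hcon => (hc m d Q u Tstar y p _ hr hcon
      ⟨1, one_pos, fun N h hg _ => ⟨hg, hg.ratio_mem, Or.inl ?_⟩⟩).mono
        ⟨1, one_pos, fun N h _ _ => ?_⟩⟩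
    · simp [AP4o33vg.hatA_eq]
    · rw [boundaryTerm, if_pos ⟨⟨_, rfl⟩, ⟨_, rfl⟩⟩, add_zero]
  · obtain ⟨ζ, hζ⟩ := AP4o33vs.orderConditions.convergesOn_smooth AP4o33vs.exists_isDamped
      (lo := 0.65) (by norm_num) 1.80
    refine ⟨ζ, fun L T κ => ?_⟩
    obtain ⟨μ, hμ, hc⟩ := hζ L T κ
    refine ⟨μ, hμ, fun m d Q u Tstar y p hr hcon => (hc m d Q u Tstar y p hr hcon).mono
      ⟨1, one_pos, fun N h _ _ => ?_⟩⟩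
    rw [boundaryTerm, if_pos ⟨⟨_, rfl⟩, ⟨_, rfl⟩⟩, add_zero]
  · intro M Λ lo hi hcase
    have hM : M.OrderConditions Λ ∧ (∃ δ > 0, M.IsDamped (Icc (1 - δ) (1 + δ))) ∧ 0 < lo := by
      rcases hcase with ⟨rfl, rfl, rfl, -⟩ | ⟨rfl, rfl, rfl, -⟩
      · exact ⟨AP4o43vs.orderConditions, AP4o43vs.exists_isDamped, by norm_num⟩
      · exact ⟨AP4o33va.orderConditions, AP4o33va.exists_isDamped, by norm_num⟩
    obtain ⟨ζ, hζ⟩ := hM.1.convergesOn_smooth hM.2.1 hM.2.2 hi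
    refine ⟨ζ, fun L T κ => ?_⟩
    obtain ⟨μ, hμ, hc⟩ := hζ L T κ
    refine ⟨μ, hμ, fun m d Q u Tstar y p hr hcon => ?_⟩
    have hconv := (hc m d Q u Tstar y p hr hcon).mono
      (b' := fun N h => μ * (errorBound M Tstar y p N h + boundaryBound M Tstar p N h))
      ⟨1, one_pos, fun N h hg _ =>
        mul_le_mul_of_nonneg_left (add_le_add le_rfl (boundaryTerm_le hg.1 p)) hμ.le⟩
    refine ⟨hconv, fun hne => ?_⟩
    obtain ⟨C, hC, H, hH, hb⟩ := exists_boundaryBound_le (M := M) (κ := κ) hr.Tstar_pos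
      hr.smooth_y hr.smooth_p hne
    have hC' : 0 ≤ C := hC
    refine ⟨μ * (1 + C), by positivity, hconv.mono ⟨H, hH, fun N h hg hf => ?_⟩⟩
    rw [mul_assoc]
    refine mul_le_mul_of_nonneg_left ?_ hμ.le
    linarith [hb hg.1 hg.2 hf]
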